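/- All graphs are finite, undirected and simple. A graph $G$ is $k$-thin if there are a strict total order $<$ on $V(G)$ and a partition of $V(G)$ into $k$ classes such that, for all vertices $u<v<w$ with $u,v$ in the same class and $uw\in E(G)$, also $vw\in E(G)$; the thinness $\mathrm{thin}(G)$ is the least such $k$. A twin-cover of $G$ is a set $X\subseteq V(G)$ such that every edge $ab$ of $G$ has $a\in X$, or $b\in X$, or $N[a]=N[b]$; $\mathrm{tc}(G)$ is the minimum size of a twin-cover of $G$, and $\mathrm{vc}(G)$ is the minimum size of a vertex cover of $G$. A module of $G$ is a set $M\subseteq V(G)$ such that every vertex outside $M$ is adjacent to all or to none of the vertices of $M$. The cluster-modular cardinality $\mathrm{cluster}\text{-}\mathrm{mc}(G)$ is the minimum number of parts in a partition of $V(G)$ into modules each of which induces a disjoint union of cliques. For a graph parameter $p$, the problem Thinness parameterized by $p$ consists of the instances $((G,t),k)$, where $G$ is a graph given by its adjacency matrix, $t\in\mathbb{N}$ (given in unary), and $k\in\mathbb{N}$ is a number that bounds the parameter; $((G,t),k)$ is a yes-instance if and only if $p(G)\le k$ and $\mathrm{thin}(G)\le t$. A parameterized problem $Q\subseteq\{0,1\}^*\times\mathbb{N}$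 is fixed-parameter tractable (FPT) if membership of $(x,k)$ in $Q$ can be decided in time $f(k)\cdot(|x|+1)^{O(1)}$ for some computable function $f$. A kernelization for $Q$ is a polynomial-time algorithm that maps each instance $(x,k)$ to an instance $(x',k')$ with $(x',k')\in Q\iff(x,k)\in Q$ and $|x'|,k'\le g(k)$ for some computable function $g$. Time is measured on a random access machine whose arithmetic is addition and truncated subtraction. Theorem. Let $p$ be the twin-cover number $\mathrm{tc}$ or the vertex cover number $\mathrm{vc}$. 1. For every graph $G$, $\mathrm{cluster}\text{-}\mathrm{mc}(G)\le 2^{p(G)}+p(G)$. 2. Thinness parameterized by $p$ is FPT. 3. Thinness parameterized by $p$ has a kernel of size $O(2^k)$, counted in vertices: there are a constant $C$ and a kernelization that maps every $(x,k)$ to an instance $((G',t'),k')$ of Thinness parameterized by $p$ with $|V(G')|,\,t',\,k'\le C\cdot 2^k$. -/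

import Mathlib

namespace ThinFPT

universe u

section Graphs

variable {V : Type u}

/-- `G` is `k`-thin: there are a strict total order on the vertices and a partition of the vertices
into `k` classes (given by a colouring `c`, so that classes may be empty) such that every triple
`u < v < w` is consistent. -/
def IsThin (G : SimpleGraph V) (k : ℕ) : Prop :=
  ∃ lt : V → V → Prop, IsStrictTotalOrder V lt ∧ ∃ c : V → Fin k,
    ∀ u v w, lt u v → lt v w → c u = c v → G.Adj u w → G.Adj v w

/-- The thinness of a finite graph: the least `k` for which it is `k`-thin. -/
noncomputable def thinness (G : SimpleGraph V) : ℕ := sInf {k | IsThin G k}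

/-- The closed neighbourhood `N[v]`. -/
def closedNeighborSet (G : SimpleGraph V) (v : V) : Set V := insert v (G.neighborSet v)

/-- Every edge meets `X` or joins two twins. -/
def IsTwinCover (G : SimpleGraph V) (X : Set V) : Prop :=
  ∀ a b, G.Adj a b → a ∈ X ∨ b ∈ X ∨ closedNeighborSet G a = closedNeighborSet G b

/-- The minimum size of a twin-cover of a finite graph. -/
noncomputable def twinCoverNumber (G : SimpleGraph V) : ℕ :=
  sInf {k | ∃ X : Set V, X.Finite ∧ X.ncard = k ∧ IsTwinCover G X}

/-- The minimum size of a vertex cover of a finite graph, as a natural number. (Mathlib's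
`SimpleGraph.vertexCoverNum` has values in `ℕ∞`; it is finite when the graph is.) -/
noncomputable def vertexCoverNumber (G : SimpleGraph V) : ℕ := G.vertexCoverNum.toNat

/-- A module: every vertex outside `X` is adjacent to all of `X` or to nothing in `X`. -/
def IsModule (G : SimpleGraph V) (X : Set V) : Prop :=
  ∀ v, v ∉ X → (∀ x ∈ X, G.Adj v x) ∨ (∀ x ∈ X, ¬ G.Adj v x)

/-- A cluster graph is a disjoint union of cliques: every connected component is a clique. -/
def IsCluster (G : SimpleGraph V) : Prop :=
  ∀ C : G.ConnectedComponent, G.IsClique C.supp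

/-- A partition of the vertex set into modules, each inducing a graph of the class `𝒢`. -/
def IsModularPartition (𝒢 : ∀ ⦃W : Type u⦄, SimpleGraph W → Prop) (G : SimpleGraph V)
    (P : Set (Set V)) : Prop :=
  Setoid.IsPartition P ∧ ∀ M ∈ P, IsModule G M ∧ 𝒢 (G.induce M)

/-- The `𝒢`-modular cardinality of a finite graph. -/
noncomputable def modularCardinality (𝒢 : ∀ ⦃W : Type u⦄, SimpleGraph W → Prop)
    (G : SimpleGraph V) : ℕ :=
  sInf {m | ∃ P : Set (Set V), IsModularPartition 𝒢 G P ∧ P.ncard = m}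

/-- The cluster-modular cardinality of a finite graph. -/
noncomputable def clusterModularCardinality (G : SimpleGraph V) : ℕ :=
  modularCardinality (fun _ H => IsCluster H) G

end Graphs

/-! The machine model is a random access machine. Its memory consists of registers and of arrays
of unbounded length, all holding natural numbers; a program mentions finitely many registers and
arrays. The arithmetic is addition and truncated subtraction only, so that within `T` steps the
bit length of a number grows by at most `O(T)`, and unit cost is polynomially equivalent to the
running time of Turing machines. -/

/-- A memory state: `reg i` is register `i`, and `arr a i` is cell `i` of array `a`. -/
structure State where
  reg : ℕ → ℕ
  arr : ℕ → ℕ → ℕ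

namespace State

/-- Write the value `v` into register `r`. -/
def setReg (s : State) (r v : ℕ) : State :=
  { s with reg := Function.update s.reg r v }

/-- Write the value `v` into cell `i` of array `a`. -/
def setArr (s : State) (a i v : ℕ) : State :=
  { s with arr := Function.update s.arr a (Function.update (s.arr a) i v) }

end State

/-- Programs of the random access machine. -/
inductive Prog where
  /-- `reg r := c` -/
  | const (r c : ℕ)
  /-- `reg r := reg x + reg y` -/
  | add (r x y : ℕ)
  /-- `reg r := reg x - reg y` (truncated) -/
  | sub (r x y : ℕ)
  /-- `reg r := arr a (reg i)` -/
  | load (r a i : ℕ)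
  /-- `arr a (reg i) := reg r` -/
  | store (a i r : ℕ)
  /-- run `p`, then `q` -/
  | seq (p q : Prog)
  /-- run `p` if `reg r ≠ 0`, and `q` otherwise -/
  | ite (r : ℕ) (p q : Prog)
  /-- run `p` as long as `reg r ≠ 0` -/
  | loop (r : ℕ) (p : Prog)

/-- `Exec p s T s'`: started in state `s`, the program `p` halts in state `s'` after exactly `T`
steps. Each elementary instruction and each test is one step. -/
inductive Exec : Prog → State → ℕ → State → Prop
  | const (r c : ℕ) (s : State) : Exec (.const r c) s 1 (s.setReg r c)
  | add (r x y : ℕ) (s : State) : Exec (.add r x y) s 1 (s.setReg r (s.reg x + s.reg y))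
  | sub (r x y : ℕ) (s : State) : Exec (.sub r x y) s 1 (s.setReg r (s.reg x - s.reg y))
  | load (r a i : ℕ) (s : State) : Exec (.load r a i) s 1 (s.setReg r (s.arr a (s.reg i)))
  | store (a i r : ℕ) (s : State) : Exec (.store a i r) s 1 (s.setArr a (s.reg i) (s.reg r))
  | seq {p q : Prog} {s s' s'' : State} {T T' : ℕ} (hp : Exec p s T s') (hq : Exec q s' T' s'') :
      Exec (.seq p q) s (T + T') s''
  | ite_pos {r : ℕ} {p q : Prog} {s s' : State} {T : ℕ} (h : s.reg r ≠ 0) (hp : Exec p s T s') :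
      Exec (.ite r p q) s (T + 1) s'
  | ite_neg {r : ℕ} {p q : Prog} {s s' : State} {T : ℕ} (h : s.reg r = 0) (hq : Exec q s T s') :
      Exec (.ite r p q) s (T + 1) s'
  | loop_done {r : ℕ} {p : Prog} {s : State} (h : s.reg r = 0) : Exec (.loop r p) s 1 s
  | loop_step {r : ℕ} {p : Prog} {s s' s'' : State} {T T' : ℕ} (h : s.reg r ≠ 0)
      (hp : Exec p s T s') (hl : Exec (.loop r p) s' T' s'') :
      Exec (.loop r p) s (T + T' + 1) s''

/-- An instance `(x, k)` of a parameterized problem: a binary string and the parameter. -/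
abbrev Inst := List Bool × ℕ

/-- The initial state on the instance `(x, k)`: register 0 holds the length of `x`, register 1
holds `k`, array 0 holds the bits of `x`, and everything else is zero. -/
def initState (I : Inst) : State where
  reg r := if r = 0 then I.1.length else if r = 1 then I.2 else 0
  arr a i := if a = 0 ∧ I.1[i]? = some true then 1 else 0

/-- The state `s` presents the instance `(x, k)` as output, in the same format as the input
(whatever the rest of the memory holds). -/
def Outputs (s : State) (I : Inst) : Prop :=
  s.reg 0 = I.1.length ∧ s.reg 1 = I.2 ∧
    ∀ i, i < I.1.length → s.arr 0 i = if I.1[i]? = some true then 1 else 0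

/-- The parameterized problem `Q` is fixed-parameter tractable: some program halts on every
instance `(x, k)` within `f(k) · (|x| + 1) ^ c` steps, `f` computable, and register 0 is then
nonzero exactly if `(x, k) ∈ Q`. -/
def IsFPT (Q : Set Inst) : Prop :=
  ∃ (p : Prog) (f : ℕ → ℕ) (c : ℕ), Computable f ∧
    ∀ (x : List Bool) (k : ℕ), ∃ (T : ℕ) (s : State), Exec p (initState (x, k)) T s ∧
      T ≤ f k * (x.length + 1) ^ c ∧ (s.reg 0 ≠ 0 ↔ (x, k) ∈ Q)

/-- The map `K` on instances is computed in time polynomial in the bit length of `(x, k)`. -/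
def IsPolyTime (K : Inst → Inst) : Prop :=
  ∃ (p : Prog) (c : ℕ), ∀ (x : List Bool) (k : ℕ), ∃ (T : ℕ) (s : State),
    Exec p (initState (x, k)) T s ∧ T ≤ c * (x.length + k.size + 1) ^ c ∧ Outputs s (K (x, k))

/-- `K` is a kernelization for `Q`: a polynomial-time map of instances to equivalent instances
`(x', k')` with `|x'|, k' ≤ g(k)` for some computable function `g`. -/
def IsKernelization (Q : Set Inst) (K : Inst → Inst) : Prop :=
  IsPolyTime K ∧ (∀ I, K I ∈ Q ↔ I ∈ Q) ∧
    ∃ g : ℕ → ℕ, Computable g ∧ ∀ x k, (K (x, k)).1.length ≤ g k ∧ (K (x, k)).2 ≤ g k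

open Classical in
/-- The binary encoding `1ⁿ 0 1ᵗ 0 A` of a graph on `n` vertices and a number `t`, where `A` lists
the rows of the adjacency matrix. -/
noncomputable def encode {n : ℕ} (G : SimpleGraph (Fin n)) (t : ℕ) : List Bool :=
  List.replicate n true ++ false :: (List.replicate t true ++ false ::
    (List.finRange n).flatMap fun i => (List.finRange n).map fun j => decide (G.Adj i j))

/-- A graph parameter on the graphs with vertex set `{0, …, n - 1}`. -/
abbrev GraphParam := ∀ n : ℕ, SimpleGraph (Fin n) → ℕ

/-- The problem Thinness parameterized by `π`: the input is a graph `G` with a number `t`,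
accompanied by a number `k` that bounds `π G`; the question is whether `thinness G ≤ t`. -/
def thinnessProblem (π : GraphParam) : Set Inst :=
  {I | ∃ (n : ℕ) (G : SimpleGraph (Fin n)) (t : ℕ),
    I.1 = encode G t ∧ π n G ≤ I.2 ∧ thinness G ≤ t}

/-- Thinness parameterized by `π` has a kernel of size `h`, counted in vertices: a kernelization
that maps every `(x, k)` to an instance `((G', t'), k')` of Thinness in which the number of vertices
of `G'` and the numbers `t'` and `k'` are at most `h k`. -/
def HasThinnessKernel (π : GraphParam) (h : ℕ → ℕ) : Prop :=
  ∃ K : Inst → Inst, IsKernelization (thinnessProblem π) K ∧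
    ∀ (x : List Bool) (k : ℕ), ∃ (n' : ℕ) (G' : SimpleGraph (Fin n')) (t' : ℕ),
      (K (x, k)).1 = encode G' t' ∧ n' ≤ h k ∧ t' ≤ h k ∧ (K (x, k)).2 ≤ h k

end ThinFPT

/-!
Both parameters are treated at once: a cover is a vertex cover or a twin-cover, depending on a flag
`tw`, and every vertex cover is a twin-cover.

*Modular cardinality.* If `X` is a twin-cover, then adjacent vertices outside `X` are twins, so the
vertices outside `X` with the same neighbours in `X` form a module that induces a disjoint union of
cliques. These at most `2 ^ |X|` classes and the singletons of `X` form the partition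
(`clusterModularCardinality_le`).

*Reduction.* A new true twin of a vertex can be inserted immediately after that vertex into its
class without raising the thinness. The same holds for a new false twin of two vertices `a < b`,
when it is inserted after `a`: a vertex before `a` in the class of `a` that is adjacent to `a` would
also be adjacent to `b` and thereby force the edge `ab` (`thinOn_insert_after`). Hence the thinness
does not change when only one vertex of each class of true twins is kept, and then only two vertices
of each class of false twins (`thinOn_reps_iff`). Outside a twin-cover of size `k` the vertices that
are kept are independent, so their neighbourhoods in the cover distinguish them up to pairs, and at
most `k + 2 * 2 ^ k ≤ 3 * 2 ^ k` vertices remain (`card_reps_le`). The answer to an instance also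
depends on whether there is a cover of size `k`. This is tested by the subsets of the vertices of a
maximal matching of the edges to be covered: each subset extends to a cover by the neighbours of the
remaining vertices (`exists_cover_iff`), and there are at most `2 * k` matched vertices if a cover
of size `k` exists (`card_matched_le`).

*Algorithms.* The kernelization leaves graphs on at most `2 ^ k` vertices alone. For larger graphs
the at most `4 ^ k` subsets are fewer than the squared number of vertices, so that the test takes
polynomial time. The decision procedure always makes the test and then searches for an order and a
partition of the reduced graph, coded by two numbers of at most `3 * 2 ^ k` digits in base at most
`3 * 2 ^ k`.

*Machine.* Programs are compiled from straight-line programs over a language of arithmetical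
expressions with bounded sums. In a straight-line program every register and every array is assigned
only once, so the final memory satisfies the equations given by the statements (`sat_runAll`), and
the correctness proofs only use these equations. The running time is polynomial in a bound on the
registers that serve as bounds of sums (`runs_compAll`, `exists_costAll_le`), whatever the other
values are.
-/

namespace ThinFPT

/-! ### Running programs -/

/-- Started in `s`, the program `p` halts within `K` steps in a state that satisfies `Q`. -/
def Runs (p : Prog) (s : State) (K : ℕ) (Q : State → Prop) : Prop :=
  ∃ T s', Exec p s T s' ∧ T ≤ K ∧ Q s'

namespace Runs

variable {p q : Prog} {s : State} {K K' : ℕ} {P Q : State → Prop}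

theorem mono (h : Runs p s K P) (hK : K ≤ K') (hPQ : ∀ s', P s' → Q s') : Runs p s K' Q := by
  obtain ⟨T, s', h1, h2, h3⟩ := h
  exact ⟨T, s', h1, h2.trans hK, hPQ _ h3⟩

theorem seq (hp : Runs p s K P) (hq : ∀ s', P s' → Runs q s' K' Q) :
    Runs (.seq p q) s (K + K') Q := by
  obtain ⟨T, s', h1, h2, h3⟩ := hp
  obtain ⟨T', s'', h1', h2', h3'⟩ := hq s' h3
  exact ⟨_, s'', .seq h1 h1', Nat.add_le_add h2 h2', h3'⟩

theorem const (r c : ℕ) (h : Q (s.setReg r c)) : Runs (.const r c) s 1 Q :=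
  ⟨_, _, .const r c s, le_rfl, h⟩

theorem add (r x y : ℕ) (h : Q (s.setReg r (s.reg x + s.reg y))) : Runs (.add r x y) s 1 Q :=
  ⟨_, _, .add r x y s, le_rfl, h⟩

theorem sub (r x y : ℕ) (h : Q (s.setReg r (s.reg x - s.reg y))) : Runs (.sub r x y) s 1 Q :=
  ⟨_, _, .sub r x y s, le_rfl, h⟩

theorem load (r a i : ℕ) (h : Q (s.setReg r (s.arr a (s.reg i)))) : Runs (.load r a i) s 1 Q :=
  ⟨_, _, .load r a i s, le_rfl, h⟩

theorem store (a i r : ℕ) (h : Q (s.setArr a (s.reg i) (s.reg r))) : Runs (.store a i r) s 1 Q :=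
  ⟨_, _, .store a i r s, le_rfl, h⟩

theorem ite (r : ℕ) (hp : s.reg r ≠ 0 → Runs p s K Q) (hq : s.reg r = 0 → Runs q s K' Q) :
    Runs (.ite r p q) s (K + K' + 1) Q := by
  by_cases h : s.reg r = 0
  · obtain ⟨T, s', h1, h2, h3⟩ := hq h
    exact ⟨_, s', .ite_neg h h1, by omega, h3⟩
  · obtain ⟨T, s', h1, h2, h3⟩ := hp h
    exact ⟨_, s', .ite_pos h h1, by omega, h3⟩

/-- A loop whose control register counts down from `N` makes `N` rounds. -/
theorem loop (c N : ℕ) (I : ℕ → State → Prop)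
    (hp : ∀ i s, i < N → I i s → s.reg c = N - i →
      Runs p s K fun s' => I (i + 1) s' ∧ s'.reg c = N - (i + 1))
    (hs : I 0 s) (hc : s.reg c = N) : Runs (.loop c p) s (N * (K + 1) + 1) (I N) := by
  have key : ∀ m i s, i + m = N → I i s → s.reg c = m →
      Runs (.loop c p) s (m * (K + 1) + 1) (I N) := by
    intro m
    induction m with
    | zero =>
      intro i s hi hI hc
      have hiN : i = N := by omega
      exact ⟨_, s, .loop_done hc, by omega, hiN ▸ hI⟩
    | succ m ih =>
      intro i s hi hI hc
      obtain ⟨T, s', h1, h2, h3, h4⟩ := hp i s (by omega) hI (by omega)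
      obtain ⟨T', s'', h1', h2', h3'⟩ := ih (i + 1) s' (by omega) h3 (by omega)
      refine ⟨_, s'', .loop_step (by omega) h1 h1', ?_, h3'⟩
      rw [add_one_mul]
      omega
  exact key N 0 s (by omega) hs hc

end Runs

@[simp] theorem State.setReg_reg (s : State) (r v r' : ℕ) :
    (s.setReg r v).reg r' = if r' = r then v else s.reg r' := by
  simp [State.setReg, Function.update_apply]

@[simp] theorem State.setReg_arr (s : State) (r v : ℕ) : (s.setReg r v).arr = s.arr := rfl

@[simp] theorem State.setArr_reg (s : State) (a i v : ℕ) : (s.setArr a i v).reg = s.reg := rfl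

theorem State.setArr_arr (s : State) (a i v a' j : ℕ) :
    (s.setArr a i v).arr a' j = if a' = a ∧ j = i then v else s.arr a' j := by
  by_cases h : a' = a
  · subst h; simp [State.setArr, Function.update_apply]
  · simp [State.setArr, h]

/-! ### Arithmetical expressions with bounded sums -/

/-- Expressions over the registers and arrays of the machine. Local variables are registers, too:
`letE x e f` evaluates `f` with the value of `e` in register `x`, and `sum x b e` is the sum of `e`
over the values of register `x` below the content of register `b`. -/
inductive Expr where
  | reg (r : ℕ)
  | const (c : ℕ)
  | add (e f : Expr)
  | sub (e f : Expr)
  | load (a : ℕ) (e : Expr)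
  | ite (c e f : Expr)
  | letE (x : ℕ) (e f : Expr)
  | sum (x b : ℕ) (e : Expr)

namespace Expr

/-- The value of an expression in a memory state. -/
def eval : Expr → State → ℕ
  | reg r, s => s.reg r
  | const c, _ => c
  | add e f, s => e.eval s + f.eval s
  | sub e f, s => e.eval s - f.eval s
  | load a e, s => s.arr a (e.eval s)
  | ite c e f, s => if c.eval s ≠ 0 then e.eval s else f.eval s
  | letE x e f, s => f.eval (s.setReg x (e.eval s))
  | sum x b e, s => ∑ i ∈ Finset.range (s.reg b), e.eval (s.setReg x i)

/-- The registers that occur in an expression. -/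
def regs : Expr → List ℕ
  | reg r => [r]
  | const _ => []
  | add e f => e.regs ++ f.regs
  | sub e f => e.regs ++ f.regs
  | load _ e => e.regs
  | ite c e f => c.regs ++ (e.regs ++ f.regs)
  | letE x e f => x :: (e.regs ++ f.regs)
  | sum x b e => x :: b :: e.regs

/-- The arrays that occur in an expression. -/
def arrs : Expr → List ℕ
  | reg _ => []
  | const _ => []
  | add e f => e.arrs ++ f.arrs
  | sub e f => e.arrs ++ f.arrs
  | load a e => a :: e.arrs
  | ite c e f => c.arrs ++ (e.arrs ++ f.arrs)
  | letE _ e f => e.arrs ++ f.arrs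
  | sum _ _ e => e.arrs

/-- All sums range over registers of the list `S`, and no register of `S` is used as a local
variable. -/
def loopsIn (S : List ℕ) : Expr → Bool
  | reg _ => true
  | const _ => true
  | add e f => e.loopsIn S && f.loopsIn S
  | sub e f => e.loopsIn S && f.loopsIn S
  | load _ e => e.loopsIn S
  | ite c e f => c.loopsIn S && (e.loopsIn S && f.loopsIn S)
  | letE x e f => decide (x ∉ S) && (e.loopsIn S && f.loopsIn S)
  | sum x b e => decide (x ∉ S) && (decide (b ∈ S) && e.loopsIn S)

/-- A bound on the time to evaluate an expression when all sums have at most `B` terms. The values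
of the terms are irrelevant, as arithmetic has unit cost. -/
def cost (B : ℕ) : Expr → ℕ
  | reg _ => 2
  | const _ => 1
  | add e f => e.cost B + f.cost B + 1
  | sub e f => e.cost B + f.cost B + 1
  | load _ e => e.cost B + 1
  | ite c e f => c.cost B + e.cost B + f.cost B + 1
  | letE _ e f => e.cost B + f.cost B + 8
  | sum _ _ e => B * (e.cost B + 5) + 9

/-- The nesting depth of sums. -/
def depth : Expr → ℕ
  | reg _ => 0
  | const _ => 0
  | add e f => max e.depth f.depth
  | sub e f => max e.depth f.depth
  | load _ e => e.depth
  | ite c e f => max c.depth (max e.depth f.depth)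
  | letE _ e f => max e.depth f.depth
  | sum _ _ e => e.depth + 1

/-- The leading coefficient of the time bound. -/
def size : Expr → ℕ
  | reg _ => 2
  | const _ => 1
  | add e f => e.size + f.size + 1
  | sub e f => e.size + f.size + 1
  | load _ e => e.size + 1
  | ite c e f => c.size + e.size + f.size + 1
  | letE _ e f => e.size + f.size + 8
  | sum _ _ e => e.size + 14

theorem cost_le (B : ℕ) (e : Expr) : e.cost B ≤ e.size * (B + 1) ^ e.depth := by
  have one : ∀ d, 1 ≤ (B + 1) ^ d := fun d => Nat.one_le_pow _ _ (by omega)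
  have up : ∀ {x y d d' : ℕ}, x ≤ y * (B + 1) ^ d → d ≤ d' → x ≤ y * (B + 1) ^ d' :=
    fun h hd => h.trans (Nat.mul_le_mul_left _ (Nat.pow_le_pow_right (by omega) hd))
  induction e with
  | reg r => simp [cost, size, depth]
  | const c => simp [cost, size, depth]
  | add e f ihe ihf | sub e f ihe ihf =>
    have h1 := up ihe (le_max_left e.depth f.depth)
    have h2 := up ihf (le_max_right e.depth f.depth)
    have h3 := one (max e.depth f.depth)
    simp only [cost, size, depth, add_mul]
    omega
  | load a e ih =>
    have h3 := one e.depth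
    simp only [cost, size, depth, add_mul]
    omega
  | ite c e f ihc ihe ihf =>
    have h0 := up ihc (le_max_left c.depth (max e.depth f.depth))
    have h1 := up ihe ((le_max_left e.depth f.depth).trans (le_max_right c.depth _))
    have h2 := up ihf ((le_max_right e.depth f.depth).trans (le_max_right c.depth _))
    have h3 := one (max c.depth (max e.depth f.depth))
    simp only [cost, size, depth, add_mul]
    omega
  | letE x e f ihe ihf =>
    have h1 := up ihe (le_max_left e.depth f.depth)
    have h2 := up ihf (le_max_right e.depth f.depth)
    have h3 := one (max e.depth f.depth)
    simp only [cost, size, depth, add_mul]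
    omega
  | sum x b e ih =>
    have h3 := one e.depth
    simp only [cost, size, depth]
    calc B * (e.cost B + 5) + 9
        ≤ B * (e.size * (B + 1) ^ e.depth + 5 * (B + 1) ^ e.depth) + 9 * (B + 1) ^ e.depth := by
          gcongr <;> omega
      _ ≤ (e.size + 14) * (B + 1) ^ (e.depth + 1) := by
          rw [pow_succ]
          nlinarith [Nat.zero_le (B * (B + 1) ^ e.depth), Nat.zero_le (e.size * (B + 1) ^ e.depth)]

theorem eval_congr (e : Expr) {s s' : State} (hr : ∀ r ∈ e.regs, s.reg r = s'.reg r)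
    (ha : ∀ a ∈ e.arrs, s.arr a = s'.arr a) : e.eval s = e.eval s' := by
  induction e generalizing s s' with
  | reg r => exact hr r (by simp [regs])
  | const c => rfl
  | add e f ihe ihf | sub e f ihe ihf =>
    simp only [regs, arrs, List.mem_append] at hr ha
    simp only [eval]
    rw [ihe (fun r h => hr r (.inl h)) (fun r h => ha r (.inl h)),
      ihf (fun r h => hr r (.inr h)) (fun r h => ha r (.inr h))]
  | load a e ih =>
    simp only [regs, arrs, List.mem_cons] at hr ha
    simp only [eval]
    rw [ih hr (fun r h => ha r (.inr h)), ha a (.inl rfl)]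
  | ite c e f ihc ihe ihf =>
    simp only [regs, arrs, List.mem_append] at hr ha
    simp only [eval]
    rw [ihc (fun r h => hr r (.inl h)) (fun r h => ha r (.inl h)),
      ihe (fun r h => hr r (.inr (.inl h))) (fun r h => ha r (.inr (.inl h))),
      ihf (fun r h => hr r (.inr (.inr h))) (fun r h => ha r (.inr (.inr h)))]
  | letE x e f ihe ihf =>
    simp only [regs, arrs, List.mem_append, List.mem_cons] at hr ha
    simp only [eval]
    rw [ihe (fun r h => hr r (.inr (.inl h))) (fun r h => ha r (.inl h))]
    refine ihf (fun r h => ?_) (fun r h => ha r (.inr h))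
    simp only [State.setReg_reg]
    rw [hr r (.inr (.inr h))]
  | sum x b e ih =>
    simp only [regs, arrs, List.mem_cons] at hr ha
    simp only [eval]
    rw [hr b (.inr (.inl rfl))]
    refine Finset.sum_congr rfl fun i _ => ih (fun r h => ?_) ha
    simp only [State.setReg_reg]
    rw [hr r (.inr (.inr h))]

/-- Setting a register that does not occur in an expression does not change its value. -/
theorem eval_setReg (e : Expr) {x : ℕ} (hx : x ∉ e.regs) (s : State) (v : ℕ) :
    e.eval (s.setReg x v) = e.eval s := by
  refine e.eval_congr (fun r hr => ?_) fun _ _ => rfl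
  have : r ≠ x := by rintro rfl; exact hx hr
  simp [this]

/-- `reg r := reg x` for `r ≠ x`. -/
def copy (r x : ℕ) : Prog := .seq (.const r 0) (.add r r x)

theorem runs_copy {r x : ℕ} (h : r ≠ x) {s : State} {Q : State → Prop}
    (hQ : Q (s.setReg r (s.reg x))) : Runs (copy r x) s 2 Q := by
  refine Runs.seq (K := 1) (K' := 1) (P := fun s' => s' = s.setReg r 0) (Runs.const _ _ rfl) ?_
  rintro _ rfl
  refine Runs.add _ _ _ ?_
  convert hQ using 1
  simp [State.setReg, h.symm]

/-- A program that computes an expression into register `d`, with the registers from `d` on as work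
space. The registers of the local variables are restored at the end. -/
def comp : Expr → ℕ → Prog
  | reg r, d => copy d r
  | const c, d => .const d c
  | add e f, d => .seq (e.comp d) (.seq (f.comp (d + 1)) (.add d d (d + 1)))
  | sub e f, d => .seq (e.comp d) (.seq (f.comp (d + 1)) (.sub d d (d + 1)))
  | load a e, d => .seq (e.comp d) (.load d a d)
  | ite c e f, d => .seq (c.comp d) (.ite d (e.comp d) (f.comp d))
  | letE x e f, d =>
    .seq (e.comp d) <| .seq (copy (d + 1) x) <| .seq (copy x d) <| .seq (f.comp (d + 2)) <|
      .seq (copy x (d + 1)) (copy d (d + 2))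
  | sum x b e, d =>
    .seq (.const d 0) <| .seq (copy (d + 1) x) <| .seq (copy (d + 2) b) <| .seq (.const x 0) <|
      .seq (.loop (d + 2) <| .seq (e.comp (d + 4)) <| .seq (.add d d (d + 4)) <|
        .seq (.const (d + 3) 1) <| .seq (.add x x (d + 3)) (.sub (d + 2) (d + 2) (d + 3)))
      (copy x (d + 1))

theorem runs_comp (e : Expr) {S : List ℕ} {B : ℕ} (hS : e.loopsIn S = true) (d : ℕ)
    (hd : ∀ r ∈ e.regs, r < d) (hSd : ∀ r ∈ S, r < d) (s : State) (hB : ∀ r ∈ S, s.reg r ≤ B) :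
    Runs (e.comp d) s (e.cost B) fun s' =>
      s'.arr = s.arr ∧ (∀ r < d, s'.reg r = s.reg r) ∧ s'.reg d = e.eval s := by
  induction e generalizing d s with
  | reg r =>
    have : r < d := hd r (by simp [regs])
    refine runs_copy (by omega) ⟨rfl, fun r' hr' => ?_, ?_⟩
    · simp; omega
    · simp [eval]
  | const c =>
    refine Runs.const _ _ ⟨rfl, fun r' hr' => ?_, ?_⟩
    · simp; omega
    · simp [eval]
  | add e f ihe ihf | sub e f ihe ihf =>
    simp only [regs, List.mem_append, loopsIn, Bool.and_eq_true] at hd hS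
    simp only [cost, add_assoc]
    refine Runs.seq (ihe hS.1 d (fun r h => hd r (.inl h)) hSd s hB) ?_
    rintro s1 ⟨ha1, hr1, hv1⟩
    refine Runs.seq (ihf hS.2 (d + 1) (fun r h => (hd r (.inr h)).trans (by omega))
      (fun r h => (hSd r h).trans (by omega)) s1
      (fun r h => (hr1 r (hSd r h)).symm ▸ hB r h)) ?_
    rintro s2 ⟨ha2, hr2, hv2⟩
    have hf : f.eval s1 = f.eval s :=
      f.eval_congr (fun r h => hr1 r (hd r (.inr h))) fun a _ => by rw [ha1]
    first | refine Runs.add _ _ _ ⟨by simp [ha2, ha1], fun r hr => ?_, ?_⟩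
          | refine Runs.sub _ _ _ ⟨by simp [ha2, ha1], fun r hr => ?_, ?_⟩
    · rw [State.setReg_reg, if_neg (by omega), hr2 r (by omega), hr1 r hr]
    · simp [eval, hr2, hv1, hv2, hf]
  | load a e ih =>
    refine Runs.seq (ih hS d hd hSd s hB) ?_
    rintro s1 ⟨ha1, hr1, hv1⟩
    refine Runs.load _ _ _ ⟨by simp [ha1], fun r hr => ?_, ?_⟩
    · rw [State.setReg_reg, if_neg (by omega), hr1 r hr]
    · simp [eval, hv1, ha1]
  | ite c e f ihc ihe ihf =>
    simp only [regs, List.mem_append, loopsIn, Bool.and_eq_true] at hd hS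
    simp only [cost, add_assoc]
    refine Runs.seq (ihc hS.1 d (fun r h => hd r (.inl h)) hSd s hB) ?_
    rintro s1 ⟨ha1, hr1, hv1⟩
    have hB1 : ∀ r ∈ S, s1.reg r ≤ B := fun r h => (hr1 r (hSd r h)).symm ▸ hB r h
    have he : e.eval s1 = e.eval s :=
      e.eval_congr (fun r h => hr1 r (hd r (.inr (.inl h)))) fun a _ => by rw [ha1]
    have hf : f.eval s1 = f.eval s :=
      f.eval_congr (fun r h => hr1 r (hd r (.inr (.inr h)))) fun a _ => by rw [ha1]
    rw [← add_assoc]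
    refine Runs.ite _ (fun hc => ?_) (fun hc => ?_)
    · refine (ihe hS.2.1 d (fun r h => hd r (.inr (.inl h))) hSd s1 hB1).mono le_rfl ?_
      rintro s2 ⟨ha2, hr2, hv2⟩
      refine ⟨ha2.trans ha1, fun r hr => (hr2 r hr).trans (hr1 r hr), ?_⟩
      rw [hv2, he, eval, if_pos (hv1 ▸ hc)]
    · refine (ihf hS.2.2 d (fun r h => hd r (.inr (.inr h))) hSd s1 hB1).mono le_rfl ?_
      rintro s2 ⟨ha2, hr2, hv2⟩
      refine ⟨ha2.trans ha1, fun r hr => (hr2 r hr).trans (hr1 r hr), ?_⟩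
      rw [hv2, hf, eval, if_neg (by simpa using hv1 ▸ hc)]
  | letE x e f ihe ihf =>
    simp only [regs, List.mem_append, List.mem_cons, loopsIn, Bool.and_eq_true,
      decide_eq_true_eq] at hd hS
    have ne : ∀ {r}, r < d → ∀ j, r ≠ d + j := by omega
    have hx : x < d := hd x (.inl rfl)
    have hcost : cost B (letE x e f) = e.cost B + (2 + (2 + (f.cost B + (2 + 2)))) := by
      simp only [cost]; omega
    rw [hcost, comp]
    refine Runs.seq (ihe hS.2.1 d (fun r h => hd r (.inr (.inl h))) hSd s hB) ?_
    rintro s1 ⟨ha1, hr1, hv1⟩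
    refine Runs.seq (P := fun s' => s' = s1.setReg (d + 1) (s1.reg x))
      (runs_copy (by omega) rfl) ?_
    rintro _ rfl
    refine Runs.seq (P := fun s' => s' = (s1.setReg (d + 1) (s1.reg x)).setReg x (s1.reg d))
      (runs_copy (by omega) ?_) ?_
    · simp
    rintro _ rfl
    refine Runs.seq (ihf hS.2.2 (d + 2) (fun r h => (hd r (.inr (.inr h))).trans (by omega))
      (fun r h => (hSd r h).trans (by omega)) _ (fun r h => ?_)) ?_
    · have h1 : r ≠ x := by rintro rfl; exact hS.1 h
      have h2 := hSd r h
      rw [State.setReg_reg, if_neg h1, State.setReg_reg, if_neg (by omega), hr1 r h2]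
      exact hB r h
    rintro s2 ⟨ha2, hr2, hv2⟩
    refine Runs.seq (P := fun s' => s' = s2.setReg x (s2.reg (d + 1)))
      (runs_copy (by omega) rfl) ?_
    rintro _ rfl
    refine runs_copy (by omega) ⟨by simp [ha2, ha1], fun r hr => ?_, ?_⟩
    · rw [State.setReg_reg, if_neg (by omega), State.setReg_reg]
      split_ifs with h
      · subst h
        rw [hr2 _ (by omega), State.setReg_reg, if_neg (by omega), State.setReg_reg, if_pos rfl,
          hr1 _ hr]
      · rw [hr2 _ (by omega), State.setReg_reg, if_neg h, State.setReg_reg, if_neg (by omega),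
          hr1 _ hr]
    · rw [State.setReg_reg, if_pos rfl, State.setReg_reg, if_neg (by omega), hv2, eval]
      refine f.eval_congr (fun r h => ?_) (fun a _ => by simp [ha1])
      have hr := hd r (.inr (.inr h))
      rw [State.setReg_reg, State.setReg_reg, State.setReg_reg, hv1, if_neg (ne hr 1),
        hr1 r hr]
  | sum x b e ih =>
    simp only [regs, List.mem_cons, loopsIn, Bool.and_eq_true, decide_eq_true_eq] at hd hS
    have ne : ∀ {r}, r < d → ∀ j, r ≠ d + j := by omega
    have hx : x < d := hd x (.inl rfl)
    have hb : b < d := hd b (.inr (.inl rfl))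
    have hbx : b ≠ x := by rintro rfl; exact hS.1 hS.2.1
    have hcost : 1 + (2 + (2 + (1 + ((s.reg b * (e.cost B + (1 + (1 + (1 + 1))) + 1) + 1) + 2)))) ≤
        cost B (sum x b e) := by
      have := Nat.mul_le_mul_right (e.cost B + (1 + (1 + (1 + 1))) + 1) (hB b hS.2.1)
      simp only [cost]
      rw [show e.cost B + 5 = e.cost B + (1 + (1 + (1 + 1))) + 1 by omega]
      omega
    refine Runs.mono ?_ hcost fun _ h => h
    rw [comp]
    refine Runs.seq (P := fun s' => s' = s.setReg d 0) (Runs.const _ _ rfl) ?_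
    rintro _ rfl
    refine Runs.seq (P := fun s' => s' = (s.setReg d 0).setReg (d + 1) (s.reg x))
      (runs_copy (by omega) ?_) ?_
    · simp [hx.ne]
    rintro _ rfl
    refine Runs.seq
      (P := fun s' => s' = ((s.setReg d 0).setReg (d + 1) (s.reg x)).setReg (d + 2) (s.reg b))
      (runs_copy (by omega) ?_) ?_
    · simp [hb.ne, ne hb 1]
    rintro _ rfl
    refine Runs.seq (P := fun s' =>
      s' = (((s.setReg d 0).setReg (d + 1) (s.reg x)).setReg (d + 2) (s.reg b)).setReg x 0)
      (Runs.const _ _ rfl) ?_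
    rintro _ rfl
    -- After `i` rounds, register `d` holds the sum of the first `i` terms.
    refine Runs.seq (Runs.loop (d + 2) (s.reg b) (fun i s' => s'.arr = s.arr ∧
      (∀ r < d, r ≠ x → s'.reg r = s.reg r) ∧ s'.reg x = i ∧ s'.reg (d + 1) = s.reg x ∧
      s'.reg d = ∑ j ∈ Finset.range i, e.eval (s.setReg x j)) ?_ ?_ ?_) ?_
    · rintro i s1 hi ⟨ha1, hr1, hx1, hs1, hv1⟩ hc1
      refine Runs.seq (ih hS.2.2 (d + 4) (fun r h => (hd r (.inr (.inr h))).trans (by omega))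
        (fun r h => (hSd r h).trans (by omega)) s1 (fun r h => ?_)) ?_
      · rw [hr1 r (hSd r h) (by rintro rfl; exact hS.1 h)]
        exact hB r h
      rintro s2 ⟨ha2, hr2, hv2⟩
      refine Runs.seq (K := 1) (K' := 3)
        (P := fun s' => s' = s2.setReg d (s2.reg d + s2.reg (d + 4)))
        (Runs.add _ _ _ rfl) ?_
      rintro _ rfl
      refine Runs.seq (K := 1) (K' := 2)
        (P := fun s' => s' = (s2.setReg d (s2.reg d + s2.reg (d + 4))).setReg (d + 3) 1)
        (Runs.const _ _ rfl) ?_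
      rintro _ rfl
      refine Runs.seq (K := 1) (K' := 1) (P := fun s' =>
        s' = ((s2.setReg d (s2.reg d + s2.reg (d + 4))).setReg (d + 3) 1).setReg x (i + 1))
        (Runs.add _ _ _ ?_) ?_
      · simp [hx.ne, ne hx 3, hr2 x (by omega), hx1]
      rintro _ rfl
      refine Runs.sub _ _ _ ⟨⟨by simp [ha2, ha1], fun r hr hrx => ?_, ?_, ?_, ?_⟩, ?_⟩
      · simp [hrx, hr.ne, ne hr 2, ne hr 3, hr2 r (by omega),
          hr1 r hr hrx]
      · simp [ne hx 2]
      · simp [(ne hx 1).symm, hr2, hs1]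
      · have he : e.eval s1 = e.eval (s.setReg x i) := by
          refine e.eval_congr (fun r h => ?_) fun a _ => by simp [ha1]
          rw [State.setReg_reg]
          split_ifs with hrx
          · rw [hrx, hx1]
          · exact hr1 r (hd r (.inr (.inr h))) hrx
        simp [hx.ne', hr2, hv1, hv2, he, Finset.sum_range_succ]
      · simp [(ne hx 2).symm, (ne hx 3).symm, hr2, hc1]
        omega
    · refine ⟨by simp, fun r hr hrx => ?_, by simp, ?_, ?_⟩
      · simp [hrx, hr.ne, ne hr 1, ne hr 2]
      · simp [(ne hx 1).symm]
      · simp [hx.ne']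
    · simp [(ne hx 2).symm]
    · rintro s2 ⟨ha2, hr2, hx2, hs2, hv2⟩
      refine runs_copy (by omega) ⟨by simp [ha2], fun r hr => ?_, ?_⟩
      · rw [State.setReg_reg]
        split_ifs with h
        · rw [hs2, h]
        · exact hr2 r hr h
      · simp [hx.ne', hv2, eval]

end Expr

/-! ### Straight-line programs -/

/-- The statements of a straight-line program: `set r e` is the assignment of the value of `e` to
register `r`, and `tab a b x e` fills the cells of array `a` whose index `x` is below the content of
register `b`, in increasing order, with the value of `e`. -/
inductive Stmt where
  | set (r : ℕ) (e : Expr)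
  | tab (a b x : ℕ) (e : Expr)

namespace Stmt

/-- The first `n` rounds of `tab a b x e`. -/
def fill (a x : ℕ) (e : Expr) : ℕ → State → State
  | 0, s => s
  | n + 1, s => (fill a x e n s).setArr a n (e.eval ((fill a x e n s).setReg x n))

/-- The effect of a statement. -/
def run : Stmt → State → State
  | set r e, s => s.setReg r (e.eval s)
  | tab a b x e, s => fill a x e (s.reg b) s

/-- The registers that a statement mentions. -/
def regs : Stmt → List ℕ
  | set r e => r :: e.regs
  | tab _ b x e => b :: x :: e.regs

/-- The arrays that a statement mentions. -/
def arrs : Stmt → List ℕ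
  | set _ e => e.arrs
  | tab a _ _ e => a :: e.arrs

/-- The register that a statement writes, if any. -/
def regTarget : Stmt → List ℕ
  | set r _ => [r]
  | tab _ _ _ _ => []

/-- The array that a statement writes, if any. -/
def arrTarget : Stmt → List ℕ
  | set _ _ => []
  | tab a _ _ _ => [a]

/-- Loops range over registers of the list `S`, which are not used as local variables. -/
def loopsIn (S : List ℕ) : Stmt → Bool
  | set _ e => e.loopsIn S
  | tab _ b x e => decide (x ∉ S) && (decide (b ∈ S) && e.loopsIn S)

/-- A bound on the running time when all loops have at most `B` rounds. -/
def cost (B : ℕ) : Stmt → ℕ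
  | set _ e => e.cost B + 2
  | tab _ _ _ e => B * (e.cost B + 5) + 8

/-- A program for a statement with the registers from `d` on as work space. -/
def comp (d : ℕ) : Stmt → Prog
  | set r e => .seq (e.comp d) (Expr.copy r d)
  | tab a b x e =>
    .seq (Expr.copy d x) <| .seq (Expr.copy (d + 1) b) <| .seq (.const x 0) <|
      .seq (.loop (d + 1) <| .seq (e.comp (d + 3)) <| .seq (.store a x (d + 3)) <|
        .seq (.const (d + 2) 1) <| .seq (.add x x (d + 2)) (.sub (d + 1) (d + 1) (d + 2)))
      (Expr.copy x d)

@[simp] theorem fill_reg (a x : ℕ) (e : Expr) (n : ℕ) (s : State) :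
    (fill a x e n s).reg = s.reg := by
  induction n with
  | zero => rfl
  | succ n ih => simpa [fill] using ih

theorem fill_arr_of_ne {a a' : ℕ} (h : a' ≠ a) (x : ℕ) (e : Expr) (n : ℕ) (s : State) :
    (fill a x e n s).arr a' = s.arr a' := by
  induction n with
  | zero => rfl
  | succ n ih =>
    funext j
    rw [fill, State.setArr_arr, if_neg (fun h' => h h'.1), ih]

theorem fill_arr_of_le (a x : ℕ) (e : Expr) {n j : ℕ} (h : n ≤ j) (s : State) :
    (fill a x e n s).arr a j = s.arr a j := by
  induction n with
  | zero => rfl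
  | succ n ih => rw [fill, State.setArr_arr, if_neg (by omega), ih (by omega)]

theorem fill_arr_of_lt (a x : ℕ) (e : Expr) {n j : ℕ} (h : j < n) (s : State) :
    (fill a x e n s).arr a j = e.eval ((fill a x e j s).setReg x j) := by
  induction n with
  | zero => omega
  | succ n ih =>
    rw [fill, State.setArr_arr]
    split_ifs with h'
    · rw [h'.2]
    · exact ih (by simp at h'; omega)

/-- The two states agree up to the work space from register `d` on. -/
def Agree (d : ℕ) (s s' : State) : Prop :=
  s'.arr = s.arr ∧ ∀ r < d, s'.reg r = s.reg r

theorem runs_comp (st : Stmt) {S : List ℕ} {B : ℕ} (hS : st.loopsIn S = true) {d : ℕ}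
    (hd : ∀ r ∈ st.regs, r < d) (hSd : ∀ r ∈ S, r < d) {s₀ s : State} (hs : Agree d s₀ s)
    (hB : ∀ r ∈ S, s₀.reg r ≤ B) :
    Runs (st.comp d) s (st.cost B) (Agree d (st.run s₀)) := by
  obtain ⟨has, hrs⟩ := hs
  have hB' : ∀ r ∈ S, s.reg r ≤ B := fun r h => (hrs r (hSd r h)).symm ▸ hB r h
  cases st with
  | set r e =>
    simp only [regs, List.mem_cons] at hd
    have hr : r < d := hd r (.inl rfl)
    refine Runs.seq (e.runs_comp hS d (fun r h => hd r (.inr h)) hSd s hB') ?_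
    rintro s1 ⟨ha1, hr1, hv1⟩
    refine Expr.runs_copy (by omega) ⟨by simp [run, ha1, has], fun r' hr' => ?_⟩
    have he : e.eval s = e.eval s₀ :=
      e.eval_congr (fun r h => hrs r (hd r (.inr h))) fun a _ => by rw [has]
    simp only [run, State.setReg_reg, hv1, he, hr1 r' hr', hrs r' hr']
  | tab a b x e =>
    simp only [regs, List.mem_cons, loopsIn, Bool.and_eq_true, decide_eq_true_eq] at hd hS
    have ne : ∀ {r}, r < d → ∀ j, r ≠ d + j := by omega
    have hx : x < d := hd x (.inr (.inl rfl))
    have hb : b < d := hd b (.inl rfl)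
    have hbx : b ≠ x := by rintro rfl; exact hS.1 hS.2.1
    have hcost : 2 + (2 + (1 + ((s₀.reg b * (e.cost B + (1 + (1 + (1 + 1))) + 1) + 1) + 2))) ≤
        cost B (tab a b x e) := by
      have := Nat.mul_le_mul_right (e.cost B + (1 + (1 + (1 + 1))) + 1) (hB b hS.2.1)
      simp only [cost, show e.cost B + (1 + (1 + (1 + 1))) + 1 = e.cost B + 5 from rfl] at this ⊢
      omega
    refine Runs.mono ?_ hcost fun _ h => h
    rw [comp]
    refine Runs.seq (P := fun s' => s' = s.setReg d (s₀.reg x))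
      (Expr.runs_copy (by omega) ?_) ?_
    · rw [hrs x hx]
    rintro _ rfl
    refine Runs.seq (P := fun s' => s' = (s.setReg d (s₀.reg x)).setReg (d + 1) (s₀.reg b))
      (Expr.runs_copy (by omega) ?_) ?_
    · simp [hb.ne, hrs b hb]
    rintro _ rfl
    refine Runs.seq
      (P := fun s' => s' = ((s.setReg d (s₀.reg x)).setReg (d + 1) (s₀.reg b)).setReg x 0)
      (Runs.const _ _ rfl) ?_
    rintro _ rfl
    refine Runs.seq (Runs.loop (d + 1) (s₀.reg b) (fun i s' => s'.arr = (fill a x e i s₀).arr ∧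
      (∀ r < d, r ≠ x → s'.reg r = s₀.reg r) ∧ s'.reg x = i ∧ s'.reg d = s₀.reg x) ?_ ?_ ?_) ?_
    · rintro i s1 hi ⟨ha1, hr1, hx1, hs1⟩ hc1
      refine Runs.seq (e.runs_comp hS.2.2 (d + 3)
        (fun r h => (hd r (.inr (.inr h))).trans (by omega))
        (fun r h => (hSd r h).trans (by omega)) s1 (fun r h => ?_)) ?_
      · rw [hr1 r (hSd r h) (by rintro rfl; exact hS.1 h)]
        exact hB r h
      rintro s2 ⟨ha2, hr2, hv2⟩
      refine Runs.seq (K := 1) (K' := 3) (P := fun s' => s' = s2.setArr a i (s2.reg (d + 3)))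
        (Runs.store _ _ _ ?_) ?_
      · rw [hr2 x (by omega), hx1]
      rintro _ rfl
      refine Runs.seq (K := 1) (K' := 2)
        (P := fun s' => s' = (s2.setArr a i (s2.reg (d + 3))).setReg (d + 2) 1)
        (Runs.const _ _ rfl) ?_
      rintro _ rfl
      refine Runs.seq (K := 1) (K' := 1) (P := fun s' =>
        s' = ((s2.setArr a i (s2.reg (d + 3))).setReg (d + 2) 1).setReg x (i + 1))
        (Runs.add _ _ _ ?_) ?_
      · simp [ne hx 2, hr2 x (by omega), hx1]
      rintro _ rfl
      have he : e.eval s1 = e.eval ((fill a x e i s₀).setReg x i) := by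
        refine e.eval_congr (fun r h => ?_) fun a _ => by simp [ha1]
        rw [State.setReg_reg, fill_reg]
        split_ifs with hrx
        · rw [hrx, hx1]
        · exact hr1 r (hd r (.inr (.inr h))) hrx
      refine Runs.sub _ _ _ ⟨⟨?_, fun r hr hrx => ?_, ?_, ?_⟩, ?_⟩
      · funext a' j
        rw [fill, State.setReg_arr, State.setReg_arr, State.setReg_arr, State.setArr_arr,
          State.setArr_arr, hv2, he, ha2, ha1]
      · simp [hrx, ne hr 1, ne hr 2, hr2 r (by omega),
          hr1 r hr hrx]
      · simp [ne hx 1]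
      · simp [hx.ne', hr2, hs1]
      · simp [(ne hx 1).symm, (ne hx 2).symm, hr2, hc1]
        omega
    · refine ⟨by simp [has, fill], fun r hr hrx => ?_, by simp, ?_⟩
      · simp [hrx, hr.ne, ne hr 1, hrs r hr]
      · simp [hx.ne']
    · simp [(ne hx 1).symm]
    · rintro s2 ⟨ha2, hr2, hx2, hs2⟩
      refine Expr.runs_copy (by omega) ⟨by simp [ha2, run], fun r hr => ?_⟩
      rw [State.setReg_reg, run, fill_reg]
      split_ifs with h
      · rw [hs2, h]
      · exact hr2 r hr h

/-- The statement changes nothing that the other statement mentions. -/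
def indep (st st' : Stmt) : Bool :=
  st.regTarget.all (fun r => decide (r ∉ st'.regs)) &&
    st.arrTarget.all (fun a => decide (a ∉ st'.arrs))

/-- An assignment does not read its own target. -/
def selfOk : Stmt → Bool
  | set r e => decide (r ∉ e.regs)
  | tab _ _ _ _ => true

theorem run_reg {st : Stmt} {r : ℕ} (h : r ∉ st.regTarget) (s : State) :
    (st.run s).reg r = s.reg r := by
  cases st with
  | set r' e => simp only [regTarget, List.mem_singleton] at h; simp [run, h]
  | tab a b x e => simp [run]

theorem run_arr {st : Stmt} {a : ℕ} (h : a ∉ st.arrTarget) (s : State) :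
    (st.run s).arr a = s.arr a := by
  cases st with
  | set r e => simp [run]
  | tab a' b x e => exact fill_arr_of_ne (by simpa [arrTarget] using h) _ _ _ _

/-- The state in which the cells of array `a` from `i` on are those of `f`. -/
def mask (s : State) (a i : ℕ) (f : ℕ → ℕ) : State where
  reg := s.reg
  arr := Function.update s.arr a fun j => if j < i then s.arr a j else f j

@[simp] theorem mask_reg (s : State) (a i : ℕ) (f : ℕ → ℕ) : (mask s a i f).reg = s.reg := rfl

@[simp] theorem mask_arr (s : State) (a i : ℕ) (f : ℕ → ℕ) (a' j : ℕ) : (mask s a i f).arr a' j =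
    if a' = a then if j < i then s.arr a j else f j else s.arr a' j := by
  by_cases h : a' = a
  · subst h; simp [mask]
  · simp [mask, h]

/-- The equation that a statement of a straight-line program imposes on the final state `s`. A cell
of a table is computed from the earlier cells of the table, the other ones being those of the
initial state `s₀`. -/
def Sat (s₀ : State) : Stmt → State → Prop
  | set r e, s => s.reg r = e.eval s
  | tab a b x e, s =>
    ∀ i < s.reg b, s.arr a i = e.eval ((mask s a i (s₀.arr a)).setReg x i)

theorem sat_run {st : Stmt} (h : st.selfOk = true) (s : State) : st.Sat s (st.run s) := by
  cases st with
  | set r e =>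
    simp only [selfOk, decide_eq_true_eq] at h
    simp [Sat, run, e.eval_setReg h]
  | tab a b x e =>
    intro i hi
    simp only [run, fill_reg] at hi ⊢
    rw [fill_arr_of_lt _ _ _ hi]
    refine e.eval_congr (fun r _ => by simp) fun a' _ => funext fun j => ?_
    simp only [State.setReg_arr, mask_arr]
    split_ifs with h1 h2
    · rw [h1, fill_arr_of_lt _ _ _ h2, fill_arr_of_lt _ _ _ (h2.trans hi)]
    · rw [h1, fill_arr_of_le _ _ _ (by omega)]
    · rw [fill_arr_of_ne h1, fill_arr_of_ne h1]

theorem sat_congr {st : Stmt} {s₀ s s' : State} (hr : ∀ r ∈ st.regs, s.reg r = s'.reg r)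
    (ha : ∀ a ∈ st.arrs, s.arr a = s'.arr a) (h : st.Sat s₀ s) : st.Sat s₀ s' := by
  cases st with
  | set r e =>
    simp only [regs, arrs, List.mem_cons] at hr ha
    rw [Sat, ← hr r (.inl rfl), h]
    exact e.eval_congr (fun r h => hr r (.inr h)) ha
  | tab a b x e =>
    simp only [regs, arrs, List.mem_cons] at hr ha
    intro i hi
    rw [← hr b (.inl rfl)] at hi
    rw [← ha a (.inl rfl), h i hi]
    refine e.eval_congr (fun r h => ?_) fun a' h' => funext fun j => ?_
    · simp [hr r (.inr (.inr h))]
    · simp [ha a (.inl rfl), ha a' (.inr h')]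

/-- The effect of a straight-line program. -/
def runAll : List Stmt → State → State
  | [], s => s
  | st :: p, s => runAll p (st.run s)

/-- Single assignment: no statement changes anything that an earlier one mentions. -/
def ssa : List Stmt → Bool
  | [] => true
  | st :: p => st.selfOk && (p.all (fun st' => st'.indep st) && ssa p)

theorem runAll_reg {p : List Stmt} {r : ℕ} (h : ∀ st ∈ p, r ∉ st.regTarget) (s : State) :
    (runAll p s).reg r = s.reg r := by
  induction p generalizing s with
  | nil => rfl
  | cons st p ih =>
    rw [runAll, ih (fun st' h' => h st' (List.mem_cons_of_mem _ h')),
      run_reg (h st List.mem_cons_self)]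

theorem runAll_arr {p : List Stmt} {a : ℕ} (h : ∀ st ∈ p, a ∉ st.arrTarget) (s : State) :
    (runAll p s).arr a = s.arr a := by
  induction p generalizing s with
  | nil => rfl
  | cons st p ih =>
    rw [runAll, ih (fun st' h' => h st' (List.mem_cons_of_mem _ h')),
      run_arr (h st List.mem_cons_self)]

theorem regTarget_subset {st : Stmt} {r : ℕ} (h : r ∈ st.regTarget) : r ∈ st.regs := by
  cases st with
  | set r' e => simp only [regTarget, List.mem_singleton] at h; simp [regs, h]
  | tab a b x e => simp [regTarget] at h

theorem arrTarget_subset {st : Stmt} {a : ℕ} (h : a ∈ st.arrTarget) : a ∈ st.arrs := by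
  cases st with
  | set r e => simp [arrTarget] at h
  | tab a' b x e => simp only [arrTarget, List.mem_singleton] at h; simp [arrs, h]

theorem notMem_of_indep {st : Stmt} {p : List Stmt} (h : p.all (fun st' => st'.indep st) = true) :
    (∀ r ∈ st.regs, ∀ st' ∈ p, r ∉ st'.regTarget) ∧
      ∀ a ∈ st.arrs, ∀ st' ∈ p, a ∉ st'.arrTarget := by
  simp only [indep, List.all_eq_true, Bool.and_eq_true, decide_eq_true_eq] at h
  exact ⟨fun r hr st' hst' hr' => (h st' hst').1 r hr' hr,
    fun a ha st' hst' ha' => (h st' hst').2 a ha' ha⟩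

/-- The final state of a single-assignment program satisfies the equations of its statements. -/
theorem sat_runAll {p : List Stmt} (h : ssa p = true) (s : State) :
    ∀ st ∈ p, st.Sat s (runAll p s) := by
  induction p generalizing s with
  | nil => simp
  | cons st p ih =>
    simp only [ssa, Bool.and_eq_true] at h
    obtain ⟨hr, ha⟩ := notMem_of_indep h.2.1
    intro st' hst'
    rcases List.mem_cons.1 hst' with rfl | hst'
    · exact sat_congr (fun r hr' => (runAll_reg (hr r hr') _).symm)
        (fun a ha' => (runAll_arr (ha a ha') _).symm) (sat_run h.1 s)
    · have := ih h.2.2 (st.run s) st' hst'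
      cases st' with
      | set r e => exact this
      | tab a b x e =>
        have hne : a ∉ st.arrTarget := fun h' =>
          ha a (arrTarget_subset h') _ hst' (by simp [arrTarget])
        simpa only [Sat, run_arr hne, runAll] using this

/-- A program for a straight-line program with the registers from `d` on as work space. -/
def compAll (d : ℕ) : List Stmt → Prog
  | [] => .const d 0
  | st :: p => .seq (st.comp d) (compAll d p)

/-- A bound on the running time when all loops have at most `B` rounds. -/
def costAll (B : ℕ) : List Stmt → ℕ
  | [] => 1
  | st :: p => st.cost B + costAll B p

/-- The program only mentions registers below `d`, and its loops range over registers of `S`. -/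
def wf (d : ℕ) (S : List ℕ) (p : List Stmt) : Bool :=
  p.all (fun st => st.regs.all (fun r => decide (r < d)) && st.loopsIn S) &&
    S.all fun r => decide (r < d)

/-- The compiled program runs in the given time bound if the registers of the loops are bounded
initially and in the end; under single assignment they are then bounded all the time. -/
theorem runs_compAll {p : List Stmt} {d : ℕ} {S : List ℕ} {B : ℕ} (hw : wf d S p = true)
    (hssa : ssa p = true) {s₀ s : State} (hs : Agree d s₀ s) (hB : ∀ r ∈ S, s₀.reg r ≤ B)
    (hB' : ∀ r ∈ S, (runAll p s₀).reg r ≤ B) :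
    Runs (compAll d p) s (costAll B p) (Agree d (runAll p s₀)) := by
  induction p generalizing s₀ s with
  | nil => exact Runs.const _ _ ⟨hs.1, fun r hr => by simpa [hr.ne, runAll] using hs.2 r hr⟩
  | cons st p ih =>
    simp only [wf, List.all_cons, Bool.and_eq_true, List.all_eq_true, decide_eq_true_eq] at hw
    obtain ⟨⟨⟨hst, hlo⟩, hp⟩, hS⟩ := hw
    simp only [ssa, Bool.and_eq_true] at hssa
    refine Runs.seq (runs_comp st hlo hst hS hs hB) fun s' hs' => ih ?_ hssa.2.2 hs' ?_ hB'
    · simp only [wf, Bool.and_eq_true, List.all_eq_true, decide_eq_true_eq]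
      exact ⟨hp, hS⟩
    · intro r hr
      by_cases h : r ∈ st.regTarget
      · rw [← runAll_reg ((notMem_of_indep hssa.2.1).1 r (regTarget_subset h))]
        exact hB' r hr
      · rw [run_reg h]
        exact hB r hr

theorem exists_costAll_le (p : List Stmt) :
    ∃ c, ∀ B, costAll B p ≤ c * (B + 1) ^ c := by
  have hup : ∀ {B x y d d' : ℕ}, x ≤ y * (B + 1) ^ d → y ≤ d' → d ≤ d' →
      x ≤ d' * (B + 1) ^ d' := fun h hy hd =>
    h.trans (Nat.mul_le_mul hy (Nat.pow_le_pow_right (by omega) hd))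
  induction p with
  | nil => exact ⟨1, fun B => by simp [costAll]⟩
  | cons st p ih =>
    obtain ⟨c, hc⟩ := ih
    have hst : ∃ c, ∀ B, st.cost B ≤ c * (B + 1) ^ c := by
      cases st with
      | set r e =>
        refine ⟨e.size + 2 + e.depth, fun B => ?_⟩
        have h1 := e.cost_le B
        have h2 : 1 ≤ (B + 1) ^ e.depth := Nat.one_le_pow _ _ (by omega)
        refine hup (y := e.size + 2) (d := e.depth) ?_ (by omega) (by omega)
        simp only [cost, add_mul]
        omega
      | tab a b x e =>
        refine ⟨e.size + 13 + (e.depth + 1), fun B => ?_⟩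
        have h1 := e.cost_le B
        have h2 : 1 ≤ (B + 1) ^ e.depth := Nat.one_le_pow _ _ (by omega)
        refine hup (y := e.size + 13) (d := e.depth + 1) ?_ (by omega) (by omega)
        simp only [cost]
        calc B * (e.cost B + 5) + 8
            ≤ B * (e.size * (B + 1) ^ e.depth + 5 * (B + 1) ^ e.depth) +
                8 * (B + 1) ^ e.depth := by
              gcongr <;> omega
          _ ≤ (e.size + 13) * (B + 1) ^ (e.depth + 1) := by
              rw [pow_succ]
              nlinarith [Nat.zero_le (B * (B + 1) ^ e.depth),
                Nat.zero_le (e.size * (B + 1) ^ e.depth)]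
    obtain ⟨c', hc'⟩ := hst
    refine ⟨c' + c, fun B => ?_⟩
    have h1 := hc B
    have h2 := hc' B
    have h3 : c * (B + 1) ^ c ≤ c * (B + 1) ^ (c' + c) :=
      Nat.mul_le_mul_left _ (Nat.pow_le_pow_right (by omega) (by omega))
    have h4 : c' * (B + 1) ^ c' ≤ c' * (B + 1) ^ (c' + c) :=
      Nat.mul_le_mul_left _ (Nat.pow_le_pow_right (by omega) (by omega))
    simp only [costAll, add_mul]
    omega

end Stmt

/-! ### Logic and arithmetic in expressions -/

namespace Expr

/-- Negation; as everywhere in the sequel, a truth value is `0` or `1`, and everything nonzero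
counts as true. -/
def not (e : Expr) : Expr := ite e (const 0) (const 1)

/-- Conjunction. -/
def and (e f : Expr) : Expr := ite e (ite f (const 1) (const 0)) (const 0)

/-- Disjunction. -/
def or (e f : Expr) : Expr := ite e (const 1) (ite f (const 1) (const 0))

/-- Implication. -/
def imp (e f : Expr) : Expr := ite e (ite f (const 1) (const 0)) (const 1)

/-- Comparison `e < f`. -/
def lt (e f : Expr) : Expr := ite (sub f e) (const 1) (const 0)

/-- Comparison `e ≤ f`. -/
def le (e f : Expr) : Expr := ite (sub e f) (const 0) (const 1)

/-- Comparison `e = f`. -/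
def eq (e f : Expr) : Expr := ite (add (sub e f) (sub f e)) (const 0) (const 1)

/-- The truth value of `e`. -/
def bool (e : Expr) : Expr := ite e (const 1) (const 0)

/-- Existence of a value of register `x` below the content of register `b` with the property `e`. -/
def ex (x b : ℕ) (e : Expr) : Expr := bool (sum x b (bool e))

/-- Truth of `e` for all values of register `x` below the content of register `b`. -/
def all (x b : ℕ) (e : Expr) : Expr := not (sum x b (not e))

/-- The product of the registers `x` and `y`, the first of which is at most the content of `b`. -/
def mul (b x y : ℕ) : Expr := sum 40 b (ite (lt (reg 40) (reg x)) (reg y) (const 0))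

/-- The quotient of the registers `x` and `y`, provided that it is at most the content of `b`. -/
def div (b x y : ℕ) : Expr :=
  sum 41 b (le (sum 40 b (ite (le (reg 40) (reg 41)) (reg y) (const 0))) (reg x))

/-- The entry in row `u` and column `v` of a matrix with `n` columns, stored in array `a` row by
row, where `u`, `v` and `n` are registers. -/
def entry (a n u v : ℕ) : Expr := load a (add (mul n u n) (reg v))

section

variable (s : State) (e f : Expr)

-- `(rfl)` instead of `rfl` keeps these equations out of `dsimp`, which would rewrite with them in
-- the condition of an `if` but not in its decidability instance.
@[simp] theorem eval_reg (r : ℕ) : (reg r).eval s = s.reg r := (rfl)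

@[simp] theorem eval_const (c : ℕ) : (const c).eval s = c := (rfl)

@[simp] theorem eval_add : (add e f).eval s = e.eval s + f.eval s := (rfl)

@[simp] theorem eval_sub : (sub e f).eval s = e.eval s - f.eval s := (rfl)

@[simp] theorem eval_load (a : ℕ) : (load a e).eval s = s.arr a (e.eval s) := (rfl)

@[simp] theorem eval_ite (c : Expr) :
    (ite c e f).eval s = if c.eval s = 0 then f.eval s else e.eval s := by
  by_cases h : c.eval s = 0 <;> simp [eval, h]

@[simp] theorem eval_letE (x : ℕ) :
    (letE x e f).eval s = f.eval (s.setReg x (e.eval s)) := (rfl)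

@[simp] theorem eval_sum (x b : ℕ) :
    (sum x b e).eval s = ∑ i ∈ Finset.range (s.reg b), e.eval (s.setReg x i) := (rfl)

open Classical in
@[simp] theorem eval_not : (not e).eval s = if e.eval s = 0 then 1 else 0 := by
  by_cases h : e.eval s = 0 <;> simp [not, h]

open Classical in
@[simp] theorem eval_and :
    (and e f).eval s = if e.eval s ≠ 0 ∧ f.eval s ≠ 0 then 1 else 0 := by
  by_cases h : e.eval s = 0 <;> simp [and, h]

open Classical in
@[simp] theorem eval_or :
    (or e f).eval s = if e.eval s ≠ 0 ∨ f.eval s ≠ 0 then 1 else 0 := by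
  by_cases h : e.eval s = 0 <;> simp [or, h]

open Classical in
@[simp] theorem eval_imp :
    (imp e f).eval s = if e.eval s ≠ 0 → f.eval s ≠ 0 then 1 else 0 := by
  by_cases h : e.eval s = 0 <;> simp [imp, h]

open Classical in
@[simp] theorem eval_lt : (lt e f).eval s = if e.eval s < f.eval s then 1 else 0 := by
  by_cases h : f.eval s ≤ e.eval s
  · simp [lt, h, h.not_gt]
  · simp [lt, Nat.sub_eq_zero_iff_le, h, not_le.1 h]

open Classical in
@[simp] theorem eval_le : (le e f).eval s = if e.eval s ≤ f.eval s then 1 else 0 := by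
  by_cases h : e.eval s ≤ f.eval s <;> simp [le, Nat.sub_eq_zero_iff_le, h]

open Classical in
@[simp] theorem eval_eq : (eq e f).eval s = if e.eval s = f.eval s then 1 else 0 := by
  have h : e.eval s - f.eval s + (f.eval s - e.eval s) = 0 ↔ e.eval s = f.eval s := by omega
  by_cases h' : e.eval s = f.eval s <;> simp only [eq, eval_ite, eval_add, eval_sub, h] <;>
    simp [h']

open Classical in
@[simp] theorem eval_bool : (bool e).eval s = if e.eval s ≠ 0 then 1 else 0 := by
  by_cases h : e.eval s = 0 <;> simp [bool, h]

open Classical in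
@[simp] theorem eval_ex (x b : ℕ) :
    (ex x b e).eval s = if ∃ i < s.reg b, e.eval (s.setReg x i) ≠ 0 then 1 else 0 := by
  simp [ex]

open Classical in
@[simp] theorem eval_all (x b : ℕ) :
    (all x b e).eval s = if ∀ i < s.reg b, e.eval (s.setReg x i) ≠ 0 then 1 else 0 := by
  simp [all]

end

theorem sum_range_ite_lt {B m : ℕ} (h : m ≤ B) (c : ℕ) :
    (∑ i ∈ Finset.range B, if i < m then c else 0) = m * c := by
  rw [← Finset.sum_filter]
  have : (Finset.range B).filter (· < m) = Finset.range m := by ext; simp; omega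
  simp [this]

theorem eval_mul {s : State} {b x y : ℕ} (hx : x ≠ 40) (hy : y ≠ 40) (h : s.reg x ≤ s.reg b) :
    (mul b x y).eval s = s.reg x * s.reg y := by
  rw [← sum_range_ite_lt h]
  simp only [← not_le, ite_not]
  simp [mul, hx, hy]

theorem eval_div {s : State} {b x y : ℕ} (hx : x ≠ 41) (hy : y ≠ 40) (hy' : y ≠ 41)
    (hb : b ≠ 41) (h0 : 0 < s.reg y) (h : s.reg x / s.reg y ≤ s.reg b) :
    (div b x y).eval s = s.reg x / s.reg y := by
  have key : ∀ i < s.reg b, (∑ j ∈ Finset.range (s.reg b), if j ≤ i then s.reg y else 0) =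
      (i + 1) * s.reg y := by
    intro i hi
    rw [← sum_range_ite_lt (by omega : i + 1 ≤ s.reg b)]
    simp only [Nat.lt_succ_iff]
  rw [← mul_one (s.reg x / s.reg y), ← sum_range_ite_lt h]
  simp only [div, eval_sum]
  refine Finset.sum_congr rfl fun i hi => ?_
  rw [Finset.mem_range] at hi
  have hi' := key i hi
  simp only [eval_le, eval_sum, eval_ite, eval_reg, State.setReg_reg, if_neg hx,
    if_neg hy, if_neg hy', eval_const, if_neg hb, if_true]
  simp only [show (41 : ℕ) ≠ 40 by decide, if_false, ite_eq_right_iff, one_ne_zero, imp_false,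
    ite_not, hi']
  simp only [Nat.lt_iff_add_one_le, Nat.le_div_iff_mul_le h0]

theorem eval_entry {s : State} {a n u v : ℕ} (hu : u ≠ 40) (hn : n ≠ 40) (h : s.reg u ≤ s.reg n) :
    (entry a n u v).eval s = s.arr a (s.reg u * s.reg n + s.reg v) := by
  simp [entry, eval_mul hu hn h]

end Expr

/-! ### Thinness relative to a set of vertices -/

section

variable {V W : Type*}

/-- The subgraph induced on `S` is `t`-thin; the order is given by an injective numbering `pos` of
the vertices and the partition by a colouring `c`. -/
def ThinOn (G : SimpleGraph V) (S : Set V) (t : ℕ) : Prop :=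
  ∃ pos c : V → ℕ, Set.InjOn pos S ∧ (∀ v ∈ S, c v < t) ∧ ∀ u ∈ S, ∀ v ∈ S, ∀ w ∈ S,
    pos u < pos v → pos v < pos w → c u = c v → G.Adj u w → G.Adj v w

/-- Orders on a finite set can be given by numberings that start with zero. -/
theorem isThin_iff [Fintype V] (G : SimpleGraph V) (t : ℕ) : IsThin G t ↔
    ∃ pos c : V → ℕ, Function.Injective pos ∧ (∀ v, pos v < Fintype.card V) ∧ (∀ v, c v < t) ∧
      ∀ u v w, pos u < pos v → pos v < pos w → c u = c v → G.Adj u w → G.Adj v w := by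
  classical
  constructor
  · rintro ⟨lt, hlt, c, hc⟩
    have hirr : ∀ x, ¬ lt x x := hlt.toIrrefl.irrefl
    have htr : ∀ x y z, lt x y → lt y z → lt x z := fun x y z => hlt.toIsTrans.trans x y z
    have htri : ∀ x y, ¬ lt x y → ¬ lt y x → x = y := hlt.toTrichotomous.trichotomous
    let pos : V → ℕ := fun v => (Finset.univ.filter fun u => lt u v).card
    have hmono : ∀ u v, lt u v → pos u < pos v := by
      intro u v h
      refine Finset.card_lt_card (Finset.ssubset_iff_of_subset ?_ |>.2 ⟨u, ?_, ?_⟩)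
      · intro x hx
        simp only [Finset.mem_filter, Finset.mem_univ, true_and] at hx ⊢
        exact htr _ _ _ hx h
      · simpa using h
      · simpa using hirr u
    have hiff : ∀ u v, pos u < pos v ↔ lt u v := by
      refine fun u v => ⟨fun h => ?_, hmono u v⟩
      by_contra h'
      by_cases h'' : lt v u
      · exact absurd (hmono _ _ h'') (by omega)
      · rw [htri _ _ h' h''] at h
        omega
    refine ⟨pos, fun v => c v, fun u v h => ?_, fun v => ?_, fun v => (c v).2,
      fun u v w h1 h2 h3 => hc u v w ((hiff _ _).1 h1) ((hiff _ _).1 h2) (Fin.ext h3)⟩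
    · refine htri _ _ (fun h' => ?_) (fun h' => ?_) <;> exact absurd (hmono _ _ h') (by omega)
    · refine Finset.card_lt_card (Finset.ssubset_iff_of_subset (Finset.subset_univ _) |>.2
        ⟨v, Finset.mem_univ _, ?_⟩)
      simpa using hirr v
  · rintro ⟨pos, c, hpos, -, hc, h⟩
    refine ⟨fun u v => pos u < pos v, ?_, fun v => ⟨c v, hc v⟩,
      fun u v w h1 h2 h3 => h u v w h1 h2 (by simpa using h3)⟩
    exact
      { trichotomous := fun a b h1 h2 => hpos (by omega)
        irrefl := fun a => lt_irrefl _
        trans := fun a b c h1 h2 => lt_trans h1 h2 }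

theorem isThin_card [Fintype V] (G : SimpleGraph V) : IsThin G (Fintype.card V) := by
  let e := Fintype.equivFin V
  refine (isThin_iff G _).2 ⟨fun v => e v, fun v => e v, fun u v h => e.injective (Fin.ext h),
    fun v => (e v).2, fun v => (e v).2, fun u v w h1 h2 h3 => ?_⟩
  omega

theorem thinness_le_iff [Fintype V] (G : SimpleGraph V) (t : ℕ) :
    thinness G ≤ t ↔ IsThin G t := by
  refine ⟨fun h => ?_, fun h => Nat.sInf_le h⟩
  have hne : {k | IsThin G k}.Nonempty := ⟨_, isThin_card G⟩
  have hmem : IsThin G (thinness G) := Nat.sInf_mem hne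
  obtain ⟨pos, c, h1, h2, h3, h4⟩ := (isThin_iff G _).1 hmem
  exact (isThin_iff G _).2 ⟨pos, c, h1, h2, fun v => (h3 v).trans_le h, h4⟩

theorem thinness_le_card [Fintype V] (G : SimpleGraph V) : thinness G ≤ Fintype.card V :=
  (thinness_le_iff G _).2 (isThin_card G)

theorem thinness_comap_le_iff [Fintype W] (G : SimpleGraph V) {f : W → V}
    (hf : Function.Injective f) (t : ℕ) :
    thinness (G.comap f) ≤ t ↔ ThinOn G (Set.range f) t := by
  rw [thinness_le_iff]
  constructor
  · intro h
    obtain ⟨pos, c, h1, -, h3, h4⟩ := (isThin_iff _ _).1 h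
    rcases isEmpty_or_nonempty W with hW | hW
    · exact ⟨fun _ => 0, fun _ => 0, by simp [Set.range_eq_empty], by simp, by simp⟩
    have hinv : ∀ x, Function.invFun f (f x) = x := Function.leftInverse_invFun hf
    refine ⟨pos ∘ Function.invFun f, c ∘ Function.invFun f, ?_, ?_, ?_⟩
    · rintro _ ⟨x, rfl⟩ _ ⟨y, rfl⟩ hxy
      simp only [Function.comp, hinv] at hxy
      rw [h1 hxy]
    · rintro _ ⟨x, rfl⟩
      simpa only [Function.comp, hinv] using h3 x
    · rintro _ ⟨x, rfl⟩ _ ⟨y, rfl⟩ _ ⟨z, rfl⟩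
      simpa only [Function.comp, hinv, SimpleGraph.comap_adj] using h4 x y z
  · rintro ⟨pos, c, h1, h2, h3⟩
    have hp : Function.Injective (pos ∘ f) := fun x y h =>
      hf (h1 (Set.mem_range_self x) (Set.mem_range_self y) h)
    refine ⟨fun u v => pos (f u) < pos (f v), ?_, fun v => ⟨c (f v), h2 _ (Set.mem_range_self v)⟩,
      fun u v w h4 h5 h6 => h3 _ (Set.mem_range_self u) _ (Set.mem_range_self v) _
        (Set.mem_range_self w) h4 h5 (by simpa using h6)⟩
    exact
      { trichotomous := fun a b h1 h2 => hp (by simp only [Function.comp]; omega)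
        irrefl := fun a => lt_irrefl _
        trans := fun a b c h1 h2 => lt_trans h1 h2 }

theorem ThinOn.mono {G : SimpleGraph V} {S T : Set V} {t : ℕ} (h : ThinOn G T t) (hST : S ⊆ T) :
    ThinOn G S t := by
  obtain ⟨pos, c, h1, h2, h3⟩ := h
  exact ⟨pos, c, h1.mono hST, fun v hv => h2 v (hST hv), fun u hu v hv w hw =>
    h3 u (hST hu) v (hST hv) w (hST hw)⟩

/-! ### Twins -/

/-- A vertex `v` that looks like `a` from outside is put immediately after `a` into the class of
`a`. The only triples that may fail are those formed with `a` and `v`. -/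
theorem thinOn_insert_after {G : SimpleGraph V} {S : Set V} {t : ℕ} {pos c : V → ℕ}
    (h1 : Set.InjOn pos S) (h2 : ∀ v ∈ S, c v < t)
    (h3 : ∀ u ∈ S, ∀ v ∈ S, ∀ w ∈ S,
      pos u < pos v → pos v < pos w → c u = c v → G.Adj u w → G.Adj v w)
    {a v : V} (ha : a ∈ S) (hv : v ∉ S) (hav : ∀ w ∈ S, w ≠ a → (G.Adj a w ↔ G.Adj v w))
    (hbefore : G.Adj v a ∨ ∀ x ∈ S, pos x < pos a → c x = c a → ¬ G.Adj x a) :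
    ThinOn G (insert v S) t := by
  classical
  have hne : ∀ {x}, x ∈ S → x ≠ v := fun hx h => hv (h ▸ hx)
  refine ⟨fun x => if x = v then 2 * pos a + 1 else 2 * pos x,
    fun x => if x = v then c a else c x, ?_, ?_, ?_⟩
  · rintro x (rfl | hx) y (rfl | hy) hxy
    · rfl
    · simp [hne hy] at hxy; omega
    · simp [hne hx] at hxy; omega
    · simp [hne hx, hne hy] at hxy; exact h1 hx hy hxy
  · rintro x (rfl | hx)
    · simpa using h2 a ha
    · simpa [hne hx] using h2 x hx
  · rintro x (rfl | hx) y (rfl | hy) z (rfl | hz) <;> simp only [if_true] <;> intro hxy hyz hc hadj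
    · omega
    · omega
    · omega
    · rw [if_neg (hne hy)] at hxy hyz hc
      rw [if_neg (hne hz)] at hyz
      have hza : z ≠ a := by rintro rfl; omega
      exact h3 a ha y hy z hz (by omega) (by omega) hc ((hav z hz hza).2 hadj)
    · omega
    · rw [if_neg (hne hx)] at hxy hc
      rw [if_neg (hne hz)] at hyz
      have hza : z ≠ a := by rintro rfl; omega
      refine (hav z hz hza).1 ?_
      by_cases hxa : x = a
      · rwa [hxa] at hadj
      · have : pos x ≠ pos a := fun h => hxa (h1 hx ha h)
        exact h3 x hx a ha z hz (by omega) (by omega) hc hadj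
    · rw [if_neg (hne hx)] at hxy hc
      rw [if_neg (hne hy)] at hxy hyz hc
      have hxa : x ≠ a := by rintro rfl; omega
      have hadj' : G.Adj x a := ((hav x hx hxa).2 hadj.symm).symm
      by_cases hya : y = a
      · subst hya
        rcases hbefore with h | h
        · exact h.symm
        · exact absurd hadj' (h x hx (by omega) hc)
      · have : pos y ≠ pos a := fun h => hya (h1 hy ha h)
        exact ((hav y hy hya).1 (h3 x hx y hy a ha (by omega) (by omega) hc hadj').symm).symm
    · rw [if_neg (hne hx)] at hxy hc
      rw [if_neg (hne hy)] at hxy hyz hc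
      rw [if_neg (hne hz)] at hyz
      exact h3 x hx y hy z hz (by omega) (by omega) hc hadj

/-- Adding a true twin of a vertex does not raise the thinness. -/
theorem ThinOn.insert_trueTwin {G : SimpleGraph V} {S : Set V} {t : ℕ} (h : ThinOn G S t)
    {a v : V} (ha : a ∈ S) (hadj : G.Adj v a)
    (hav : ∀ w ∈ S, w ≠ a → w ≠ v → (G.Adj a w ↔ G.Adj v w)) : ThinOn G (insert v S) t := by
  by_cases hv : v ∈ S
  · rwa [Set.insert_eq_of_mem hv]
  obtain ⟨pos, c, h1, h2, h3⟩ := h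
  exact thinOn_insert_after h1 h2 h3 ha hv
    (fun w hw hwa => hav w hw hwa fun h => hv (h ▸ hw)) (.inl hadj)

/-- Adding a vertex that has two false twins does not raise the thinness: if `a` precedes `b`, then
no earlier vertex of the class of `a` is adjacent to `a`, for it would be adjacent to `b` and force
the edge `ab`. -/
theorem ThinOn.insert_falseTwin {G : SimpleGraph V} {S : Set V} {t : ℕ} (h : ThinOn G S t)
    {a b v : V} (ha : a ∈ S) (hb : b ∈ S) (hab : a ≠ b)
    (hav : ∀ w ∈ S, G.Adj a w ↔ G.Adj v w) (hbv : ∀ w ∈ S, G.Adj b w ↔ G.Adj v w) :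
    ThinOn G (insert v S) t := by
  by_cases hv : v ∈ S
  · rwa [Set.insert_eq_of_mem hv]
  obtain ⟨pos, c, h1, h2, h3⟩ := h
  have hnadj : ¬ G.Adj a b := fun h' =>
    (G.irrefl : ¬ G.Adj a a) ((hav a ha).2 ((hbv a ha).1 h'.symm))
  wlog hlt : pos a < pos b generalizing a b
  · have hpos : pos a ≠ pos b := fun h' => hab (h1 ha hb h')
    exact this hb ha hab.symm hbv hav (fun h' => hnadj h'.symm) (by omega)
  refine thinOn_insert_after h1 h2 h3 ha hv (fun w hw _ => hav w hw) (.inr ?_)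
  intro x hx hxa hc hadj
  exact hnadj (h3 x hx a ha b hb hxa hlt hc (((hbv x hx).2 ((hav x hx).1 hadj.symm)).symm))

end

/-! ### Covers -/

section

variable {V W : Type*}

/-- The edges of the subgraph induced on `S` that have to be covered: all edges for vertex covers,
and the edges that do not join twins for twin-covers, which are the case `tw = true`. -/
def MustCover (tw : Bool) (G : SimpleGraph V) (S : Set V) (a b : V) : Prop :=
  G.Adj a b ∧ (tw = true → ∃ w ∈ S, w ≠ a ∧ w ≠ b ∧ ¬ (G.Adj a w ↔ G.Adj b w))

theorem MustCover.symm {tw : Bool} {G : SimpleGraph V} {S : Set V} {a b : V}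
    (h : MustCover tw G S a b) : MustCover tw G S b a :=
  ⟨h.1.symm, fun htw => by
    obtain ⟨w, h1, h2, h3, h4⟩ := h.2 htw
    exact ⟨w, h1, h3, h2, fun h => h4 h.symm⟩⟩

/-- The set `C` covers the subgraph induced on `S`. -/
def IsCover (tw : Bool) (G : SimpleGraph V) (S : Set V) (C : Finset V) : Prop :=
  ∀ a ∈ S, ∀ b ∈ S, MustCover tw G S a b → a ∈ C ∨ b ∈ C

/-- The twin-cover number for `tw = true`, and the vertex cover number for `tw = false`. -/
noncomputable def coverNumber (tw : Bool) : GraphParam := fun _ G =>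
  if tw = true then twinCoverNumber G else vertexCoverNumber G

theorem closedNeighborSet_eq_iff {G : SimpleGraph V} {a b : V} (h : G.Adj a b) :
    closedNeighborSet G a = closedNeighborSet G b ↔
      ∀ w, w ≠ a → w ≠ b → (G.Adj a w ↔ G.Adj b w) := by
  simp only [closedNeighborSet, Set.ext_iff, Set.mem_insert_iff, SimpleGraph.mem_neighborSet]
  refine forall_congr' fun w => ?_
  by_cases h1 : w = a
  · subst h1; simp [h.symm]
  by_cases h2 : w = b
  · subst h2; simp [h]
  · simp [h1, h2]

theorem isTwinCover_iff {G : SimpleGraph V} {C : Finset V} :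
    IsTwinCover G (C : Set V) ↔ IsCover true G Set.univ C := by
  simp only [IsTwinCover, IsCover, MustCover, Set.mem_univ, true_and, forall_true_left,
    Finset.mem_coe]
  refine forall_congr' fun a => forall_congr' fun b => ?_
  by_cases h : G.Adj a b
  · simp only [h, true_and, forall_true_left, closedNeighborSet_eq_iff h]
    by_cases h' : ∃ w, w ≠ a ∧ w ≠ b ∧ ¬ (G.Adj a w ↔ G.Adj b w)
    · have : ¬ ∀ w, w ≠ a → w ≠ b → (G.Adj a w ↔ G.Adj b w) := by
        obtain ⟨w, h1, h2, h3⟩ := h'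
        exact fun hall => h3 (hall w h1 h2)
      simp only [eq_false this, eq_true h', or_false, forall_true_left]
    · have : ∀ w, w ≠ a → w ≠ b → (G.Adj a w ↔ G.Adj b w) :=
        fun w h1 h2 => by_contra fun h3 => h' ⟨w, h1, h2, h3⟩
      simp only [eq_true this, eq_false h', or_true, false_imp_iff]
  · simp [h]

theorem twinCoverNumber_le_iff [Finite V] (G : SimpleGraph V) (k : ℕ) :
    twinCoverNumber G ≤ k ↔ ∃ C : Finset V, C.card ≤ k ∧ IsCover true G Set.univ C := by
  have hne : {k | ∃ X : Set V, X.Finite ∧ X.ncard = k ∧ IsTwinCover G X}.Nonempty :=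
    ⟨_, Set.univ, Set.finite_univ, rfl, fun a b _ => .inl (Set.mem_univ a)⟩
  constructor
  · intro h
    obtain ⟨X, hX, hcard, hcov⟩ := Nat.sInf_mem hne
    refine ⟨hX.toFinset, ?_, isTwinCover_iff.1 (by simpa using hcov)⟩
    rw [← Set.ncard_eq_toFinset_card X hX, hcard]
    exact h
  · rintro ⟨C, hC, hcov⟩
    have hmem : C.card ∈ {k | ∃ X : Set V, X.Finite ∧ X.ncard = k ∧ IsTwinCover G X} :=
      ⟨C, C.finite_toSet, Set.ncard_coe_finset C, isTwinCover_iff.2 hcov⟩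
    exact (Nat.sInf_le hmem).trans hC

theorem vertexCoverNumber_le_iff [Finite V] (G : SimpleGraph V) (k : ℕ) :
    vertexCoverNumber G ≤ k ↔ ∃ C : Finset V, C.card ≤ k ∧ IsCover false G Set.univ C := by
  have hiff : ∀ C : Finset V, G.IsVertexCover (C : Set V) ↔ IsCover false G Set.univ C := by
    intro C
    simp [SimpleGraph.IsVertexCover, IsCover, MustCover]
  have htop : G.vertexCoverNum ≠ ⊤ := SimpleGraph.vertexCoverNum_ne_top_of_finite
  have hle : vertexCoverNumber G ≤ k ↔ G.vertexCoverNum ≤ k := by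
    rw [vertexCoverNumber, ← ENat.natCast_le_natCast, ENat.natCast_toNat htop]
  rw [hle]
  constructor
  · intro h
    obtain ⟨X, hX, hcov⟩ := G.vertexCoverNum_exists
    refine ⟨(Set.toFinite X).toFinset, ?_, (hiff _).1 (by simpa using hcov)⟩
    rw [← hX, (Set.toFinite X).encard_eq_coe_toFinset_card] at h
    exact_mod_cast h
  · rintro ⟨C, hC, hcov⟩
    refine (((hiff C).2 hcov).vertexCoverNum_le).trans ?_
    rw [Set.encard_coe_eq_coe_finsetCard]
    exact_mod_cast hC

theorem coverNumber_comap_le_iff {n : ℕ} (tw : Bool) (G : SimpleGraph V) {f : Fin n → V}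
    (hf : Function.Injective f) (k : ℕ) :
    coverNumber tw n (G.comap f) ≤ k ↔
      ∃ C : Finset V, C.card ≤ k ∧ IsCover tw G (Set.range f) C := by
  classical
  have h1 : coverNumber tw n (G.comap f) ≤ k ↔
      ∃ C : Finset (Fin n), C.card ≤ k ∧ IsCover tw (G.comap f) Set.univ C := by
    cases tw
    · simpa [coverNumber] using vertexCoverNumber_le_iff (G.comap f) k
    · simpa [coverNumber] using twinCoverNumber_le_iff (G.comap f) k
  have h2 : ∀ a b, MustCover tw (G.comap f) Set.univ a b ↔
      MustCover tw G (Set.range f) (f a) (f b) := by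
    intro a b
    simp [MustCover, hf.eq_iff]
  rw [h1]
  constructor
  · rintro ⟨C, hC, hcov⟩
    refine ⟨C.image f, Finset.card_image_le.trans hC, ?_⟩
    rintro _ ⟨a, rfl⟩ _ ⟨b, rfl⟩ hab
    exact (hcov a trivial b trivial ((h2 a b).2 hab)).imp (Finset.mem_image_of_mem f)
      (Finset.mem_image_of_mem f)
  · rintro ⟨C, hC, hcov⟩
    refine ⟨C.preimage f hf.injOn, ?_, fun a _ b _ hab => ?_⟩
    · refine le_trans ?_ hC
      rw [← Finset.card_image_of_injective _ hf]
      exact Finset.card_le_card (Finset.image_subset_iff.2 fun x hx => Finset.mem_preimage.1 hx)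
    · simpa using hcov (f a) ⟨a, rfl⟩ (f b) ⟨b, rfl⟩ ((h2 a b).1 hab)

theorem IsCover.mono {tw : Bool} {G : SimpleGraph V} {S T : Set V} {C : Finset V}
    (h : IsCover tw G T C) (hST : S ⊆ T) : IsCover tw G S C :=
  fun a ha b hb hab => h a (hST ha) b (hST hb) ⟨hab.1, fun htw => by
    obtain ⟨w, h1, h2⟩ := hab.2 htw
    exact ⟨w, hST h1, h2⟩⟩

theorem IsCover.isTwinCover {tw : Bool} {G : SimpleGraph V} {S : Set V} {C : Finset V}
    (h : IsCover tw G S C) : IsCover true G S C :=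
  fun a ha b hb hab => h a ha b hb ⟨hab.1, fun _ => hab.2 rfl⟩

end

/-! ### The reduced graph -/

section

open Classical in
/-- The first vertices of the classes of true twins among the vertices below `n`. -/
noncomputable def trueReps (G : SimpleGraph ℕ) (n : ℕ) : Finset ℕ :=
  (Finset.range n).filter fun v =>
    ¬ ∃ u < n, u < v ∧ G.Adj u v ∧ ∀ w < n, w ≠ u → w ≠ v → (G.Adj u w ↔ G.Adj v w)

open Classical in
/-- The first two vertices of the classes of false twins in the graph induced on `trueReps`. -/
noncomputable def reps (G : SimpleGraph ℕ) (n : ℕ) : Finset ℕ :=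
  (trueReps G n).filter fun v =>
    ((Finset.range n).filter fun u => u < v ∧ u ∈ trueReps G n ∧
      ∀ w < n, w ∈ trueReps G n → (G.Adj u w ↔ G.Adj v w)).card < 2

variable {G : SimpleGraph ℕ} {n : ℕ}

theorem mem_trueReps {v : ℕ} : v ∈ trueReps G n ↔ v < n ∧
    ¬ ∃ u < n, u < v ∧ G.Adj u v ∧ ∀ w < n, w ≠ u → w ≠ v → (G.Adj u w ↔ G.Adj v w) := by
  simp only [trueReps, Finset.mem_filter, Finset.mem_range]

open Classical in
theorem mem_reps {v : ℕ} : v ∈ reps G n ↔ v ∈ trueReps G n ∧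
    ((Finset.range n).filter fun u => u < v ∧ u ∈ trueReps G n ∧
      ∀ w < n, w ∈ trueReps G n → (G.Adj u w ↔ G.Adj v w)).card < 2 := by
  simp only [reps, Finset.mem_filter]

theorem reps_subset : reps G n ⊆ trueReps G n := fun _ hv => (mem_reps.1 hv).1

theorem trueReps_subset : trueReps G n ⊆ Finset.range n :=
  fun _ hv => Finset.mem_range.2 (mem_trueReps.1 hv).1

/-- If the vertices below `n` can be added to `S` in increasing order without raising the thinness,
then the thinness of the whole graph is at most that of the graph induced on `S`. -/
theorem ThinOn.of_step {S T : Set ℕ} {t : ℕ} (hT : T ⊆ Finset.range n)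
    (hstep : ∀ v ∈ T, v ∉ S → ThinOn G (S ∪ {u ∈ T | u < v}) t →
      ThinOn G (insert v (S ∪ {u ∈ T | u < v})) t) (h : ThinOn G S t) : ThinOn G T t := by
  have key : ∀ j, ThinOn G (S ∪ {u ∈ T | u < j}) t := by
    intro j
    induction j with
    | zero => simpa using h
    | succ j ih =>
      have hsub : S ∪ {u ∈ T | u < j + 1} ⊆ insert j (S ∪ {u ∈ T | u < j}) := by
        rintro x (hx | ⟨hx, hxj⟩)
        · exact .inr (.inl hx)
        · by_cases hxj' : x = j
          · exact .inl hxj'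
          · exact .inr (.inr ⟨hx, by omega⟩)
      by_cases hj : j ∈ T
      · by_cases hjS : j ∈ S
        · refine ih.mono (hsub.trans ?_)
          rw [Set.insert_eq_of_mem (.inl hjS)]
        · exact (hstep j hj hjS ih).mono hsub
      · refine ih.mono ?_
        rintro x (hx | ⟨hx, hxj⟩)
        · exact .inl hx
        · have : x ≠ j := fun h => hj (h ▸ hx)
          exact .inr ⟨hx, by omega⟩
  refine (key n).mono fun x hx => .inr ⟨hx, ?_⟩
  simpa using hT hx

open Classical in
/-- Passing to the reduced graph does not change the thinness. -/
theorem thinOn_reps_iff (t : ℕ) :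
    ThinOn G (reps G n : Set ℕ) t ↔ ThinOn G (Finset.range n : Set ℕ) t := by
  refine ⟨fun h => ?_, fun h => h.mono (by exact_mod_cast reps_subset.trans trueReps_subset)⟩
  have h1 : ThinOn G (trueReps G n : Set ℕ) t := by
    refine h.of_step (by exact_mod_cast trueReps_subset) ?_
    intro v hv hvS hthin
    have hv' : v ∈ trueReps G n := by simpa using hv
    have hcard : 1 < ((Finset.range n).filter fun u => u < v ∧ u ∈ trueReps G n ∧
        ∀ w < n, w ∈ trueReps G n → (G.Adj u w ↔ G.Adj v w)).card := by
      by_contra h'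
      exact hvS (mem_reps.2 ⟨hv', by omega⟩)
    obtain ⟨a, ha, b, hb, hab⟩ := Finset.one_lt_card.1 hcard
    simp only [Finset.mem_filter, Finset.mem_range] at ha hb
    have hmem : ∀ w ∈ (reps G n : Set ℕ) ∪ {u ∈ (trueReps G n : Set ℕ) | u < v},
        w < n ∧ w ∈ trueReps G n := by
      rintro w (hw | ⟨hw, -⟩)
      · have := reps_subset (by simpa using hw)
        exact ⟨by simpa using trueReps_subset this, this⟩
      · exact ⟨by simpa using trueReps_subset hw, by simpa using hw⟩
    exact hthin.insert_falseTwin (.inr ⟨ha.2.2.1, ha.2.1⟩) (.inr ⟨hb.2.2.1, hb.2.1⟩) hab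
      (fun w hw => ha.2.2.2 w (hmem w hw).1 (hmem w hw).2)
      (fun w hw => hb.2.2.2 w (hmem w hw).1 (hmem w hw).2)
  refine h1.of_step le_rfl ?_
  intro v hv hvS hthin
  have hvn : v < n := by simpa using hv
  have : ∃ u < n, u < v ∧ G.Adj u v ∧ ∀ w < n, w ≠ u → w ≠ v → (G.Adj u w ↔ G.Adj v w) := by
    by_contra h'
    exact hvS (mem_trueReps.2 ⟨hvn, h'⟩)
  obtain ⟨u, hun, huv, hadj, hw⟩ := this
  refine hthin.insert_trueTwin (.inr ⟨by simpa using hun, huv⟩) hadj.symm fun w hwS => hw w ?_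
  rcases hwS with hwS | ⟨hwS, -⟩
  · simpa using trueReps_subset hwS
  · simpa using hwS

/-- Outside a twin-cover there are only edges between true twins. -/
theorem not_adj_of_mem_trueReps {C : Finset ℕ}
    (hC : IsCover true G (Finset.range n : Set ℕ) C) {u v : ℕ} (hu : u ∈ trueReps G n)
    (hv : v ∈ trueReps G n) (huC : u ∉ C) (hvC : v ∉ C) : ¬ G.Adj u v := by
  intro hadj
  wlog huv : u < v generalizing u v
  · have hne : u ≠ v := G.ne_of_adj hadj
    exact this hv hu hvC huC hadj.symm (by omega)
  have hun := trueReps_subset hu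
  have hvn := trueReps_subset hv
  rw [Finset.mem_range] at hun hvn
  refine (mem_trueReps.1 hv).2 ⟨u, hun, huv, hadj, fun w hwn hwu hwv => ?_⟩
  by_contra hw
  have := hC u (by simpa using hun) v (by simpa using hvn)
    ⟨hadj, fun _ => ⟨w, by simpa using hwn, hwu, hwv, hw⟩⟩
  tauto

open Classical in
/-- The vertices of the reduced graph outside a twin-cover `C` are determined, up to the choice
between two false twins, by their neighbourhoods in `C`. -/
theorem card_reps_le {C : Finset ℕ} (hC : IsCover true G (Finset.range n : Set ℕ) C) :
    (reps G n).card ≤ C.card + 2 * 2 ^ C.card := by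
  have h1 : (reps G n \ C).card ≤ 2 * C.powerset.card := by
    refine Finset.card_le_mul_card_image_of_maps_to (f := fun v => C.filter (G.Adj v))
      (fun v _ => by simp) 2 fun N _ => ?_
    by_contra hlt
    set F := (reps G n \ C).filter fun v => C.filter (G.Adj v) = N
    have hF : F.Nonempty := Finset.card_pos.1 (by omega)
    have hmem : ∀ v ∈ F, v ∈ reps G n ∧ v ∉ C ∧ C.filter (G.Adj v) = N := by
      intro v hv
      simpa [F, and_assoc] using hv
    obtain ⟨hv1, hv2, hv3⟩ := hmem _ (F.max'_mem hF)
    set v := F.max' hF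
    have hsub : F.erase v ⊆ (Finset.range n).filter fun u => u < v ∧ u ∈ trueReps G n ∧
        ∀ w < n, w ∈ trueReps G n → (G.Adj u w ↔ G.Adj v w) := by
      intro u hu
      obtain ⟨huv, huF⟩ := Finset.mem_erase.1 hu
      obtain ⟨hu1, hu2, hu3⟩ := hmem u huF
      have hle : u ≤ v := F.le_max' u huF
      refine Finset.mem_filter.2 ⟨trueReps_subset (reps_subset hu1), by omega, reps_subset hu1,
        fun w _ hw => ?_⟩
      by_cases hwC : w ∈ C
      · have := Finset.ext_iff.1 (hu3.trans hv3.symm) w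
        simpa [hwC] using this
      · exact iff_of_false (not_adj_of_mem_trueReps hC (reps_subset hu1) hw hu2 hwC)
          (not_adj_of_mem_trueReps hC (reps_subset hv1) hw hv2 hwC)
    have h2 := Finset.card_le_card hsub
    rw [Finset.card_erase_of_mem (F.max'_mem hF)] at h2
    have h3 := (mem_reps.1 hv1).2
    omega
  have h2 : (reps G n).card ≤ C.card + (reps G n \ C).card := by
    have := Finset.card_le_card_sdiff_add_card (s := reps G n) (t := C)
    omega
  rw [Finset.card_powerset] at h1
  omega

end

/-! ### Testing the size of covers -/

section

variable {n : ℕ} {H : ℕ → ℕ → Prop}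

open Classical in
/-- Let the set `D` cover all edges of a graph. Every subset `Y` of `D` extends to a cover by the
neighbours of the rest of `D`, and every cover contains the one obtained from its trace on `D`. -/
theorem exists_cover_iff (hsymm : ∀ u v, H u v → H v u) {D : Finset ℕ}
    (hcov : ∀ u < n, ∀ v < n, H u v → u ∈ D ∨ v ∈ D) (k : ℕ) :
    (∃ C : Finset ℕ, C.card ≤ k ∧ ∀ u < n, ∀ v < n, H u v → u ∈ C ∨ v ∈ C) ↔
      ∃ Y : Finset ℕ, ((Finset.range n).filter fun w =>
        (w ∈ D ∧ w ∈ Y) ∨ ∃ u < n, u ∈ D ∧ u ∉ Y ∧ H u w).card ≤ k := by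
  constructor
  · rintro ⟨C, hC, h⟩
    refine ⟨C, (Finset.card_le_card fun w hw => ?_).trans hC⟩
    obtain ⟨hwn, hw | ⟨u, hun, -, huC, huw⟩⟩ := Finset.mem_filter.1 hw
    · exact hw.2
    · exact (h u hun w (by simpa using hwn) huw).resolve_left huC
  · rintro ⟨Y, hY⟩
    refine ⟨_, hY, fun u hu v hv huv => ?_⟩
    wlog huD : u ∈ D generalizing u v
    · exact (this v hv u hu (hsymm _ _ huv) ((hcov u hu v hv huv).resolve_left huD)).symm
    by_cases huY : u ∈ Y
    · exact .inl (Finset.mem_filter.2 ⟨by simpa using hu, .inl ⟨huD, huY⟩⟩)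
    · exact .inr (Finset.mem_filter.2 ⟨by simpa using hv, .inr ⟨u, hu, huD, huY, huv⟩⟩)

/-- A matching `m` has at most as many edges as a cover has vertices. -/
theorem card_matched_le {m : ℕ → ℕ → Prop} (hm : ∀ u v v', m u v → m u v' → v = v')
    (hsymm : ∀ u v, m u v → m v u) {D C : Finset ℕ} (hD : ∀ u ∈ D, ∃ v, m u v)
    (hC : ∀ u v, m u v → u ∈ C ∨ v ∈ C) : D.card ≤ 2 * C.card := by
  classical
  have hsub : D ⊆ C ∪ C.image fun c => if h : ∃ v, m c v then h.choose else 0 := by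
    intro u hu
    obtain ⟨v, huv⟩ := hD u hu
    rcases hC u v huv with h | h
    · exact Finset.mem_union_left _ h
    · refine Finset.mem_union_right _ (Finset.mem_image.2 ⟨v, h, ?_⟩)
      have hv : ∃ w, m v w := ⟨u, hsymm _ _ huv⟩
      rw [dif_pos hv]
      exact hm v _ _ hv.choose_spec (hsymm _ _ huv)
  have h1 := Finset.card_le_card hsub
  have h2 := Finset.card_union_le C (C.image fun c => if h : ∃ v, m c v then h.choose else 0)
  have h3 : (C.image fun c => if h : ∃ v, m c v then h.choose else 0).card ≤ C.card :=
    Finset.card_image_le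
  omega

end

/-! ### The encoding of instances -/

section

theorem getElem?_encode_matrix {n : ℕ} (f : Fin n → Fin n → Bool) (u v : Fin n) :
    ((List.finRange n).flatMap fun i => (List.finRange n).map fun j => f i j)[(u : ℕ) * n + v]? =
      some (f u v) := by
  have h : (List.finRange n).flatMap (fun i => (List.finRange n).map fun j => f i j) =
      List.ofFn fun e : Fin (n * n) => f e.divNat e.modNat := by
    rw [List.ofFn_mul, List.flatMap_def]
    congr 1
    rw [List.ofFn_eq_map]
    refine List.map_congr_left fun i _ => ?_
    rw [List.ofFn_eq_map]
    refine List.map_congr_left fun j _ => ?_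
    have hn : 0 < n := i.pos
    congr 1
    · ext
      simp [Fin.divNat, Nat.add_div_of_dvd_right, mul_comm, Nat.div_eq_of_lt j.2, hn]
    · ext; simp [Fin.modNat, Nat.mod_eq_of_lt j.2, mul_comm]
  have hlt : (u : ℕ) * n + v < n * n := by
    have := Nat.mul_le_mul_right n (show (u : ℕ) + 1 ≤ n from u.2)
    have := v.2
    rw [add_mul] at *
    omega
  have hn : 0 < n := u.pos
  rw [h, List.getElem?_ofFn, dif_pos hlt]
  congr 2
  · ext; simp [Fin.divNat, Nat.mul_add_div, mul_comm, Nat.div_eq_of_lt v.2, hn]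
  · ext; simp [Fin.modNat, Nat.mod_eq_of_lt v.2, mul_comm]

variable {n : ℕ} (G : SimpleGraph (Fin n)) (t : ℕ)

theorem length_encode : (encode G t).length = n + t + n * n + 2 := by
  simp [encode, List.length_flatMap]
  omega

/-- A string is the encoding of `G` and `t` if and only if it has the right length and the right
bits. -/
theorem eq_encode_iff (x : List Bool) : x = encode G t ↔
    x.length = n + t + n * n + 2 ∧ (∀ j < n, x[j]? = some true) ∧ x[n]? ≠ some true ∧
      (∀ j < t, x[n + 1 + j]? = some true) ∧ x[n + 1 + t]? ≠ some true ∧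
      ∀ u v : Fin n, x[n + t + 2 + (u * n + v)]? = some true ↔ G.Adj u v := by
  have key : (encode G t).length = n + t + n * n + 2 ∧
      (∀ j < n, (encode G t)[j]? = some true) ∧ (encode G t)[n]? ≠ some true ∧
      (∀ j < t, (encode G t)[n + 1 + j]? = some true) ∧ (encode G t)[n + 1 + t]? ≠ some true ∧
      ∀ u v : Fin n, (encode G t)[n + t + 2 + (u * n + v)]? = some true ↔ G.Adj u v := by
    refine ⟨length_encode G t, fun j hj => ?_, ?_, fun j hj => ?_, ?_, fun u v => ?_⟩
    · simp [encode, hj, List.getElem?_append_left]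
    · simp [encode]
    · rw [encode, List.getElem?_append_right (by simp; omega)]
      simp [show n + 1 + j - n = j + 1 by omega, hj, List.getElem?_append_left]
    · rw [encode, List.getElem?_append_right (by simp; omega)]
      simp [show n + 1 + t - n = t + 1 by omega]
    · rw [encode, List.getElem?_append_right (by simp; omega),
        show n + t + 2 + (u * n + v) - (List.replicate n true).length = (t + 1 + (u * n + v)) + 1 by
          simp; omega, List.getElem?_cons_succ, List.getElem?_append_right (by simp; omega),
        show t + 1 + (u * n + v) - (List.replicate t true).length = (u * n + v) + 1 by
          simp; omega, List.getElem?_cons_succ, getElem?_encode_matrix]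
      simp
  constructor
  · rintro rfl
    exact key
  · rintro ⟨h1, h2, h3, h4, h5, h6⟩
    obtain ⟨k1, k2, k3, k4, k5, k6⟩ := key
    have hbit : ∀ i < n + t + n * n + 2, x[i]? = some true ↔ (encode G t)[i]? = some true := by
      intro i hi
      rcases lt_trichotomy i n with h | h | h
      · simp [h2 i h, k2 i h]
      · subst h; simp only [h3, k3]
      rcases lt_trichotomy i (n + 1 + t) with h' | h' | h'
      · obtain ⟨j, rfl⟩ := Nat.exists_eq_add_of_le (show n + 1 ≤ i by omega)
        simp [h4 j (by omega), k4 j (by omega)]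
      · subst h'; simp only [h5, k5]
      · obtain ⟨e, rfl⟩ := Nat.exists_eq_add_of_le (show n + t + 2 ≤ i by omega)
        have he : e < n * n := by omega
        have hn : 0 < n := Nat.pos_of_ne_zero (by rintro rfl; omega)
        have := h6 ⟨e / n, (Nat.div_lt_iff_lt_mul hn).2 he⟩ ⟨e % n, Nat.mod_lt _ hn⟩
        have := k6 ⟨e / n, (Nat.div_lt_iff_lt_mul hn).2 he⟩ ⟨e % n, Nat.mod_lt _ hn⟩
        simp only [Nat.div_add_mod'] at *
        tauto
    refine List.ext_getElem? fun i => ?_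
    by_cases hi : i < n + t + n * n + 2
    · have := hbit i hi
      rw [List.getElem?_eq_getElem (by omega), List.getElem?_eq_getElem (by omega)] at this ⊢
      simp only [Option.some.injEq] at this ⊢
      exact Bool.eq_iff_iff.2 this
    · rw [List.getElem?_eq_none (by omega), List.getElem?_eq_none (by omega)]

end

/-- If `p` holds below `m` and fails at `m`, then `p` holds up to exactly `m` indices. -/
theorem card_leading {p : ℕ → Prop} {m L : ℕ} (hm : m < L) (h : ∀ j < m, p j)
    (h' : ¬ p m) [DecidablePred fun i => ∀ j < L, j ≤ i → p j] :
    ((Finset.range L).filter fun i => ∀ j < L, j ≤ i → p j).card = m := by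
  have key : ∀ i, (∀ j < L, j ≤ i → p j) ↔ i < m := fun i =>
    ⟨fun hi => by_contra fun hn => h' (hi m hm (by omega)), fun hi j _ hj => h j (by omega)⟩
  have : (Finset.range L).filter (fun i => ∀ j < L, j ≤ i → p j) = Finset.range m := by
    ext i; simp only [Finset.mem_filter, Finset.mem_range, key]; omega
  simp [this]

/-! ### The reduction as a straight-line program

Register 0 holds the length of the input, register 1 the parameter. The straight-line programs below
use the following registers and arrays for their results, each of which is assigned once.

* registers 2, 3, 4, 5: the number of vertices `n₀` and the threshold `t₀` that the input announces,
  `n₀²`, and whether the input is an encoding;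
* registers 6, 7, 8, 9: the number of vertices `n`, the threshold, `n²` and `n + 1`;
* register 10: whether the graph is left as it is;
* registers 11, 12: the number of vertices of a maximal matching and the number of sets of such
  vertices, if the size of covers is tested, and `0` if not;
* register 13: whether the input is an encoding and the test, if it took place, succeeded;
* registers 14, 15, 16: number of vertices, threshold and matrix size of the reduced instance;
* register 17: the constant `2`; registers 18, 19, 20: kernelization and decision procedure;
* arrays 0, 1, 2, 3, 4, 5: input, adjacency matrix, powers of two, matrix of the matching, its
  vertices and their ranks;
* arrays 6, 7, 8, 9: the representatives of the classes of true twins, the vertices that are kept,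
  their list, and the adjacency matrix of the reduced graph; array 10: kernelization and decision
  procedure.

Local variables are the registers from 30 on; 40 and 41 are reserved for products and quotients.
The registers from 60 on are the work space of the compiled programs. -/

namespace Expr

/-- Equivalence. -/
def iff (e f : Expr) : Expr := ite e (bool f) (not f)

open Classical in
@[simp] theorem eval_iff (e f : Expr) (s : State) :
    (iff e f).eval s = if (e.eval s ≠ 0 ↔ f.eval s ≠ 0) then 1 else 0 := by
  by_cases h : e.eval s = 0 <;> simp [iff, h]

/-- The digit of register `s` at the place of value `p`, in the base given by register `b`. The
content of register `B` is at least that of `s`. -/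
def digit (B b s : ℕ) (p : Expr) : Expr :=
  letE 37 p (letE 38 (div B s 37) (letE 39 (div B 38 b) (sub (reg 38) (mul B 39 b))))

theorem eval_digit {B b s : ℕ} {p : Expr} {σ : State} (hB : B < 30) (hb : b < 30) (hs : s < 37)
    (hb0 : 0 < σ.reg b) (hp : 0 < p.eval σ) (hle : σ.reg s ≤ σ.reg B) :
    (digit B b s p).eval σ = σ.reg s / p.eval σ % σ.reg b := by
  have neB : ∀ j, 30 ≤ j → B ≠ j := by omega
  have neb : ∀ j, 30 ≤ j → b ≠ j := by omega
  have nes : ∀ j, 37 ≤ j → s ≠ j := by omega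
  have h1 : (div B s 37).eval (σ.setReg 37 (p.eval σ)) = σ.reg s / p.eval σ := by
    have := (Nat.div_le_self _ (p.eval σ)).trans hle
    rw [eval_div (nes 41 (by decide)) (by decide) (by decide) (neB 41 (by decide))] <;>
      simp [nes 37, neB 37, this, hp]
  have h2 : σ.reg s / p.eval σ ≤ σ.reg B := (Nat.div_le_self _ _).trans hle
  have h3 : (div B 38 b).eval ((σ.setReg 37 (p.eval σ)).setReg 38 (σ.reg s / p.eval σ)) =
      σ.reg s / p.eval σ / σ.reg b := by
    have := (Nat.div_le_self _ (σ.reg b)).trans h2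
    rw [eval_div (by decide) (neb 40 (by decide)) (neb 41 (by decide)) (neB 41 (by decide))] <;>
      simp [neb 37, neb 38, neB 37, neB 38, this, hb0]
  rw [digit, eval_letE, eval_letE, h1, eval_letE, h3, eval_sub,
    eval_mul (by decide) (neb 40 (by decide))]
  · simp [neb 37, neb 38, neb 39, Nat.mod_eq_sub_mul_div, mul_comm]
  · have := (Nat.div_le_self _ (σ.reg b)).trans h2
    simpa [neB 37, neB 38, neB 39]

end Expr

open ThinFPT.Expr ThinFPT.Stmt

/-- The entry in row `u` and column `v` of the adjacency matrix within the input. -/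
def inputEntry (u v : ℕ) : Expr :=
  load 0 (add (add (add (reg 2) (reg 3)) (const 2)) (add (mul 2 u 2) (reg v)))

/-- Adjacency of the vertices in registers `u` and `v`. -/
def adjE (u v : ℕ) : Expr := entry 1 6 u v

/-- The edge between the vertices in registers `u` and `v` exists and has to be covered. -/
def mustE (tw : Bool) (u v : ℕ) : Expr :=
  if tw = true then
    and (adjE u v) (ex 35 6 (and (not (eq (reg 35) (reg u)))
      (and (not (eq (reg 35) (reg v))) (not (iff (adjE u 35) (adjE v 35))))))
  else adjE u v

/-- The vertex in register `w` is in the subset number `s` of the matched vertices. -/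
def chosenE (w : ℕ) : Expr := digit 12 17 36 (load 2 (load 5 (reg w)))

/-- The number of vertices `n₀`, the threshold `t₀`, whether the input is an encoding, the number of
vertices `n` and the threshold `t` (zero if the input is none), and the adjacency matrix. -/
def parse : List Stmt := [
  set 2 (sum 30 0 (all 31 0 (imp (le (reg 31) (reg 30)) (load 0 (reg 31))))),
  set 3 (sum 30 0 (all 31 0 (imp (le (reg 31) (reg 30))
    (load 0 (add (add (reg 2) (const 1)) (reg 31)))))),
  set 4 (mul 2 2 2),
  set 5 (and (eq (reg 0) (add (add (add (reg 2) (reg 3)) (reg 4)) (const 2)))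
    (and (all 31 0 (imp (lt (reg 31) (reg 2)) (load 0 (reg 31))))
    (and (not (load 0 (reg 2)))
    (and (all 31 0 (imp (lt (reg 31) (reg 3)) (load 0 (add (add (reg 2) (const 1)) (reg 31)))))
    (and (not (load 0 (add (add (reg 2) (const 1)) (reg 3))))
    (and (all 32 2 (not (inputEntry 32 32)))
      (all 32 2 (all 33 2 (imp (inputEntry 32 33) (inputEntry 33 32)))))))))),
  set 6 (ite (reg 5) (reg 2) (const 0)),
  set 7 (ite (reg 5) (reg 3) (const 0)),
  set 8 (mul 6 6 6),
  set 9 (add (reg 6) (const 1)),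
  tab 1 8 30 (load 0 (add (add (add (reg 2) (reg 3)) (const 2)) (reg 30)))]

/-- The powers of two, the flag `small` given by the expression `sm`, a greedy matching, its
vertices, their number and ranks, the number of subsets of the matched vertices (or zero), and
whether the input is fine and has a small cover. -/
def testCover (tw : Bool) (sm : Expr) : List Stmt := [
  tab 2 9 30 (ite (reg 30)
    (add (load 2 (sub (reg 30) (const 1))) (load 2 (sub (reg 30) (const 1)))) (const 1)),
  set 10 sm,
  set 17 (const 2),
  tab 3 8 30 (ex 32 6 (ex 33 6 (and (eq (add (mul 6 32 6) (reg 33)) (reg 30))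
    (and (mustE tw 32 33) (not (ex 34 6 (or (or (entry 3 6 32 34) (entry 3 6 34 32))
      (or (entry 3 6 33 34) (entry 3 6 34 33))))))))),
  tab 4 6 30 (ex 32 6 (or (entry 3 6 30 32) (entry 3 6 32 30))),
  set 11 (sum 32 6 (load 4 (reg 32))),
  tab 5 6 30 (sum 32 6 (and (lt (reg 32) (reg 30)) (load 4 (reg 32)))),
  set 12 (ite (or (reg 10) (lt (add (reg 1) (reg 1)) (reg 11))) (const 0) (load 2 (reg 11))),
  set 13 (and (reg 5) (or (reg 10) (ex 36 12 (le (sum 34 6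
    (or (and (load 4 (reg 34)) (chosenE 34))
      (ex 32 6 (and (load 4 (reg 32)) (and (not (chosenE 32)) (mustE tw 32 34)))))) (reg 1)))))]

/-- The vertices of the reduced graph, their number, their list, the threshold, and the adjacency
matrix of the reduced graph. -/
def reduce : List Stmt := [
  tab 6 6 33 (not (ex 32 6 (and (lt (reg 32) (reg 33)) (and (adjE 32 33)
    (all 34 6 (or (eq (reg 34) (reg 32)) (or (eq (reg 34) (reg 33))
      (iff (adjE 32 34) (adjE 33 34))))))))),
  tab 7 6 33 (or (reg 10) (and (load 6 (reg 33)) (lt (sum 32 6 (and (lt (reg 32) (reg 33))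
    (and (load 6 (reg 32)) (all 34 6 (imp (load 6 (reg 34)) (iff (adjE 32 34) (adjE 33 34)))))))
    (const 2)))),
  set 14 (ite (reg 13) (sum 33 6 (load 7 (reg 33))) (const 1)),
  tab 8 14 30 (sum 33 6 (ite (and (load 7 (reg 33))
    (eq (sum 32 6 (and (lt (reg 32) (reg 33)) (load 7 (reg 32)))) (reg 30))) (reg 33) (const 0))),
  set 15 (ite (reg 13) (sub (reg 14) (sub (reg 14) (reg 7))) (const 0)),
  set 16 (mul 14 14 14),
  tab 9 16 30 (and (reg 13) (ex 35 14 (ex 36 14 (and (eq (add (mul 14 35 14) (reg 36)) (reg 30))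
    (ex 32 6 (ex 33 6 (and (eq (reg 32) (load 8 (reg 35)))
      (and (eq (reg 33) (load 8 (reg 36))) (adjE 32 33)))))))))]

/-- The common part of the kernelization and of the decision procedure. -/
def core (tw : Bool) (sm : Expr) : List Stmt := parse ++ (testCover tw sm ++ reduce)

theorem eval_inputEntry {u v : ℕ} (hu : u ≠ 40) {s : State} (h : s.reg u ≤ s.reg 2) :
    (inputEntry u v).eval s =
      s.arr 0 (s.reg 2 + s.reg 3 + 2 + (s.reg u * s.reg 2 + s.reg v)) := by
  simp only [inputEntry, eval_load, eval_add, eval_mul hu (by decide : 2 ≠ 40) h, eval_reg,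
    eval_const]

section

variable {x : List Bool} {σ : State}

/-- The parser computes the encoded graph and threshold, and it recognizes the strings that encode
nothing; the latter are treated as the empty graph. -/
theorem parse_spec (h0 : ∀ i, σ.arr 0 i = if x[i]? = some true then 1 else 0)
    (hL : σ.reg 0 = x.length) {s₀ : State} (h : ∀ st ∈ parse, st.Sat s₀ σ) :
    ∃ G : SimpleGraph ℕ, σ.reg 2 ≤ x.length ∧ σ.reg 6 ≤ σ.reg 2 ∧ σ.reg 8 = σ.reg 6 * σ.reg 6 ∧
      σ.reg 9 = σ.reg 6 + 1 ∧
      (∀ u < σ.reg 6, ∀ v < σ.reg 6, σ.arr 1 (u * σ.reg 6 + v) ≠ 0 ↔ G.Adj u v) ∧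
      (σ.reg 5 ≠ 0 → x = encode (G.comap (Fin.val : Fin (σ.reg 6) → ℕ)) (σ.reg 7)) ∧
      (σ.reg 5 = 0 → ∀ (m : ℕ) (H : SimpleGraph (Fin m)) (t : ℕ), x ≠ encode H t) := by
  simp only [parse, List.forall_mem_cons, Sat] at h
  obtain ⟨h2, h3, h4, h5, h6, h7, h8, h9, ha1, -⟩ := h
  rw [eval_mul (by decide) (by decide) le_rfl] at h4 h8
  have h5' : σ.reg 5 ≠ 0 ↔ x.length = σ.reg 2 + σ.reg 3 + σ.reg 2 * σ.reg 2 + 2 ∧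
      (∀ j < x.length, j < σ.reg 2 → x[j]? = some true) ∧ x[σ.reg 2]? ≠ some true ∧
      (∀ j < x.length, j < σ.reg 3 → x[σ.reg 2 + 1 + j]? = some true) ∧
      x[σ.reg 2 + 1 + σ.reg 3]? ≠ some true ∧
      (∀ u < σ.reg 2, x[σ.reg 2 + σ.reg 3 + 2 + (u * σ.reg 2 + u)]? ≠ some true) ∧
      ∀ u < σ.reg 2, ∀ v < σ.reg 2, x[σ.reg 2 + σ.reg 3 + 2 + (u * σ.reg 2 + v)]? = some true →
        x[σ.reg 2 + σ.reg 3 + 2 + (v * σ.reg 2 + u)]? = some true := by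
    have e1 : ∀ u < σ.reg 2, (inputEntry 32 32).eval (σ.setReg 32 u) =
        if x[σ.reg 2 + σ.reg 3 + 2 + (u * σ.reg 2 + u)]? = some true then 1 else 0 :=
      fun u hu => by rw [eval_inputEntry (by decide)] <;> simp [h0, hu.le]
    have e2 : ∀ u < σ.reg 2, ∀ v, (inputEntry 32 33).eval ((σ.setReg 32 u).setReg 33 v) =
        if x[σ.reg 2 + σ.reg 3 + 2 + (u * σ.reg 2 + v)]? = some true then 1 else 0 :=
      fun u hu v => by rw [eval_inputEntry (by decide)] <;> simp [h0, hu.le]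
    have e3 : ∀ u, ∀ v < σ.reg 2, (inputEntry 33 32).eval ((σ.setReg 32 u).setReg 33 v) =
        if x[σ.reg 2 + σ.reg 3 + 2 + (v * σ.reg 2 + u)]? = some true then 1 else 0 :=
      fun u v hv => by rw [eval_inputEntry (by decide)] <;> simp [h0, hv.le]
    simp [h0, hL, h4] at h5
    simp +contextual only [e1, e2, e3] at h5
    simp [h5]
  simp [h0, hL] at h2 h3 h6 h7 h9
  have hn2 : σ.reg 2 ≤ x.length := by
    rw [h2]
    exact (Finset.card_filter_le _ _).trans (by simp)
  have hadj : σ.reg 5 ≠ 0 → ∀ u < σ.reg 6, ∀ v < σ.reg 6,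
      (σ.arr 1 (u * σ.reg 6 + v) ≠ 0 ↔
        x[σ.reg 2 + σ.reg 3 + 2 + (u * σ.reg 2 + v)]? = some true) := by
    intro h u hu v hv
    have hlt : u * σ.reg 6 + v < σ.reg 8 := by
      rw [h8]
      have := Nat.mul_le_mul_right (σ.reg 6) (show u + 1 ≤ σ.reg 6 from hu)
      rw [add_mul] at this
      omega
    rw [ha1 _ hlt]
    simp [h0, h6, h]
  by_cases hv : σ.reg 5 = 0
  · rw [if_pos hv] at h6 h7
    refine ⟨⊥, hn2, by omega, h8, h9, fun u hu => by omega, fun h => absurd hv h,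
      fun _ m H t hx => ?_⟩
    obtain ⟨k1, k2, k3, k4, k5, k6⟩ := (eq_encode_iff H t x).1 hx
    have hm : σ.reg 2 = m := by
      rw [h2]
      exact card_leading (p := fun i => x[i]? = some true) (by omega) k2 k3
    have ht : σ.reg 3 = t := by
      rw [h3, hm]
      exact card_leading (p := fun i => x[m + 1 + i]? = some true) (by omega) k4 k5
    refine h5'.2 ⟨?_, ?_, ?_, ?_, ?_, ?_, ?_⟩ hv <;> rw [hm] <;> try rw [ht]
    · omega
    · exact fun j _ => k2 j
    · exact k3
    · exact fun j _ => k4 j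
    · exact k5
    · exact fun u hu => by simpa using (k6 ⟨u, hu⟩ ⟨u, hu⟩).not.2 H.irrefl
    · exact fun u hu v hv huv =>
        (k6 ⟨v, hv⟩ ⟨u, hu⟩).2 ((k6 ⟨u, hu⟩ ⟨v, hv⟩).1 huv).symm
  · rw [if_neg hv] at h6 h7
    obtain ⟨k1, k2, k3, k4, k5, k6, k7⟩ := h5'.1 hv
    refine ⟨⟨fun u v => u < σ.reg 6 ∧ v < σ.reg 6 ∧ σ.arr 1 (u * σ.reg 6 + v) ≠ 0, ?_, ?_⟩,
      hn2, by omega, h8, h9, fun u hu v hv => by simp [hu, hv], fun _ => ?_, fun h => absurd h hv⟩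
    · refine ⟨?_⟩
      rintro u v ⟨hu, hv', huv⟩
      refine ⟨hv', hu, ?_⟩
      rw [hadj hv _ hv' _ hu]
      exact k7 u (by omega) v (by omega) ((hadj hv _ hu _ hv').1 huv)
    · refine ⟨?_⟩
      rintro u ⟨hu, -, huv⟩
      exact k6 u (by omega) ((hadj hv _ hu _ hu).1 huv)
    · simp only [← h6, ← h7] at k1 k2 k3 k4 k5 hadj
      refine (eq_encode_iff _ _ _).2 ⟨by omega, fun j hj => k2 j (by omega) hj, k3,
        fun j hj => k4 j (by omega) hj, k5, fun u v => ?_⟩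
      rw [← hadj hv u u.2 v v.2]
      simp

end

/-! ### Ranks and subsets -/

section

/-- The rank of `v` in `S`. -/
def rank (S : Finset ℕ) (v : ℕ) : ℕ := (S.filter (· < v)).card

theorem rank_lt_rank {S : Finset ℕ} {u v : ℕ} (hu : u ∈ S) (h : u < v) : rank S u < rank S v := by
  refine Finset.card_lt_card (Finset.ssubset_iff_of_subset ?_ |>.2 ⟨u, ?_, ?_⟩)
  · exact Finset.monotone_filter_right _ fun w _ hw => lt_trans hw h
  · simp [hu, h]
  · simp

theorem rank_injOn (S : Finset ℕ) : Set.InjOn (rank S) S := by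
  intro u hu v hv h
  rcases lt_trichotomy u v with h' | h' | h'
  · exact absurd (rank_lt_rank hu h') (by omega)
  · exact h'
  · exact absurd (rank_lt_rank hv h') (by omega)

theorem rank_lt_card {S : Finset ℕ} {v : ℕ} (hv : v ∈ S) : rank S v < S.card :=
  Finset.card_lt_card (Finset.filter_ssubset.2 ⟨v, hv, by simp⟩)

theorem rank_le_card (S : Finset ℕ) (v : ℕ) : rank S v ≤ S.card := Finset.card_filter_le _ _

theorem exists_rank_eq {S : Finset ℕ} {i : ℕ} (hi : i < S.card) : ∃ v ∈ S, rank S v = i := by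
  have h1 : S.image (rank S) ⊆ Finset.range S.card := by
    intro j hj
    obtain ⟨v, hv, rfl⟩ := Finset.mem_image.1 hj
    exact Finset.mem_range.2 (rank_lt_card hv)
  have h2 : S.image (rank S) = Finset.range S.card := by
    refine Finset.eq_of_subset_of_card_le h1 ?_
    rw [Finset.card_image_of_injOn (rank_injOn S), Finset.card_range]
  have := Finset.ext_iff.1 h2 i
  simpa [hi] using this

theorem sum_eq_card {S : Finset ℕ} {n : ℕ} {p : ℕ → Prop} {_ : DecidablePred p}
    (h : ∀ u, u < n ∧ p u ↔ u ∈ S) : (∑ u ∈ Finset.range n, if p u then 1 else 0) = S.card := by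
  rw [← Finset.card_filter]
  congr 1
  ext u
  simp [← h]

/-- The element of rank `i`, written as a sum. -/
theorem sum_rank {S : Finset ℕ} {n v : ℕ} (hS : S ⊆ Finset.range n) (hv : v ∈ S)
    [DecidablePred fun w => w ∈ S ∧ rank S w = rank S v] :
    (∑ w ∈ Finset.range n, if w ∈ S ∧ rank S w = rank S v then w else 0) = v := by
  rw [Finset.sum_eq_single_of_mem v (hS hv), if_pos ⟨hv, rfl⟩]
  intro w _ hwv
  exact if_neg fun h => hwv (rank_injOn S h.1 hv h.2)

/-- Every sequence of `d` digits in base `b` is that of a number below `b ^ d`. -/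
theorem exists_digits {b d : ℕ} {f : ℕ → ℕ} (hf : ∀ i < d, f i < b) :
    ∃ s < b ^ d, ∀ i < d, s / b ^ i % b = f i := by
  let g : Fin d → Fin b := fun i => ⟨f i, hf i i.2⟩
  refine ⟨finFunctionFinEquiv g, (finFunctionFinEquiv g).2, fun i hi => ?_⟩
  exact congrArg Fin.val (congrFun (finFunctionFinEquiv.symm_apply_apply g) ⟨i, hi⟩)

/-- The subsets of `D` are coded by the numbers below `2 ^ |D|`. -/
theorem exists_code (D Y : Finset ℕ) :
    ∃ s < 2 ^ D.card, ∀ w ∈ D, (s / 2 ^ rank D w % 2 ≠ 0 ↔ w ∈ Y) := by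
  classical
  obtain ⟨s, hs, h⟩ := exists_digits (b := 2) (d := D.card)
    (f := fun i => if ∃ w ∈ D, w ∈ Y ∧ rank D w = i then 1 else 0)
    (fun i _ => by split_ifs <;> decide)
  refine ⟨s, hs, fun w hw => ?_⟩
  have key : (∃ w' ∈ D, w' ∈ Y ∧ rank D w' = rank D w) ↔ w ∈ Y :=
    ⟨fun ⟨w', h1, h2, h3⟩ => rank_injOn D h1 hw h3 ▸ h2, fun h => ⟨w, hw, h, rfl⟩⟩
  rw [h _ (rank_lt_card hw)]
  simp [key]

end

/-! ### Matrices -/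

section

variable {n : ℕ}

theorem index_lt {u v : ℕ} (hu : u < n) (hv : v < n) : u * n + v < n * n := by
  have := Nat.mul_le_mul_right n (show u + 1 ≤ n from hu)
  rw [add_mul] at this
  omega

theorem index_inj {u v u' v' : ℕ} (hv : v < n) (hv' : v' < n) (h : u * n + v = u' * n + v') :
    u = u' ∧ v = v' := by
  have hn : 0 < n := by omega
  have h1 := congrArg (· / n) h
  have h2 := congrArg (· % n) h
  simp only [mul_comm _ n, Nat.mul_add_div hn, Nat.div_eq_of_lt hv, Nat.div_eq_of_lt hv',
    Nat.mul_add_mod, Nat.mod_eq_of_lt hv, Nat.mod_eq_of_lt hv'] at h1 h2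
  exact ⟨by omega, h2⟩

/-- A matrix is tabulated by searching for the row and the column. -/
theorem matrix_of_tab {a : ℕ → ℕ} {f : ℕ → ℕ → ℕ → ℕ} {P : ℕ → ℕ → ℕ → Prop}
    {_ : ∀ i, Decidable (∃ u < n, ∃ v < n, f u v i = i ∧ P u v i)}
    (hf : ∀ u < n, ∀ v < n, ∀ i, f u v i = u * n + v)
    (h : ∀ i < n * n, a i = if ∃ u < n, ∃ v < n, f u v i = i ∧ P u v i then 1 else 0)
    {u v : ℕ} (hu : u < n) (hv : v < n) : a (u * n + v) ≠ 0 ↔ P u v (u * n + v) := by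
  rw [h _ (index_lt hu hv)]
  have : (∃ u' < n, ∃ v' < n, f u' v' (u * n + v) = u * n + v ∧ P u' v' (u * n + v)) ↔
      P u v (u * n + v) := by
    constructor
    · rintro ⟨u', hu', v', hv', he, hP⟩
      obtain ⟨rfl, rfl⟩ := index_inj hv' hv ((hf u' hu' v' hv' _).symm.trans he)
      exact hP
    · exact fun hP => ⟨u, hu, v, hv, hf u hu v hv _, hP⟩
  simp [this]

/-- The array holds the matrix of the relation `R` on the numbers below `n`. -/
def IsMatrix (n : ℕ) (a : ℕ → ℕ) (R : ℕ → ℕ → Prop) : Prop :=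
  ∀ u < n, ∀ v < n, a (u * n + v) ≠ 0 ↔ R u v

theorem IsMatrix.eval_entry {R : ℕ → ℕ → Prop} {a m u v : ℕ} {s : State} (hu : u ≠ 40)
    (hm : m ≠ 40) (h : IsMatrix n (s.arr a) R) (hn : s.reg m = n) (h1 : s.reg u < n)
    (h2 : s.reg v < n) : (entry a m u v).eval s = 0 ↔ ¬ R (s.reg u) (s.reg v) := by
  rw [Expr.eval_entry hu hm (by omega), hn, ← h _ h1 _ h2, not_not]

theorem IsMatrix.eval_mustE {G : SimpleGraph ℕ} {tw : Bool} {u v : ℕ} {s : State}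
    (h : IsMatrix n (s.arr 1) G.Adj) (hu : u ≠ 40) (hv : v ≠ 40) (hu' : u ≠ 35) (hv' : v ≠ 35)
    (hn : s.reg 6 = n) (h1 : s.reg u < n) (h2 : s.reg v < n) : (mustE tw u v).eval s = 0 ↔
      ¬ MustCover tw G (Finset.range n : Set ℕ) (s.reg u) (s.reg v) := by
  have e0 := h.eval_entry (m := 6) hu (by decide) hn h1 h2
  cases tw with
  | false => simp [mustE, adjE, MustCover, e0]
  | true =>
    have e1 : ∀ w < n, ((entry 1 6 u 35).eval (s.setReg 35 w) = 0 ↔ ¬ G.Adj (s.reg u) w) := by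
      intro w hw
      have := IsMatrix.eval_entry (R := G.Adj) (s := s.setReg 35 w) (m := 6) (v := 35) hu
        (by decide) h (by simpa) (by simpa [hu']) (by simpa)
      simpa [hu'] using this
    have e2 : ∀ w < n, ((entry 1 6 v 35).eval (s.setReg 35 w) = 0 ↔ ¬ G.Adj (s.reg v) w) := by
      intro w hw
      have := IsMatrix.eval_entry (R := G.Adj) (s := s.setReg 35 w) (m := 6) (v := 35) hv
        (by decide) h (by simpa) (by simpa [hv']) (by simpa)
      simpa [hv'] using this
    simp only [mustE, adjE, if_true, MustCover, eval_and, eval_ex, eval_not, eval_eq, eval_iff,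
      State.setReg_reg, eval_reg, ne_eq, e0, hn, if_neg hu', if_neg hv', ite_eq_right_iff,
      one_ne_zero, imp_false, not_not, forall_true_left, Finset.coe_range, Set.mem_Iio]
    refine not_congr (and_congr_right fun _ => exists_congr fun w => and_congr_right fun hw => ?_)
    simp [e1 w hw, e2 w hw]

end

/-! ### Correctness of the reduction -/

section

variable {n k : ℕ} {G : SimpleGraph ℕ} {tw : Bool} {sm : Expr} {σ s₀ : State}

/-- The test finds out whether there is a cover of size at most `k`. The matched vertices cover
everything that has to be covered; if there are more than `2 * k` of them, no cover of size `k`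
exists, and otherwise all their subsets are tried. -/
theorem testCover_spec (h : ∀ st ∈ testCover tw sm, st.Sat s₀ σ) (hn : σ.reg 6 = n)
    (h8 : σ.reg 8 = n * n) (h9 : σ.reg 9 = n + 1) (hk : σ.reg 1 = k)
    (hG : IsMatrix n (σ.arr 1) G.Adj) (hs₀ : ∀ i, s₀.arr 3 i = 0) :
    σ.reg 10 = sm.eval σ ∧ (∀ i ≤ n, σ.arr 2 i = 2 ^ i) ∧ (σ.reg 10 ≠ 0 → σ.reg 12 = 0) ∧
      σ.reg 12 ≤ 2 ^ (k + k) ∧ (σ.reg 13 ≠ 0 ↔ σ.reg 5 ≠ 0 ∧ (σ.reg 10 ≠ 0 ∨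
        ∃ C : Finset ℕ, C.card ≤ k ∧ IsCover tw G (Finset.range n : Set ℕ) C)) := by
  classical
  simp only [testCover, List.forall_mem_cons, Sat] at h
  obtain ⟨ha2, h10, h17, ha3, ha4, h11, ha5, h12, h13, -⟩ := h
  simp [h9] at ha2
  simp at h17
  have hpow : ∀ i ≤ n, σ.arr 2 i = 2 ^ i := by
    intro i hi
    induction i with
    | zero => simpa using ha2 0 (by omega)
    | succ i ih =>
      rw [ha2 _ (by omega)]
      simp [ih (by omega), pow_succ, mul_two]
  have e1 : ∀ u < n, ∀ v < n, ∀ i, (mul 6 32 6).eval ((((mask σ 3 i (s₀.arr 3)).setReg 30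
      i).setReg 32 u).setReg 33 v) + v = u * n + v := by
    intro u hu v _ i
    rw [eval_mul (by decide) (by decide)] <;> simp [hn, hu.le]
  have e2 : ∀ u < n, ∀ v < n, ∀ i, ((mustE tw 32 33).eval ((((mask σ 3 i (s₀.arr 3)).setReg 30
      i).setReg 32 u).setReg 33 v) = 0 ↔
        ¬ MustCover tw G (Finset.range n : Set ℕ) u v) := by
    intro u hu v hv i
    have := IsMatrix.eval_mustE (n := n) (G := G) (tw := tw) (u := 32) (v := 33)
      (s := (((mask σ 3 i (s₀.arr 3)).setReg 30 i).setReg 32 u).setReg 33 v)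
      (by simpa [IsMatrix] using hG) (by decide) (by decide) (by decide) (by decide)
      (by simpa) (by simpa) (by simpa)
    simpa using this
  have e3 : ∀ u < n, ∀ v < n, ∀ w < n, ∀ i, ∀ s : State,
      s = ((((mask σ 3 i (s₀.arr 3)).setReg 30 i).setReg 32 u).setReg 33 v).setReg 34 w →
      ((entry 3 6 32 34).eval s = 0 ↔ (u * n + w < i → σ.arr 3 (u * n + w) = 0)) ∧
      ((entry 3 6 34 32).eval s = 0 ↔ (w * n + u < i → σ.arr 3 (w * n + u) = 0)) ∧
      ((entry 3 6 33 34).eval s = 0 ↔ (v * n + w < i → σ.arr 3 (v * n + w) = 0)) ∧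
      ((entry 3 6 34 33).eval s = 0 ↔ (w * n + v < i → σ.arr 3 (w * n + v) = 0)) := by
    rintro u hu v hv w hw i s rfl
    refine ⟨?_, ?_, ?_, ?_⟩ <;> rw [eval_entry (by decide) (by decide)] <;>
      simp [hn, hu.le, hv.le, hw.le, hs₀]
  simp [h8, hn] at ha3
  -- An entry of the matching is set unless an earlier one shares a vertex with it.
  have hM : ∀ u < n, ∀ v < n, (σ.arr 3 (u * n + v) ≠ 0 ↔
      MustCover tw G (Finset.range n : Set ℕ) u v ∧ ∀ w < n,
        (u * n + w < u * n + v → σ.arr 3 (u * n + w) = 0) ∧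
        (w * n + u < u * n + v → σ.arr 3 (w * n + u) = 0) ∧
        (v * n + w < u * n + v → σ.arr 3 (v * n + w) = 0) ∧
        (w * n + v < u * n + v → σ.arr 3 (w * n + v) = 0)) := by
    intro u hu v hv
    rw [matrix_of_tab e1 ha3 hu hv, e2 u hu v hv, not_not]
    refine and_congr_right fun _ => forall_congr' fun w => forall_congr' fun hw => ?_
    obtain ⟨h1, h2, h3, h4⟩ := e3 u hu v hv w hw _ _ rfl
    rw [h1, h2, h3, h4]
  -- The greedy matching, as a symmetric relation: no two of its edges share a vertex.
  let m : ℕ → ℕ → Prop := fun u v =>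
    u < n ∧ v < n ∧ (σ.arr 3 (u * n + v) ≠ 0 ∨ σ.arr 3 (v * n + u) ≠ 0)
  have hmsymm : ∀ u v, m u v → m v u := fun u v h => ⟨h.2.1, h.1, h.2.2.symm⟩
  have hm : ∀ u v v', m u v → m u v' → v = v' := by
    have key : ∀ a < n, ∀ b < n, ∀ a' < n, ∀ b' < n, σ.arr 3 (a * n + b) ≠ 0 →
        σ.arr 3 (a' * n + b') ≠ 0 → (a' = a ∨ a' = b ∨ b' = a ∨ b' = b) →
        ¬ a' * n + b' < a * n + b := by
      intro a ha b hb a' ha' b' hb' h1 h2 h3 hlt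
      have h4 := ((hM a ha b hb).1 h1).2
      rcases h3 with rfl | rfl | rfl | rfl
      · exact h2 ((h4 b' hb').1 hlt)
      · exact h2 ((h4 b' hb').2.2.1 hlt)
      · exact h2 ((h4 a' ha').2.1 hlt)
      · exact h2 ((h4 a' ha').2.2.2 hlt)
    have key' : ∀ a < n, ∀ b < n, ∀ a' < n, ∀ b' < n, σ.arr 3 (a * n + b) ≠ 0 →
        σ.arr 3 (a' * n + b') ≠ 0 → (a' = a ∨ a' = b ∨ b' = a ∨ b' = b) → a = a' ∧ b = b' := by
      intro a ha b hb a' ha' b' hb' h1 h2 h3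
      have h4 := key a ha b hb a' ha' b' hb' h1 h2 h3
      have h5 := key a' ha' b' hb' a ha b hb h2 h1 (by omega)
      exact index_inj hb hb' (by omega)
    rintro u v v' ⟨hu, hv, h1 | h1⟩ ⟨-, hv', h2 | h2⟩
    · have := key' u hu v hv u hu v' hv' h1 h2 (by omega); omega
    · have := key' u hu v hv v' hv' u hu h1 h2 (by omega); omega
    · have := key' v hv u hu u hu v' hv' h1 h2 (by omega); omega
    · have := key' v hv u hu v' hv' u hu h1 h2 (by omega); omega
  have hmust : ∀ u v, m u v → MustCover tw G (Finset.range n : Set ℕ) u v := by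
    rintro u v ⟨hu, hv, h | h⟩
    · exact ((hM u hu v hv).1 h).1
    · exact ((hM v hv u hu).1 h).1.symm
  let D : Finset ℕ := (Finset.range n).filter fun w => ∃ u, m w u
  have hD4 : ∀ w < n, σ.arr 4 w = if w ∈ D then 1 else 0 := by
    intro w hw
    rw [ha4 w (by omega)]
    have e4 : ∀ u < n, ∀ s : State, s = ((mask σ 4 w (s₀.arr 4)).setReg 30 w).setReg 32 u →
        (entry 3 6 30 32).eval s = σ.arr 3 (w * n + u) ∧
        (entry 3 6 32 30).eval s = σ.arr 3 (u * n + w) := by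
      rintro u hu s rfl
      constructor <;> rw [eval_entry (by decide) (by decide)] <;> simp [hn, hu.le, hw.le]
    have e5 : (∃ u < n, ¬ (σ.arr 3 (w * n + u) = 0 ∧ σ.arr 3 (u * n + w) = 0)) ↔ w ∈ D := by
      simp only [D, m, Finset.mem_filter, Finset.mem_range, hw, true_and, ne_eq,
        ← not_and_or]
    rw [← if_congr e5 rfl rfl]
    simp only [eval_ex, eval_or]
    refine if_congr ?_ rfl rfl
    simp only [State.setReg_reg, mask_reg, hn, ne_eq]
    refine exists_congr fun u => and_congr_right fun hu => ?_
    rw [(e4 u hu _ rfl).1, (e4 u hu _ rfl).2]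
    simp
  have hDsub : D ⊆ Finset.range n := Finset.filter_subset _ _
  -- The matching is maximal: the entry of an edge outside its reach would have been set.
  have hcov : ∀ u < n, ∀ v < n, MustCover tw G (Finset.range n : Set ℕ) u v → u ∈ D ∨ v ∈ D := by
    intro u hu v hv huv
    have hin : ∀ a < n, ∀ b < n, σ.arr 3 (a * n + b) ≠ 0 → a ∈ D ∧ b ∈ D := by
      intro a ha b hb hab
      exact ⟨Finset.mem_filter.2 ⟨Finset.mem_range.2 ha, b, ha, hb, .inl hab⟩,
        Finset.mem_filter.2 ⟨Finset.mem_range.2 hb, a, hb, ha, .inr hab⟩⟩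
    by_contra hnot
    rw [not_or] at hnot
    refine hnot.1 (hin u hu v hv ((hM u hu v hv).2 ⟨huv, fun w hw => ⟨fun _ => ?_, fun _ => ?_,
      fun _ => ?_, fun _ => ?_⟩⟩)).1
    · exact by_contra fun h => hnot.1 (hin _ hu _ hw h).1
    · exact by_contra fun h => hnot.1 (hin _ hw _ hu h).2
    · exact by_contra fun h => hnot.2 (hin _ hv _ hw h).1
    · exact by_contra fun h => hnot.2 (hin _ hw _ hv h).2
  have h4 : ∀ w < n, σ.arr 4 w = 0 ↔ w ∉ D := fun w hw => by simp [hD4 w hw]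
  have h11' : σ.reg 11 = D.card := by
    rw [h11]
    simp only [eval_sum, hn, eval_load, eval_reg, State.setReg_reg, State.setReg_arr, if_true]
    rw [Finset.sum_congr rfl fun w hw => hD4 w (Finset.mem_range.1 hw)]
    exact sum_eq_card fun u => ⟨fun h => h.2, fun h => ⟨Finset.mem_range.1 (hDsub h), h⟩⟩
  have hrank : ∀ w < n, σ.arr 5 w = rank D w := by
    intro w hw
    rw [ha5 w (by omega)]
    simp only [eval_sum, mask_reg, State.setReg_reg, hn, eval_and, eval_lt]
    refine sum_eq_card fun u => ?_
    have := fun hu => h4 u hu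
    have := fun hu => Finset.mem_range.1 (hDsub (x := u) hu)
    simp
    grind
  have hQ : σ.reg 12 = if σ.reg 10 ≠ 0 ∨ k + k < D.card then 0 else 2 ^ D.card := by
    rw [h12]
    have hcard : D.card ≤ n := (Finset.card_le_card hDsub).trans (by simp)
    rw [eval_ite, ← ite_not]
    refine if_congr ?_ rfl ?_
    · simp [hk, h11', imp_iff_not_or]
    · simp [h11', hpow _ hcard]
  have hch : ∀ s < σ.reg 12, ∀ w < n, w ∈ D → ∀ (s' : State) (x : ℕ), s'.reg 17 = 2 →
      s'.reg 36 = s → s'.reg x = w → s'.reg 12 = σ.reg 12 → s'.arr = σ.arr →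
      (chosenE x).eval s' = s / 2 ^ rank D w % 2 := by
    intro s hs w hw hwD s' x e17 e36 ex e12 ea
    have e : (load 2 (load 5 (reg x))).eval s' = 2 ^ rank D w := by
      simp [ea, ex, hrank w hw, hpow _ ((rank_le_card D w).trans
        ((Finset.card_le_card hDsub).trans (by simp)))]
    rw [chosenE, eval_digit (by decide) (by decide) (by decide) (by omega)
      (by rw [e]; positivity) (by omega), e, e17, e36]
  -- The set `Y` that is coded by `s` yields the cover of `Y` and the neighbours of `D \ Y`.
  let F : ℕ → Finset ℕ := fun s => (Finset.range n).filter fun w =>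
    (w ∈ D ∧ s / 2 ^ rank D w % 2 ≠ 0) ∨ ∃ u < n, u ∈ D ∧ s / 2 ^ rank D u % 2 = 0 ∧
      MustCover tw G (Finset.range n : Set ℕ) u w
  have h13' : σ.reg 13 ≠ 0 ↔ σ.reg 5 ≠ 0 ∧ (σ.reg 10 ≠ 0 ∨ ∃ s < σ.reg 12, (F s).card ≤ k) := by
    rw [h13]
    simp only [eval_and, eval_or, eval_ex, eval_le, eval_reg, ne_eq, ite_eq_right_iff, one_ne_zero,
      imp_false, not_not, State.setReg_reg]
    refine and_congr_right fun _ => or_congr_right (exists_congr fun s =>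
      and_congr_right fun hs => ?_)
    rw [if_neg (by decide), hk]
    simp only [eval_sum, eval_or, eval_and, eval_ex, eval_not]
    rw [sum_eq_card (S := F s)]
    intro w
    simp only [F, Finset.mem_filter, Finset.mem_range, State.setReg_reg, hn]
    have c : ∀ u < n, u ∈ D → ∀ (s' : State) (x : ℕ), s'.reg 17 = 2 → s'.reg 36 = s →
        s'.reg x = u → s'.reg 12 = σ.reg 12 → s'.arr = σ.arr →
        ((chosenE x).eval s' = 0 ↔ s / 2 ^ rank D u % 2 = 0) := by
      intro u hu huD s' x a1 a2 a3 a4 a5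
      rw [hch s hs u hu huD s' x a1 a2 a3 a4 a5]
    simp only [show (6 : ℕ) ≠ 34 ∧ (6 : ℕ) ≠ 36 ∧ (6 : ℕ) ≠ 32 by decide, if_false]
    refine and_congr_right fun hw => ?_
    simp only [ne_eq, ite_eq_right_iff, one_ne_zero, imp_false, not_not, eval_load, eval_reg,
      State.setReg_arr, State.setReg_reg, if_true, h4 w hw]
    refine or_congr (and_congr_right fun hwD => ?_) (exists_congr fun u => and_congr_right
      fun hu => ?_)
    · rw [c w hw hwD _ 34] <;> simp [h17]
    · simp only [h4 u hu, not_not]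
      refine and_congr_right fun huD => and_congr ?_ ?_
      · rw [c u hu huD _ 32] <;> simp [h17]
      · have := IsMatrix.eval_mustE (n := n) (G := G) (tw := tw) (u := 32) (v := 34)
          (s := ((σ.setReg 36 s).setReg 34 w).setReg 32 u)
          (by simpa [IsMatrix] using hG) (by decide) (by decide) (by decide) (by decide)
          (by simpa) (by simpa) (by simpa)
        simpa using this.not
  refine ⟨h10, hpow, fun h => ?_, ?_, ?_⟩
  · rw [hQ, if_pos (.inl h)]
  · rw [hQ]
    split_ifs with h
    · simp
    · exact Nat.pow_le_pow_right (by decide) (by omega)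
  · rw [h13']
    refine and_congr_right fun _ => ?_
    by_cases hs : σ.reg 10 = 0
    swap
    · simp [hs]
    simp only [hs, ne_eq, not_true, false_or]
    have key := exists_cover_iff (n := n) (H := MustCover tw G (Finset.range n : Set ℕ))
      (fun u v h => h.symm) hcov k
    have hcover : ∀ C, IsCover tw G (Finset.range n : Set ℕ) C ↔ ∀ u < n, ∀ v < n,
      MustCover tw G (Finset.range n : Set ℕ) u v → u ∈ C ∨ v ∈ C := by simp [IsCover]
    constructor
    · rintro ⟨s, -, h⟩
      simp only [hcover]
      refine key.2 ⟨D.filter fun w => s / 2 ^ rank D w % 2 ≠ 0, ?_⟩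
      convert h using 2
      refine Finset.filter_congr fun w _ => ?_
      simp only [Finset.mem_filter, not_and, not_not]
      refine or_congr (by simp) (exists_congr fun u => and_congr_right fun _ =>
        and_congr_right fun hu => ?_)
      simp [hu]
    · rintro ⟨C, hC, h⟩
      have hD : D.card ≤ 2 * C.card := card_matched_le hm hmsymm
        (fun u hu => (Finset.mem_filter.1 hu).2)
        (fun u v huv => (hcover C).1 h u huv.1 v huv.2.1 (hmust u v huv))
      obtain ⟨Y, hY⟩ := key.1 ⟨C, hC, (hcover C).1 h⟩
      obtain ⟨s, hs1, hs2⟩ := exists_code D Y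
      refine ⟨s, ?_, ?_⟩
      · rwa [hQ, if_neg (by omega)]
      · convert hY using 2
        refine Finset.filter_congr fun w _ => or_congr (and_congr_right fun hw => hs2 w hw)
          (exists_congr fun u => and_congr_right fun _ => and_congr_right fun hu => ?_)
        rw [← hs2 u hu, not_not]

end

section

variable {n : ℕ} {G : SimpleGraph ℕ} {σ s₀ : State}

open Classical in
/-- The vertices that the reduction keeps: all of them if the flag `small` is set, and otherwise the
representatives. -/
noncomputable def kept (G : SimpleGraph ℕ) (n : ℕ) (small : ℕ) : Finset ℕ :=
  if small = 0 then reps G n else Finset.range n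

theorem kept_subset (G : SimpleGraph ℕ) (n : ℕ) (small : ℕ) :
    kept G n small ⊆ Finset.range n := by
  unfold kept
  split_ifs
  · exact reps_subset.trans trueReps_subset
  · exact subset_rfl

/-- The reduction lists the vertices that are kept, and computes the matrix of the subgraph that
they induce. -/
theorem reduce_spec (h : ∀ st ∈ reduce, st.Sat s₀ σ) (hn : σ.reg 6 = n)
    (hG : IsMatrix n (σ.arr 1) G.Adj) :
    (σ.reg 13 = 0 → σ.reg 14 = 1 ∧ σ.reg 15 = 0) ∧
    (σ.reg 13 ≠ 0 → σ.reg 14 = (kept G n (σ.reg 10)).card ∧ σ.reg 15 = min (σ.reg 14) (σ.reg 7) ∧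
      Set.InjOn (σ.arr 8) (Set.Iio (σ.reg 14)) ∧
      σ.arr 8 '' Set.Iio (σ.reg 14) = kept G n (σ.reg 10)) ∧
    σ.reg 16 = σ.reg 14 * σ.reg 14 ∧
    IsMatrix (σ.reg 14) (σ.arr 9) (if σ.reg 13 = 0 then ⊥ else G.comap (σ.arr 8)).Adj := by
  classical
  simp only [reduce, List.forall_mem_cons, Sat] at h
  obtain ⟨ha6, ha7, h14, ha8, h15, h16, ha9, -⟩ := h
  rw [eval_mul (by decide) (by decide) le_rfl] at h16
  -- In all tables below, adjacency is read off from the matrix in array 1.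
  have adj : ∀ (s : State) (x y u v : ℕ), x ≠ 40 → (∀ i, s.arr 1 i = σ.arr 1 i) → s.reg 6 = n →
      s.reg x = u → s.reg y = v → u < n → v < n → ((entry 1 6 x y).eval s = 0 ↔ ¬ G.Adj u v) := by
    rintro s x y u v hx h1 h2 rfl rfl h3 h4
    exact IsMatrix.eval_entry hx (by decide) (funext h1 ▸ hG) h2 h3 h4
  have h6 : ∀ v < n, (σ.arr 6 v = 0 ↔ v ∉ trueReps G n) := by
    intro v hv
    rw [ha6 v (by omega), mem_trueReps]
    simp only [eval_not, eval_ex, eval_and, eval_lt, eval_all, eval_or, eval_eq, eval_iff, eval_reg,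
      State.setReg_reg, mask_reg, hn, adjE]
    simp only [ite_eq_right_iff, one_ne_zero, imp_false, ne_eq, not_not, if_true,
      reduceIte, Nat.reduceEqDiff]
    simp only [hv, true_and, not_not]
    refine exists_congr fun u => and_congr_right fun hu => and_congr_right fun _ =>
      and_congr ?_ (forall_congr' fun w => forall_congr' fun hw => ?_)
    · rw [adj _ _ _ u v] <;> simp [hn, hu, hv]
    · rw [adj _ _ _ u w, adj _ _ _ v w] <;> simp [hn, hu, hv, hw]
      tauto
  have h7 : ∀ v < n, σ.arr 7 v = if v ∈ kept G n (σ.reg 10) then 1 else 0 := by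
    intro v hv
    rw [ha7 v (by omega), kept]
    simp only [eval_or, eval_and, eval_lt, eval_const, eval_load, eval_reg, eval_sum, eval_all,
      eval_iff, eval_imp, State.setReg_reg, mask_reg, hn, adjE]
    simp only [ite_eq_right_iff, one_ne_zero, imp_false, ne_eq, not_not, if_true,
      reduceIte, Nat.reduceEqDiff, Finset.sum_boole]
    simp
    by_cases hs : σ.reg 10 = 0
    swap
    · simp [hs, hv]
    simp only [hs, not_true, false_or, if_true]
    refine if_congr ?_ rfl rfl
    rw [mem_reps, h6 v hv, not_not]
    refine and_congr_right fun _ => ?_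
    rw [Nat.lt_succ_iff]
    have hle : ∀ a b : ℕ, a = b → (a ≤ 1 ↔ b ≤ 1) := by omega
    refine hle _ _ (congrArg Finset.card (Finset.filter_congr fun u hu => ?_))
    replace hu := Finset.mem_range.1 hu
    refine and_congr_right fun _ => and_congr (by rw [h6 u hu, not_not])
      (forall_congr' fun w => forall_congr' fun hw => ?_)
    rw [h6 w hw, not_not]
    refine imp_congr Iff.rfl ?_
    rw [adj _ _ _ u w, adj _ _ _ v w] <;> simp [hn, hu, hv, hw]
  -- The list of the vertices that are kept, in increasing order.
  have h8 : ∀ i < σ.reg 14, σ.arr 8 i = ∑ v ∈ Finset.range n,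
      if v ∈ kept G n (σ.reg 10) ∧ rank (kept G n (σ.reg 10)) v = i then v else 0 := by
    intro i hi
    rw [ha8 i hi]
    simp only [eval_sum, eval_ite, eval_and, eval_eq, eval_lt, eval_load, eval_reg, eval_const,
      State.setReg_reg, mask_reg, hn, reduceIte, Nat.reduceEqDiff]
    refine Finset.sum_congr rfl fun v hv => ?_
    have hr : (∑ u ∈ Finset.range n, if u < v ∧ σ.arr 7 u ≠ 0 then 1 else 0) =
        rank (kept G n (σ.reg 10)) v := by
      refine sum_eq_card fun u => ?_
      have h1 := fun hu => h7 u hu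
      have h2 := fun hu => Finset.mem_range.1 (kept_subset G n (σ.reg 10) (x := u) hu)
      simp only [Finset.mem_filter]
      grind
    have h1 : σ.arr 7 v = 0 ↔ v ∉ kept G n (σ.reg 10) := by simp [h7 v (Finset.mem_range.1 hv)]
    rw [← ite_not]
    refine if_congr ?_ rfl rfl
    simp only [ite_eq_right_iff, one_ne_zero, imp_false, not_not, ne_eq, mask_arr, reduceIte,
      Nat.reduceEqDiff, State.setReg_arr, h1]
    rw [← hr]
  have h14' : σ.reg 13 ≠ 0 → σ.reg 14 = (kept G n (σ.reg 10)).card := by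
    intro h
    rw [h14, eval_ite, if_neg (by simpa using h)]
    simp only [eval_sum, hn, eval_load, eval_reg, State.setReg_reg, State.setReg_arr, if_true]
    rw [Finset.sum_congr rfl fun v hv => h7 v (Finset.mem_range.1 hv)]
    exact sum_eq_card fun u =>
      ⟨fun h => h.2, fun h => ⟨Finset.mem_range.1 (kept_subset _ _ _ h), h⟩⟩
  have h8' : ∀ v ∈ kept G n (σ.reg 10), rank (kept G n (σ.reg 10)) v < σ.reg 14 →
      σ.arr 8 (rank (kept G n (σ.reg 10)) v) = v := by
    intro v hv hr
    rw [h8 _ hr]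
    exact sum_rank (kept_subset _ _ _) hv
  have hmem : σ.reg 13 ≠ 0 → ∀ i < σ.reg 14, σ.arr 8 i ∈ kept G n (σ.reg 10) ∧
      rank (kept G n (σ.reg 10)) (σ.arr 8 i) = i := by
    intro h i hi
    obtain ⟨v, hv, rfl⟩ := exists_rank_eq (h14' h ▸ hi)
    rw [h8' v hv hi]
    exact ⟨hv, rfl⟩
  refine ⟨fun h => ?_, fun h => ⟨h14' h, ?_, ?_, ?_⟩, h16, ?_⟩
  · rw [h14, h15]
    simp [h]
  · rw [h15]
    simp [h]
    omega
  · intro i hi j hj hij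
    rw [← (hmem h i hi).2, hij, (hmem h j hj).2]
  · ext v
    constructor
    · rintro ⟨i, hi, rfl⟩
      exact (hmem h i hi).1
    · intro hv
      have := h14' h ▸ rank_lt_card hv
      exact ⟨_, this, h8' v hv this⟩
  · by_cases hok : σ.reg 13 = 0
    · intro u hu v hv
      rw [if_pos hok, ha9 _ (h16 ▸ index_lt hu hv)]
      simp [hok]
    · rw [if_neg hok]
      simp only [h16] at ha9
      intro u hu v hv
      simp [hok] at ha9
      rw [matrix_of_tab ?_ ha9 hu hv]
      · have hlt : ∀ i < σ.reg 14, σ.arr 8 i < n := fun i hi =>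
          Finset.mem_range.1 (kept_subset _ _ _ (hmem hok i hi).1)
        rw [adjE, adj _ _ _ (σ.arr 8 u) (σ.arr 8 v)] <;> simp [hn, hlt, hu, hv]
      · intro u hu v hv i
        rw [eval_mul (by decide) (by decide)] <;> simp [hu.le]

end

section

/-- Different instances have different encodings. -/
theorem encode_mem_thinnessProblem {n : ℕ} {G : SimpleGraph (Fin n)} {t k : ℕ} (π : GraphParam) :
    (encode G t, k) ∈ thinnessProblem π ↔ π n G ≤ k ∧ thinness G ≤ t := by
  refine ⟨?_, fun h => ⟨n, G, t, rfl, h⟩⟩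
  rintro ⟨n', G', t', h, hk, ht⟩
  obtain ⟨-, a1, a2, a3, a4, a5⟩ := (eq_encode_iff G t _).1 rfl
  obtain ⟨-, b1, b2, b3, b4, b5⟩ := (eq_encode_iff G' t' _).1 h
  obtain rfl : n = n' := by
    rcases lt_trichotomy n n' with hlt | rfl | hlt
    · exact absurd (b1 _ hlt) a2
    · rfl
    · exact absurd (a1 _ hlt) b2
  obtain rfl : t = t' := by
    rcases lt_trichotomy t t' with hlt | rfl | hlt
    · exact absurd (b3 _ hlt) a4
    · rfl
    · exact absurd (a3 _ hlt) b4
  obtain rfl : G = G' := by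
    ext u v
    rw [← a5 u v, b5 u v]
  exact ⟨hk, ht⟩

theorem not_thinness_le_zero {n : ℕ} (hn : 0 < n) (G : SimpleGraph (Fin n)) :
    ¬ thinness G ≤ 0 := by
  rw [thinness_le_iff]
  rintro ⟨-, -, c, -⟩
  exact (c ⟨0, hn⟩).elim0

variable {x : List Bool} {k : ℕ} {tw : Bool} {sm : Expr} {σ s₀ : State}

/-- The reduction is correct: it computes a graph on at most `3 * 2 ^ k` vertices and a threshold
that form an equivalent instance. -/
theorem core_spec (h : ∀ st ∈ core tw sm, st.Sat s₀ σ) (hL : σ.reg 0 = x.length)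
    (hk : σ.reg 1 = k) (h0 : ∀ i, σ.arr 0 i = if x[i]? = some true then 1 else 0)
    (hs₀ : ∀ i, s₀.arr 3 i = 0)
    (hsm : (∀ i ≤ σ.reg 6, σ.arr 2 i = 2 ^ i) → sm.eval σ ≠ 0 → σ.reg 6 ≤ 2 ^ k) :
    (∃ H : SimpleGraph ℕ, IsMatrix (σ.reg 14) (σ.arr 9) H.Adj ∧
      ((x, k) ∈ thinnessProblem (coverNumber tw) ↔
        coverNumber tw _ (H.comap (Fin.val : Fin (σ.reg 14) → ℕ)) ≤ k ∧
          thinness (H.comap (Fin.val : Fin (σ.reg 14) → ℕ)) ≤ σ.reg 15) ∧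
      (σ.reg 10 = 0 → coverNumber tw _ (H.comap (Fin.val : Fin (σ.reg 14) → ℕ)) ≤ k)) ∧
    σ.reg 14 ≤ 3 * 2 ^ k ∧ σ.reg 15 ≤ σ.reg 14 ∧ σ.reg 2 ≤ x.length ∧ σ.reg 6 ≤ x.length ∧
    σ.reg 8 = σ.reg 6 * σ.reg 6 ∧ σ.reg 9 = σ.reg 6 + 1 ∧ σ.reg 14 ≤ x.length + 1 ∧
    σ.reg 16 = σ.reg 14 * σ.reg 14 ∧
    (∀ i ≤ σ.reg 6, σ.arr 2 i = 2 ^ i) ∧ σ.reg 10 = sm.eval σ ∧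
    (σ.reg 10 ≠ 0 → σ.reg 12 = 0) ∧ σ.reg 12 ≤ 2 ^ (k + k) := by
  classical
  simp only [core, List.forall_mem_append] at h
  obtain ⟨G, hn2, h6, h8, h9, hG, hval, hinv⟩ := parse_spec h0 hL h.1
  obtain ⟨h10, hpow, hQ, hQk, h13⟩ := testCover_spec h.2.1 rfl h8 h9 hk hG hs₀
  obtain ⟨hno, hyes, h16, hH⟩ := reduce_spec h.2.2 rfl hG
  set n := σ.reg 6 with hn
  have hval_range : Set.range (Fin.val : Fin n → ℕ) = (Finset.range n : Set ℕ) := by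
    ext i
    simp
  have hle : n ≤ x.length := h6.trans hn2
  have hkept : (kept G n (σ.reg 10)).card ≤ n :=
    (Finset.card_le_card (kept_subset _ _ _)).trans (by simp)
  suffices hmain : (∃ H : SimpleGraph ℕ, IsMatrix (σ.reg 14) (σ.arr 9) H.Adj ∧
      ((x, k) ∈ thinnessProblem (coverNumber tw) ↔
        coverNumber tw _ (H.comap (Fin.val : Fin (σ.reg 14) → ℕ)) ≤ k ∧
          thinness (H.comap (Fin.val : Fin (σ.reg 14) → ℕ)) ≤ σ.reg 15) ∧
      (σ.reg 10 = 0 → coverNumber tw _ (H.comap (Fin.val : Fin (σ.reg 14) → ℕ)) ≤ k)) ∧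
      σ.reg 14 ≤ 3 * 2 ^ k ∧ σ.reg 15 ≤ σ.reg 14 ∧ σ.reg 14 ≤ x.length + 1 from
    ⟨hmain.1, hmain.2.1, hmain.2.2.1, hn2, hle, h8, h9, hmain.2.2.2, h16, hpow, h10, hQ, hQk⟩
  have hpos : 0 < 2 ^ k := by positivity
  by_cases hok : σ.reg 13 = 0
  · obtain ⟨e14, e15⟩ := hno hok
    refine ⟨⟨⊥, by simpa [hok] using hH, iff_of_false ?_ ?_, fun _ => ?_⟩, by omega, by omega,
      by omega⟩
    · by_cases hv : σ.reg 5 = 0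
      · rintro ⟨m, K, t, hx, -⟩
        exact hinv hv m K t hx
      · rw [hval hv, encode_mem_thinnessProblem, coverNumber_comap_le_iff tw G Fin.val_injective,
          hval_range]
        exact fun hmem => h13.2 ⟨hv, .inr hmem.1⟩ hok
    · rw [e15]
      exact fun hmem => not_thinness_le_zero (by omega) _ hmem.2
    · rw [coverNumber_comap_le_iff tw _ Fin.val_injective]
      exact ⟨∅, by simp, fun a _ b _ hab => hab.1.elim⟩
  obtain ⟨e14, e15, hinj, himage⟩ := hyes hok
  rw [if_neg hok] at hH
  have hf : Function.Injective (σ.arr 8 ∘ (Fin.val : Fin (σ.reg 14) → ℕ)) :=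
    fun i j hij => Fin.ext (hinj i.2 j.2 hij)
  have hrange : Set.range (σ.arr 8 ∘ (Fin.val : Fin (σ.reg 14) → ℕ)) = kept G n (σ.reg 10) := by
    rw [Set.range_comp, ← himage]
    congr 1
    ext i
    simp
  obtain ⟨hv, hcover⟩ := h13.1 hok
  have hthin : thinness ((G.comap (σ.arr 8)).comap (Fin.val : Fin (σ.reg 14) → ℕ)) ≤ σ.reg 15 ↔
      ThinOn G (Finset.range n : Set ℕ) (σ.reg 7) := by
    have hcard := thinness_le_card ((G.comap (σ.arr 8)).comap (Fin.val : Fin (σ.reg 14) → ℕ))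
    rw [Fintype.card_fin] at hcard
    rw [e15, le_min_iff, and_iff_right hcard, SimpleGraph.comap_comap, thinness_comap_le_iff G hf,
      hrange, kept]
    split_ifs
    · exact thinOn_reps_iff _
    · exact Iff.rfl
  have hcov : coverNumber tw _ ((G.comap (σ.arr 8)).comap (Fin.val : Fin (σ.reg 14) → ℕ)) ≤ k ↔
      ∃ C : Finset ℕ, C.card ≤ k ∧ IsCover tw G (kept G n (σ.reg 10) : Set ℕ) C := by
    rw [SimpleGraph.comap_comap, coverNumber_comap_le_iff tw G hf, hrange]
  have hmem : (x, k) ∈ thinnessProblem (coverNumber tw) ↔ (∃ C : Finset ℕ, C.card ≤ k ∧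
      IsCover tw G (Finset.range n : Set ℕ) C) ∧ ThinOn G (Finset.range n : Set ℕ) (σ.reg 7) := by
    rw [hval hv, encode_mem_thinnessProblem, coverNumber_comap_le_iff tw G Fin.val_injective,
      thinness_comap_le_iff G Fin.val_injective, hval_range]
  have hcov' : σ.reg 10 = 0 → (∃ C : Finset ℕ, C.card ≤ k ∧
      IsCover tw G (Finset.range n : Set ℕ) C) := fun hs => hcover.resolve_left (by simpa using hs)
  have hcov'' : σ.reg 10 = 0 → (∃ C : Finset ℕ, C.card ≤ k ∧
      IsCover tw G (kept G n (σ.reg 10) : Set ℕ) C) := fun hs => by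
    obtain ⟨C, hC, hC'⟩ := hcov' hs
    exact ⟨C, hC, hC'.mono (by exact_mod_cast kept_subset _ _ _)⟩
  refine ⟨⟨G.comap (σ.arr 8), hH, ?_, fun hs => hcov.2 (hcov'' hs)⟩, ?_, ?_,
    e14.trans_le (hkept.trans (hle.trans (Nat.le_succ _)))⟩
  · rw [hmem, hthin, hcov]
    refine and_congr_left fun _ => ?_
    by_cases hs : σ.reg 10 = 0
    · exact iff_of_true (hcov' hs) (hcov'' hs)
    · rw [kept, if_neg hs]
  rotate_left
  · rw [e15]
    exact min_le_left _ _
  · rw [e14]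
    by_cases hs : σ.reg 10 = 0
    · obtain ⟨C, hC, hC'⟩ := hcov' hs
      have h1 := card_reps_le hC'.isTwinCover
      have h2 : 2 ^ C.card ≤ 2 ^ k := Nat.pow_le_pow_right (by decide) hC
      have h3 : k < 2 ^ k := Nat.lt_two_pow_self
      rw [kept, if_pos hs]
      omega
    · have := hsm hpow (h10 ▸ hs)
      omega

end

/-! ### The kernelization -/

section

/-- Two straight-line programs, of which the second may overwrite what the first has read, run in
polynomial time in a bound on the loops. -/
theorem runs_compAll_seq {p q : List Stmt} {d : ℕ} {S S' : List ℕ} {B : ℕ}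
    (hp : wf d S p = true) (hp' : ssa p = true) (hq : wf d S' q = true) (hq' : ssa q = true)
    {s : State} (h1 : ∀ r ∈ S, s.reg r ≤ B) (h2 : ∀ r ∈ S, (runAll p s).reg r ≤ B)
    (h3 : ∀ r ∈ S', (runAll p s).reg r ≤ B) (h4 : ∀ r ∈ S', (runAll q (runAll p s)).reg r ≤ B) :
    Runs (.seq (compAll d p) (compAll d q)) s (costAll B p + costAll B q)
      (Agree d (runAll q (runAll p s))) :=
  Runs.seq (runs_compAll hp hp' ⟨rfl, fun _ _ => rfl⟩ h1 h2) fun _ hs' =>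
    runs_compAll hq hq' hs' h3 h4

theorem exists_costAll_add_le (p q : List Stmt) :
    ∃ c, ∀ B F Y, B + 1 ≤ F * Y ^ 2 → costAll B p + costAll B q ≤ c * F ^ c * Y ^ (2 * c) := by
  obtain ⟨c, hc⟩ := exists_costAll_le p
  obtain ⟨c', hc'⟩ := exists_costAll_le q
  refine ⟨c + c', fun B F Y hB => ?_⟩
  have h1 : c * (B + 1) ^ c ≤ c * (B + 1) ^ (c + c') :=
    Nat.mul_le_mul_left _ (Nat.pow_le_pow_right (by omega) (by omega))
  have h2 : c' * (B + 1) ^ c' ≤ c' * (B + 1) ^ (c + c') :=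
    Nat.mul_le_mul_left _ (Nat.pow_le_pow_right (by omega) (by omega))
  calc costAll B p + costAll B q ≤ (c + c') * (B + 1) ^ (c + c') := by
        rw [add_mul]
        exact Nat.add_le_add ((hc B).trans h1) ((hc' B).trans h2)
    _ ≤ (c + c') * (F * Y ^ 2) ^ (c + c') := Nat.mul_le_mul_left _ (Nat.pow_le_pow_left hB _)
    _ = _ := by rw [mul_pow, ← pow_mul, mul_assoc]

/-- A straight-line program that does not write into the input leaves it as it is. -/
theorem runAll_initState {p : List Stmt} (x : List Bool) (k : ℕ)
    (h0 : ∀ st ∈ p, 0 ∉ st.regTarget) (h1 : ∀ st ∈ p, 1 ∉ st.regTarget)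
    (h2 : ∀ st ∈ p, 0 ∉ st.arrTarget) :
    (runAll p (initState (x, k))).reg 0 = x.length ∧ (runAll p (initState (x, k))).reg 1 = k ∧
      ∀ i, (runAll p (initState (x, k))).arr 0 i = if x[i]? = some true then 1 else 0 := by
  rw [runAll_reg h0, runAll_reg h1, runAll_arr h2]
  simp [initState]

theorem initState_reg_le (x : List Bool) (k : ℕ) {r : ℕ} (h : r ≠ 1) :
    (initState (x, k)).reg r ≤ x.length := by
  simp only [initState, if_neg h]
  split_ifs <;> simp

/-- At most `2 ^ k` vertices. If there are more, then `4 ^ k` is at most quadratic in their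
number. -/
def isSmall : Expr := le (reg 6) (load 2 (sub (reg 6) (sub (reg 6) (reg 1))))

/-- The length of the output and its bits. -/
def output : List Stmt := [
  set 18 (add (add (reg 14) (reg 15)) (add (reg 16) (const 2))),
  tab 10 18 30 (or (lt (reg 30) (reg 14))
    (or (and (lt (reg 14) (reg 30)) (lt (reg 30) (add (add (reg 14) (reg 15)) (const 1))))
      (and (le (add (add (reg 14) (reg 15)) (const 2)) (reg 30))
        (load 9 (sub (reg 30) (add (add (reg 14) (reg 15)) (const 2)))))))]

/-- Replacing the input by the output. -/
def overwrite : List Stmt := [tab 0 18 30 (load 10 (reg 30)), set 0 (reg 18)]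

theorem eval_isSmall {σ : State} (h : ∀ i ≤ σ.reg 6, σ.arr 2 i = 2 ^ i) :
    isSmall.eval σ ≠ 0 ↔ σ.reg 6 ≤ 2 ^ σ.reg 1 := by
  have hle : σ.reg 6 - (σ.reg 6 - σ.reg 1) ≤ σ.reg 6 := Nat.sub_le _ _
  simp only [isSmall, eval_le, eval_load, eval_sub, eval_reg, h _ hle, ne_eq, ite_eq_right_iff,
    one_ne_zero, imp_false, not_not]
  rcases le_total (σ.reg 1) (σ.reg 6) with h' | h'
  · rw [Nat.sub_sub_self h']
  · rw [Nat.sub_eq_zero_of_le h', Nat.sub_zero]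
    have h1 : σ.reg 6 < 2 ^ σ.reg 6 := Nat.lt_two_pow_self
    have h2 : 2 ^ σ.reg 6 ≤ 2 ^ σ.reg 1 := Nat.pow_le_pow_right (by decide) h'
    exact iff_of_true h1.le (h1.le.trans h2)

theorem output_spec {σ s₀ : State} (h : ∀ st ∈ output, st.Sat s₀ σ) {H : SimpleGraph ℕ}
    (hH : IsMatrix (σ.reg 14) (σ.arr 9) H.Adj) (h16 : σ.reg 16 = σ.reg 14 * σ.reg 14) :
    σ.reg 18 = (encode (H.comap (Fin.val : Fin (σ.reg 14) → ℕ)) (σ.reg 15)).length ∧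
      ∀ i < σ.reg 18, σ.arr 10 i =
        if (encode (H.comap (Fin.val : Fin (σ.reg 14) → ℕ)) (σ.reg 15))[i]? = some true
          then 1 else 0 := by
  simp only [output, List.forall_mem_cons, Sat] at h
  obtain ⟨h18, ha, -⟩ := h
  obtain ⟨hlen, a1, a2, a3, a4, a5⟩ :=
    (eq_encode_iff (H.comap (Fin.val : Fin (σ.reg 14) → ℕ)) (σ.reg 15) _).1 rfl
  set e := encode (H.comap (Fin.val : Fin (σ.reg 14) → ℕ)) (σ.reg 15)
  have h18' : σ.reg 18 = e.length := by
    rw [hlen, h18]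
    simp
    omega
  refine ⟨h18', fun i hi => ?_⟩
  rw [ha i hi]
  simp only [eval_or]
  refine if_congr ?_ rfl rfl
  have key : (i < σ.reg 14 ∨ (σ.reg 14 < i ∧ i < σ.reg 14 + σ.reg 15 + 1) ∨
      (σ.reg 14 + σ.reg 15 + 2 ≤ i ∧ σ.arr 9 (i - (σ.reg 14 + σ.reg 15 + 2)) ≠ 0)) ↔
      e[i]? = some true := by
    rcases lt_or_ge i (σ.reg 14) with c1 | c1
    · exact iff_of_true (.inl c1) (a1 i c1)
    rcases c1.eq_or_lt with rfl | c1
    · exact iff_of_false (by omega) a2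
    rcases lt_or_ge i (σ.reg 14 + 1 + σ.reg 15) with c2 | c2
    · refine iff_of_true (.inr (.inl (by omega))) ?_
      have := a3 (i - (σ.reg 14 + 1)) (by omega)
      rwa [Nat.add_sub_cancel' (by omega)] at this
    rcases c2.eq_or_lt with rfl | c2
    · exact iff_of_false (by omega) a4
    obtain ⟨j, rfl⟩ : ∃ j, i = σ.reg 14 + σ.reg 15 + 2 + j := Nat.exists_eq_add_of_le (by omega)
    have hj : j < σ.reg 14 * σ.reg 14 := by omega
    have hn : 0 < σ.reg 14 := Nat.pos_of_ne_zero fun h0 => by simp [h0] at hj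
    have hu : j / σ.reg 14 < σ.reg 14 := Nat.div_lt_of_lt_mul hj
    have hv : j % σ.reg 14 < σ.reg 14 := Nat.mod_lt _ hn
    have h1 := a5 ⟨_, hu⟩ ⟨_, hv⟩
    have h2 := hH _ hu _ hv
    simp only [Nat.div_add_mod', SimpleGraph.comap_adj] at h1 h2
    rw [h1, ← h2, Nat.add_sub_cancel_left]
    constructor
    · rintro (h | h | h)
      · omega
      · omega
      · exact h.2
    · exact fun h => .inr (.inr ⟨by omega, h⟩)
  rw [← key]
  simp
  omega

/-- The straight-line program of the kernelization. -/
def kernelize (tw : Bool) : List Stmt := core tw isSmall ++ output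

theorem exists_thinnessKernel_run (tw : Bool) (x : List Bool) (k : ℕ) :
    ∃ (σ : State) (n t : ℕ) (H : SimpleGraph (Fin n)),
      Runs (.seq (compAll 60 (kernelize tw)) (compAll 60 overwrite)) (initState (x, k))
        (costAll ((x.length + 3) ^ 2) (kernelize tw) + costAll ((x.length + 3) ^ 2) overwrite)
        (Agree 60 σ) ∧ Outputs σ (encode H t, k) ∧ n ≤ 3 * 2 ^ k ∧ t ≤ n ∧
      ((encode H t, k) ∈ thinnessProblem (coverNumber tw) ↔
        (x, k) ∈ thinnessProblem (coverNumber tw)) := by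
  have hssa : ssa (kernelize tw) = true := by cases tw <;> decide
  have hwf : wf 60 [0, 2, 6, 8, 9, 12, 14, 16, 18] (kernelize tw) = true := by cases tw <;> decide
  obtain ⟨hL, hk, hx⟩ := runAll_initState (p := kernelize tw) x k (by cases tw <;> decide)
    (by cases tw <;> decide) (by cases tw <;> decide)
  have hsat := sat_runAll hssa (initState (x, k))
  have hruns := fun B => runs_compAll_seq (S' := [18]) (q := overwrite) (s := initState (x, k))
    (B := B) hwf hssa (by decide) (by decide)
  generalize runAll (kernelize tw) (initState (x, k)) = σ at *
  simp only [kernelize, List.forall_mem_append] at hsat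
  obtain ⟨⟨H, hH, hiff, -⟩, b14, b15, b2, b6, e8, e9, b14', e16, hpow, e10, hQ, hQk⟩ :=
    core_spec hsat.1 hL hk hx (fun _ => by simp [initState])
      (fun hpow h => hk ▸ (eval_isSmall hpow).1 h)
  obtain ⟨e18, hbits⟩ := output_spec hsat.2 hH e16
  have hsat' := sat_runAll (p := overwrite) (by decide) σ
  have h18 : (runAll overwrite σ).reg 18 = σ.reg 18 := runAll_reg (by decide) _
  have h10 : (runAll overwrite σ).arr 10 = σ.arr 10 := runAll_arr (by decide) _
  have h1 : (runAll overwrite σ).reg 1 = σ.reg 1 := runAll_reg (by decide) _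
  generalize runAll overwrite σ = σ' at *
  simp only [overwrite, List.forall_mem_cons, Sat] at hsat'
  -- All loops are bounded: if the matching is used, then `2 ^ k` is less than the number of
  -- vertices.
  have hQ' : σ.reg 12 ≤ x.length * x.length := by
    by_cases hs : σ.reg 10 = 0
    · rw [e10] at hs
      have hlt : 2 ^ k < σ.reg 6 := by
        rw [← hk]
        exact not_le.1 fun h => (eval_isSmall hpow).2 h hs
      calc σ.reg 12 ≤ 2 ^ k * 2 ^ k := by rwa [← pow_add]
        _ ≤ x.length * x.length := Nat.mul_le_mul (hlt.le.trans b6) (hlt.le.trans b6)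
    · rw [hQ hs]
      exact Nat.zero_le _
  have b8 : σ.reg 8 ≤ x.length * x.length := e8 ▸ Nat.mul_le_mul b6 b6
  have b16 : σ.reg 16 ≤ (x.length + 1) * (x.length + 1) := e16 ▸ Nat.mul_le_mul b14' b14'
  have e18' := e18
  rw [length_encode] at e18'
  have hB : ∀ r ∈ [0, 2, 6, 8, 9, 12, 14, 16, 18], σ.reg r ≤ (x.length + 3) ^ 2 := by
    have hsq : (x.length + 3) ^ 2 = x.length * x.length + 6 * x.length + 9 := by ring
    have hsq' : (x.length + 1) * (x.length + 1) = x.length * x.length + 2 * x.length + 1 := by ring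
    simp only [List.forall_mem_cons, hsq]
    refine ⟨?_, ?_, ?_, ?_, ?_, ?_, ?_, ?_, ?_, by simp⟩ <;> omega
  refine ⟨σ', _, _, H.comap (Fin.val : Fin (σ.reg 14) → ℕ), hruns _ (fun r hr => ?_) hB
    (fun r hr => hB r (by simp_all)) ?_, ⟨?_, ?_, ?_⟩, b14, b15, ?_⟩
  · refine (initState_reg_le x k ?_).trans (hL ▸ hB 0 (by simp))
    rintro rfl
    simp at hr
  · simpa [h18] using hB 18 (by simp)
  · rw [hsat'.2.1]
    simp [h18, e18]
  · simp [h1, hk]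
  · intro i hi
    have hi' : i < σ.reg 18 := hi.trans_eq e18.symm
    rw [hsat'.1 i (by omega)]
    simpa [h10] using hbits i hi'
  · rw [encode_mem_thinnessProblem, hiff]

theorem hasThinnessKernel (tw : Bool) : HasThinnessKernel (coverNumber tw) fun k => 3 * 2 ^ k := by
  choose σ n t H hrun hout hn ht hiff using exists_thinnessKernel_run tw
  have hk : ∀ k : ℕ, k ≤ 3 * 2 ^ k := fun k => by
    have : k < 2 ^ k := Nat.lt_two_pow_self
    omega
  refine ⟨fun I => (encode (H I.1 I.2) (t I.1 I.2), I.2), ⟨?_, fun I => hiff I.1 I.2, ?_⟩,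
    fun x k => ⟨n x k, H x k, t x k, rfl, hn x k, (ht x k).trans (hn x k), hk k⟩⟩
  · obtain ⟨c, hc⟩ := exists_costAll_add_le (kernelize tw) overwrite
    refine ⟨.seq (compAll 60 (kernelize tw)) (compAll 60 overwrite), c * 10 ^ c + 2 * c,
      fun x k => ?_⟩
    obtain ⟨T, s, hT, hle, harr, hreg⟩ := hrun x k
    obtain ⟨h0, h1, h2⟩ := hout x k
    refine ⟨T, s, hT, hle.trans ?_, ?_, ?_, ?_⟩
    · refine (hc ((x.length + 3) ^ 2) 10 (x.length + 1) ?_).trans ?_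
      · have : 10 * (x.length + 1) ^ 2 =
            (x.length + 3) ^ 2 + 1 + (9 * x.length * x.length + 14 * x.length) := by ring
        exact this ▸ Nat.le_add_right _ _
      have hY : x.length + 1 ≤ x.length + k.size + 1 := by omega
      exact Nat.mul_le_mul (Nat.le_add_right _ _) ((Nat.pow_le_pow_left hY _).trans
        (Nat.pow_le_pow_right (by omega) (Nat.le_add_left _ _)))
    · rw [hreg 0 (by decide), h0]
    · rw [hreg 1 (by decide), h1]
    · rwa [harr]
  · have hpow : Primrec fun k : ℕ => 3 * 2 ^ k :=
      Primrec.nat_mul.comp (.const 3) ((Primrec₂.unpaired'.1 Nat.Primrec.pow).comp (.const 2) .id)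
    refine ⟨fun k => 3 * 2 ^ k + 3 * 2 ^ k + 3 * 2 ^ k * (3 * 2 ^ k) + 2, ?_, fun x k => ⟨?_, ?_⟩⟩
    · exact (Primrec.nat_add.comp (Primrec.nat_add.comp (Primrec.nat_add.comp hpow hpow)
        (Primrec.nat_mul.comp hpow hpow)) (.const 2)).to_comp
    · rw [length_encode]
      have h1 := hn x k
      have h2 := (ht x k).trans h1
      have h3 := Nat.mul_le_mul h1 h1
      dsimp only
      omega
    · have := hk k
      dsimp only
      omega

end

/-! ### The decision procedure -/

section

/-- The position of the vertex in register `v` in the order coded by register 35. -/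
def posE (v : ℕ) : Expr := digit 19 14 35 (load 10 (reg v))

/-- The class of the vertex in register `v` in the partition coded by register 36. -/
def colE (v : ℕ) : Expr := digit 19 14 36 (load 10 (reg v))

/-- The powers of the number of vertices, and the search for an order and a partition that show that
the reduced graph is thin. -/
def search : List Stmt := [
  set 18 (add (reg 14) (const 1)),
  tab 10 18 30 (ite (reg 30) (letE 36 (load 10 (sub (reg 30) (const 1))) (mul 14 14 36)) (const 1)),
  set 19 (load 10 (reg 14)),
  set 20 (ex 35 19 (ex 36 19 (and (all 31 14 (all 32 14 (imp (eq (posE 31) (posE 32))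
    (eq (reg 31) (reg 32))))) (and (all 31 14 (lt (colE 31) (reg 15)))
      (all 31 14 (all 32 14 (all 33 14 (imp (lt (posE 31) (posE 32)) (imp (lt (posE 32) (posE 33))
        (imp (eq (colE 31) (colE 32)) (imp (entry 9 14 31 33) (entry 9 14 32 33))))))))))))]

theorem search_spec {n : ℕ} {σ s₀ : State} (h : ∀ st ∈ search, st.Sat s₀ σ) (hn : σ.reg 14 = n)
    (ht : σ.reg 15 ≤ n) {H : SimpleGraph ℕ} (hH : IsMatrix n (σ.arr 9) H.Adj) :
    σ.reg 18 = n + 1 ∧ σ.reg 19 = n ^ n ∧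
      (σ.reg 20 ≠ 0 ↔ thinness (H.comap (Fin.val : Fin n → ℕ)) ≤ σ.reg 15) := by
  classical
  simp only [search, List.forall_mem_cons, Sat] at h
  obtain ⟨h18, ha, h19, h20, -⟩ := h
  have h18' : σ.reg 18 = n + 1 := by rw [h18]; simp [hn]
  have hpow : ∀ i ≤ n, σ.arr 10 i = n ^ i := by
    intro i hi
    induction i with
    | zero =>
      rw [ha _ (by omega)]
      simp
    | succ i ih =>
      rw [ha _ (by omega), eval_ite, eval_letE, eval_mul (by decide) (by decide) (by simp)]
      simp [ih (by omega), hn, pow_succ, mul_comm]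
  have h19' : σ.reg 19 = n ^ n := by rw [h19]; simp [hn, hpow]
  refine ⟨h18', h19', ?_⟩
  have hdig : ∀ (s : State) (r x u : ℕ), r < 37 → s.arr 10 = σ.arr 10 → s.reg 14 = n →
      s.reg 19 = n ^ n → s.reg r < n ^ n → s.reg x = u → u < n →
      (digit 19 14 r (load 10 (reg x))).eval s = s.reg r / n ^ u % n := by
    intro s r x u hr harr e14 e19 hlt e hu
    have e1 : (load 10 (reg x)).eval s = n ^ u := by simp [harr, e, hpow u hu.le]
    rw [eval_digit (by decide) (by decide) hr (by omega)
      (by rw [e1]; exact Nat.pow_pos (by omega)) (by omega), e1, e14]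
  have hent : ∀ (s : State) (x y u v : ℕ), x ≠ 40 → s.arr 9 = σ.arr 9 → s.reg 14 = n →
      s.reg x = u → s.reg y = v → u < n → v < n →
      ((entry 9 14 x y).eval s = 0 ↔ ¬ H.Adj u v) := by
    rintro s x y u v hx h1 h2 rfl rfl h3 h4
    exact IsMatrix.eval_entry hx (by decide) (h1 ▸ hH) h2 h3 h4
  -- The two codes are numbers with `n` digits in base `n`.
  have h20' : σ.reg 20 ≠ 0 ↔ ∃ p < n ^ n, ∃ c < n ^ n,
      (∀ u < n, ∀ v < n, p / n ^ u % n = p / n ^ v % n → u = v) ∧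
      (∀ u < n, c / n ^ u % n < σ.reg 15) ∧ ∀ u < n, ∀ v < n, ∀ w < n,
        p / n ^ u % n < p / n ^ v % n → p / n ^ v % n < p / n ^ w % n →
        c / n ^ u % n = c / n ^ v % n → H.Adj u w → H.Adj v w := by
    rw [h20]
    simp only [eval_ex, eval_and, eval_all, eval_imp, eval_lt, eval_eq, eval_reg, State.setReg_reg,
      hn, h19', posE, colE]
    simp only [ite_eq_right_iff, one_ne_zero, imp_false, not_not, ne_eq, reduceIte,
      Nat.reduceEqDiff]
    refine exists_congr fun p => and_congr_right fun hp => exists_congr fun c =>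
      and_congr_right fun hc => and_congr ?_ (and_congr ?_ ?_)
    · refine forall_congr' fun u => forall_congr' fun hu => forall_congr' fun v =>
        forall_congr' fun hv => ?_
      rw [hdig _ _ _ u, hdig _ _ _ v] <;> simp [hn, h19', hp, hu, hv]
    · refine forall_congr' fun u => forall_congr' fun hu => ?_
      rw [hdig _ _ _ u] <;> simp [hn, h19', hc, hu]
    · refine forall_congr' fun u => forall_congr' fun hu => forall_congr' fun v =>
        forall_congr' fun hv => forall_congr' fun w => forall_congr' fun hw => ?_
      rw [hdig _ 35 31 u, hdig _ 35 32 v, hdig _ 35 33 w, hdig _ 36 31 u, hdig _ 36 32 v,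
        hent _ 31 33 u w, hent _ 32 33 v w] <;> simp [hn, h19', hp, hc, hu, hv, hw]
  rw [h20', thinness_le_iff, isThin_iff]
  constructor
  · rintro ⟨p, -, c, -, h1, h2, h3⟩
    refine ⟨fun v => p / n ^ (v : ℕ) % n, fun v => c / n ^ (v : ℕ) % n,
      fun u v huv => Fin.ext (h1 u u.2 v v.2 huv), fun v => ?_, fun v => h2 v v.2,
      fun u v w => h3 u u.2 v v.2 w w.2⟩
    rw [Fintype.card_fin]
    exact Nat.mod_lt _ v.pos
  · rintro ⟨pos, c, h1, h2, h3, h4⟩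
    rw [Fintype.card_fin] at h2
    obtain ⟨p, hp, hp'⟩ := exists_digits (b := n) (d := n)
      (f := fun i => if hi : i < n then pos ⟨i, hi⟩ else 0) fun i hi => by simp [hi, h2]
    obtain ⟨q, hq, hq'⟩ := exists_digits (b := n) (d := n)
      (f := fun i => if hi : i < n then c ⟨i, hi⟩ else 0)
      fun i hi => by simpa [hi] using (h3 ⟨i, hi⟩).trans_le ht
    refine ⟨p, hp, q, hq, fun u hu v hv => ?_, fun u hu => ?_, fun u hu v hv w hw => ?_⟩
    · rw [hp' u hu, hp' v hv, dif_pos hu, dif_pos hv]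
      exact fun huv => congrArg Fin.val (h1 huv)
    · rw [hq' u hu, dif_pos hu]
      exact h3 _
    · rw [hp' u hu, hp' v hv, hp' w hw, hq' u hu, hq' v hv, dif_pos hu, dif_pos hv, dif_pos hw,
        dif_pos hu, dif_pos hv]
      exact h4 ⟨u, hu⟩ ⟨v, hv⟩ ⟨w, hw⟩

/-- The straight-line program of the decision procedure. -/
def decision (tw : Bool) : List Stmt := core tw (const 0) ++ search

set_option maxRecDepth 4000 in
theorem exists_decision_run (tw : Bool) (x : List Bool) (k : ℕ) :
    ∃ σ : State, Runs (.seq (compAll 60 (decision tw)) (compAll 60 [set 0 (reg 20)]))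
      (initState (x, k)) (costAll ((x.length + 3) ^ 2 + (2 ^ (k + k) + (3 * 2 ^ k) ^ (3 * 2 ^ k)))
        (decision tw) + costAll ((x.length + 3) ^ 2 + (2 ^ (k + k) + (3 * 2 ^ k) ^ (3 * 2 ^ k)))
        [set 0 (reg 20)]) (Agree 60 σ) ∧
      (σ.reg 0 ≠ 0 ↔ (x, k) ∈ thinnessProblem (coverNumber tw)) := by
  have hssa : ssa (decision tw) = true := by cases tw <;> decide
  have hwf : wf 60 [0, 2, 6, 8, 9, 12, 14, 16, 18, 19] (decision tw) = true := by
    cases tw <;> decide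
  obtain ⟨hL, hk, hx⟩ := runAll_initState (p := decision tw) x k (by cases tw <;> decide)
    (by cases tw <;> decide) (by cases tw <;> decide)
  have hsat := sat_runAll hssa (initState (x, k))
  have hruns := fun B => runs_compAll_seq (S' := []) (q := [set 0 (reg 20)])
    (s := initState (x, k)) (B := B) hwf hssa (by decide) (by decide)
  generalize runAll (decision tw) (initState (x, k)) = σ at *
  simp only [decision, List.forall_mem_append] at hsat
  obtain ⟨⟨H, hH, hiff, hcov⟩, b14, b15, b2, b6, e8, e9, b14', e16, hpow, e10, -, hQk⟩ :=
    core_spec hsat.1 hL hk hx (fun _ => by simp [initState]) (fun _ h => absurd (by simp) h)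
  obtain ⟨e18, e19, h20⟩ := search_spec hsat.2 rfl b15 hH
  have b8 : σ.reg 8 ≤ x.length * x.length := e8 ▸ Nat.mul_le_mul b6 b6
  have b16 : σ.reg 16 ≤ (x.length + 1) * (x.length + 1) := e16 ▸ Nat.mul_le_mul b14' b14'
  have b19 : σ.reg 19 ≤ (3 * 2 ^ k) ^ (3 * 2 ^ k) := by
    rw [e19]
    exact (Nat.pow_le_pow_left b14 _).trans (Nat.pow_le_pow_right (by positivity) b14)
  generalize (3 * 2 ^ k) ^ (3 * 2 ^ k) = M at *
  have hB : ∀ r ∈ [0, 2, 6, 8, 9, 12, 14, 16, 18, 19], σ.reg r ≤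
      (x.length + 3) ^ 2 + (2 ^ (k + k) + M) := by
    have hsq : (x.length + 3) ^ 2 = x.length * x.length + 6 * x.length + 9 := by ring
    have hsq' : (x.length + 1) * (x.length + 1) = x.length * x.length + 2 * x.length + 1 := by ring
    simp only [List.forall_mem_cons, hsq]
    refine ⟨?_, ?_, ?_, ?_, ?_, ?_, ?_, ?_, ?_, ?_, by simp⟩ <;> omega
  refine ⟨_, hruns _ (fun r hr => ?_) hB (by simp) (by simp), ?_⟩
  · refine (initState_reg_le x k ?_).trans (hL ▸ hB 0 (by simp))
    rintro rfl
    simp at hr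
  · rw [hiff, and_iff_right (hcov (by simpa using e10)), ← h20]
    simp [runAll, Stmt.run]

theorem isFPT (tw : Bool) : IsFPT (thinnessProblem (coverNumber tw)) := by
  obtain ⟨c, hc⟩ := exists_costAll_add_le (decision tw) [set 0 (reg 20)]
  have hpow : Primrec₂ fun a b : ℕ => a ^ b := Primrec₂.unpaired'.1 Nat.Primrec.pow
  have hM : Primrec fun k : ℕ => 3 * 2 ^ k :=
    Primrec.nat_mul.comp (.const 3) (hpow.comp (.const 2) .id)
  refine ⟨.seq (compAll 60 (decision tw)) (compAll 60 [set 0 (reg 20)]),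
    fun k => c * (10 + (2 ^ (k + k) + (3 * 2 ^ k) ^ (3 * 2 ^ k))) ^ c, 2 * c, ?_, fun x k => ?_⟩
  · exact (Primrec.nat_mul.comp (.const c) (hpow.comp (Primrec.nat_add.comp (.const 10)
      (Primrec.nat_add.comp (hpow.comp (.const 2) (Primrec.nat_add.comp .id .id))
        (hpow.comp hM hM))) (.const c))).to_comp
  · obtain ⟨σ, ⟨T, s, hT, hle, -, hreg⟩, hσ⟩ := exists_decision_run tw x k
    refine ⟨T, s, hT, hle.trans (hc _ _ _ ?_), ?_⟩
    · generalize 2 ^ (k + k) + (3 * 2 ^ k) ^ (3 * 2 ^ k) = M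
      have : (10 + M) * (x.length + 1) ^ 2 = (x.length + 3) ^ 2 + M + 1 +
          (9 * x.length * x.length + 14 * x.length + M * (x.length * x.length + 2 * x.length)) := by
        ring
      exact this ▸ Nat.le_add_right _ _
    · rw [hreg 0 (by decide), hσ]

end

/-! ### The cluster-modular cardinality -/

section

variable {V : Type*}

theorem isCluster_of_adj_trans {G : SimpleGraph V}
    (h : ∀ a b c, G.Adj a b → G.Adj b c → a ≠ c → G.Adj a c) : IsCluster G := by
  rintro C u hu v hv huv
  have hr : G.Reachable u v := SimpleGraph.ConnectedComponent.exact (hu.trans hv.symm)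
  rw [SimpleGraph.reachable_iff_reflTransGen] at hr
  have key : u = v ∨ G.Adj u v := by
    clear hv huv
    induction hr with
    | refl => exact .inl rfl
    | @tail b c _ hbc ih =>
      by_cases huc : u = c
      · exact .inl huc
      · rcases ih with rfl | ih
        · exact .inr hbc
        · exact .inr (h _ _ _ ih hbc huc)
  exact key.resolve_left huv

open Classical in
/-- The vertices of the twin-cover `X` are separated from everything else, and the other vertices
are classified by their neighbours in `X`. -/
noncomputable def trace (G : SimpleGraph V) (X : Finset V) (v : V) : V ⊕ Finset V :=
  if v ∈ X then .inl v else .inr (X.filter (G.Adj v))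

theorem trace_eq_of_twins {G : SimpleGraph V} {X : Finset V} {a b : V} (ha : a ∉ X) (hb : b ∉ X)
    (h : closedNeighborSet G a = closedNeighborSet G b) : trace G X a = trace G X b := by
  classical
  rw [trace, trace, if_neg ha, if_neg hb]
  refine congrArg Sum.inr (Finset.filter_congr fun w hw => ?_)
  have h1 := Set.ext_iff.1 h w
  have hwa : w ≠ a := fun h => ha (h ▸ hw)
  have hwb : w ≠ b := fun h => hb (h ▸ hw)
  simpa [closedNeighborSet, hwa, hwb] using h1

/-- A twin-cover and the classes of the other vertices with respect to their neighbours in it form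
a partition into modules that induce cluster graphs. -/
theorem clusterModularCardinality_le {G : SimpleGraph V} {X : Finset V}
    (hX : IsTwinCover G (X : Set V)) :
    clusterModularCardinality G ≤ 2 ^ X.card + X.card := by
  classical
  set f := trace G X with hf
  have hcl : (Setoid.ker f).classes = (fun l => f ⁻¹' {l}) '' Set.range f := by
    ext M
    simp only [Setoid.classes, Setoid.ker_def, Set.mem_ofPred_eq, Set.mem_image, Set.mem_range,
      exists_exists_eq_and]
    exact exists_congr fun v => eq_comm
  have hrange : Set.range f ⊆ ↑(X.powerset.image Sum.inr ∪ X.image Sum.inl) := by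
    rintro _ ⟨v, rfl⟩
    by_cases hv : v ∈ X <;> simp [hf, trace, hv]
  have hinl : ∀ {v x}, f v = .inl x ↔ v ∈ X ∧ v = x := by
    intro v x
    by_cases hv : v ∈ X <;> simp [hf, trace, hv]
  have hinr : ∀ {v N}, f v = .inr N → v ∉ X ∧ N = X.filter (G.Adj v) := by
    intro v N h
    by_cases hv : v ∈ X
    · simp [hf, trace, hv] at h
    · simp only [hf, trace, hv, if_false, Sum.inr.injEq] at h
      exact ⟨hv, h.symm⟩
  have htwin : ∀ a b, a ∉ X → b ∉ X → G.Adj a b → closedNeighborSet G a = closedNeighborSet G b :=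
    fun a b ha hb hab => ((hX a b hab).resolve_left ha).resolve_left hb
  have hmem : ∀ M ∈ (Setoid.ker f).classes, IsModule G M ∧ IsCluster (G.induce M) := by
    rw [hcl]
    rintro _ ⟨l, -, rfl⟩
    rcases l with x | N
    · have hsub : (f ⁻¹' {Sum.inl x}).Subsingleton := fun a ha b hb =>
        (hinl.1 ha).2.trans (hinl.1 hb).2.symm
      refine ⟨fun v _ => ?_, isCluster_of_adj_trans fun a b c _ _ hac =>
        absurd (Subtype.ext (hsub a.2 c.2)) hac⟩
      by_cases h : ∃ y ∈ f ⁻¹' {Sum.inl x}, G.Adj v y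
      · obtain ⟨y, hy, hvy⟩ := h
        exact .inl fun z hz => hsub hy hz ▸ hvy
      · exact .inr fun z hz hvz => h ⟨z, hz, hvz⟩
    · refine ⟨fun v hv => ?_, isCluster_of_adj_trans ?_⟩
      · by_cases hvX : v ∈ X
        · have hadj : ∀ z ∈ f ⁻¹' {Sum.inr N}, G.Adj v z ↔ v ∈ N := by
            intro z hz
            rw [(hinr hz).2]
            simp [hvX, G.adj_comm]
          by_cases hvN : v ∈ N
          · exact .inl fun z hz => (hadj z hz).2 hvN
          · exact .inr fun z hz => fun h => hvN ((hadj z hz).1 h)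
        · refine .inr fun z hz hvz => hv ?_
          have hzX := (hinr hz).1
          exact (trace_eq_of_twins hvX hzX (htwin v z hvX hzX hvz)).trans hz
      · rintro ⟨a, ha⟩ ⟨b, hb⟩ ⟨c, hc⟩ hab hbc hac
        simp only [SimpleGraph.comap_adj, Function.Embedding.subtype_apply, ne_eq,
          Subtype.mk.injEq] at hab hbc hac ⊢
        have hcb : c ∈ closedNeighborSet G b := .inr hbc
        rw [← htwin a b (hinr ha).1 (hinr hb).1 hab] at hcb
        exact hcb.resolve_left fun h => hac h.symm
  calc clusterModularCardinality G ≤ (Setoid.ker f).classes.ncard :=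
        Nat.sInf_le ⟨_, ⟨Setoid.isPartition_classes _, hmem⟩, rfl⟩
    _ ≤ (Set.range f).ncard := by
        rw [hcl]
        exact Set.ncard_image_le ((Finset.finite_toSet _).subset hrange)
    _ ≤ (X.powerset.image Sum.inr ∪ X.image Sum.inl : Finset (V ⊕ Finset V)).card := by
        rw [← Set.ncard_coe_finset]
        exact Set.ncard_le_ncard hrange (Finset.finite_toSet _)
    _ ≤ 2 ^ X.card + X.card := by
        refine (Finset.card_union_le _ _).trans (Nat.add_le_add ?_ Finset.card_image_le)
        exact Finset.card_image_le.trans (Finset.card_powerset X).le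

theorem clusterModularCardinality_le_of_isCover {G : SimpleGraph V} {k : ℕ} {tw : Bool}
    (h : ∃ C : Finset V, C.card ≤ k ∧ IsCover tw G Set.univ C) :
    clusterModularCardinality G ≤ 2 ^ k + k := by
  obtain ⟨C, hC, hcov⟩ := h
  exact (clusterModularCardinality_le (isTwinCover_iff.2 hcov.isTwinCover)).trans
    (Nat.add_le_add (Nat.pow_le_pow_right (by decide) hC) hC)

end

end ThinFPT

theorem mainTheorem8 :
    (∀ (V : Type*) [Finite V] (G : SimpleGraph V),
      ThinFPT.clusterModularCardinality G ≤
        2 ^ ThinFPT.twinCoverNumber G + ThinFPT.twinCoverNumber G) ∧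
    ThinFPT.IsFPT (ThinFPT.thinnessProblem fun _ G => ThinFPT.twinCoverNumber G) ∧
    (∃ C : ℕ, ThinFPT.HasThinnessKernel (fun _ G => ThinFPT.twinCoverNumber G)
      fun k => C * 2 ^ k) ∧
    (∀ (V : Type*) [Finite V] (G : SimpleGraph V),
      ThinFPT.clusterModularCardinality G ≤
        2 ^ ThinFPT.vertexCoverNumber G + ThinFPT.vertexCoverNumber G) ∧
    ThinFPT.IsFPT (ThinFPT.thinnessProblem fun _ G => ThinFPT.vertexCoverNumber G) ∧
    (∃ C : ℕ, ThinFPT.HasThinnessKernel (fun _ G => ThinFPT.vertexCoverNumber G)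
      fun k => C * 2 ^ k) :=
  ⟨fun _ _ G => ThinFPT.clusterModularCardinality_le_of_isCover
      ((ThinFPT.twinCoverNumber_le_iff G _).1 le_rfl),
    ThinFPT.isFPT true, ⟨3, ThinFPT.hasThinnessKernel true⟩,
    fun _ _ G => ThinFPT.clusterModularCardinality_le_of_isCover
      ((ThinFPT.vertexCoverNumber_le_iff G _).1 le_rfl),
    ThinFPT.isFPT false, ⟨3, ThinFPT.hasThinnessKernel false⟩⟩
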